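/- **Setting.** Let $(M^{2n+1},\xi)$ be a contact manifold: a smooth real $(2n+1)$-manifold with a smooth rank $2n$ subbundle $\xi\subset TM$ such that $\theta\wedge d\theta^n$ vanishes nowhere for every local one-form $\theta$ with $\ker\theta=\xi$ (a *local contact form*). Let $\mathscr A=\bigoplus_k\mathscr A^k$ be the space of smooth real differential forms, $\mu(\alpha\otimes\beta)=\alpha\wedge\beta$, and let $\mathscr A_0^k\subset\mathscr A^k$ be the space of vertical forms, i.e. those $\omega$ with $\theta\wedge\omega=0$ for all local contact forms $\theta$. The Rumin spaces are $\mathscr R=\bigoplus_k\mathscr R^k\subset\mathscr A$ with $$\mathscr R^k=\{\omega\in\mathscr A^k:\theta\wedge\omega\wedge d\theta^{n+1-k}=0,\ \theta\wedge d\omega\wedge d\theta^{n-k}=0\}\quad(k\le n),$$ $$\mathscr R^k=\{\omega\in\mathscr A^k:\theta\wedge\omega=0,\ \theta\wedge d\omega=0\}\quad(k\ge n+1),$$ the conditions being required for all local contact forms $\theta$. Let $i\colon\mathscr R\to\mathscr A$ be the inclusion. **Conventions.** An $A_\infty$-algebra is a $\mathbb Z$-graded vector space $A$ with maps $m_k\colon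 A^{\otimes k}\to A$ ($k\ge1$) of degree $2-k$ such that $\sum_{r+s+t=N}(-1)^{r+st}m_{r+1+t}(1^{\otimes r}\otimes m_s\otimes1^{\otimes t})=0$ for all $N\ge1$. An $A_\infty$-morphism $f\colon(A,m)\to(B,\overline m)$ consists of maps $f_k\colon A^{\otimes k}\to B$ of degree $1-k$ such that, for all $N\ge1$, $$\sum_{r+s+t=N}(-1)^{r+st}f_{r+1+t}(1^{\otimes r}\otimes m_s\otimes1^{\otimes t})=\sum_{i_1+\dots+i_r=N}(-1)^{\sum_j(r-j)(i_j-1)}\,\overline m_r(f_{i_1}\otimes\dots\otimes f_{i_r}).$$ Here $r,t\ge0$ and $s\ge1$ on the left-hand sides, $r,i_j\ge1$ on the right, and the Koszul rule $(f\otimes g)(\alpha\otimes\beta)=(-1)^{|g||\alpha|}f(\alpha)\otimes g(\beta)$ is used. They are a $C_\infty$-algebra, respectively (between $C_\infty$-algebras) a $C_\infty$-morphism, if moreover $m_{p+q}\circ\nu_{p,q}=0$, respectively $f_{p+q}\circ\nu_{p,q}=0$, for all $p,q\ge1$, where $\nu_{p,q}$ is the signed sum over $(p,q)$-shuffles (with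 the sign of the shuffle times the Koszul sign). A $C_\infty$-morphism $f$ is a $C_\infty$-quasi-isomorphism if $[\alpha]\mapsto[f_1\alpha]$ is an isomorphism of the cohomology algebras $(H(A,m_1),[m_2])\to(H(B,\overline m_1),[\overline m_2])$. **Theorem.** There is a unique linear map $\Gamma\colon\mathscr A\to\mathscr A$ with $\Gamma(\mathscr A^k)\subset\mathscr A_0^{k-1}$ for all $k$ such that for every $\omega\in\mathscr A^k$ and every local contact form $\theta$, on the domain of $\theta$: * if $k\le n$, then $\theta\wedge\omega\wedge d\theta^{n+1-k}=\Gamma\omega\wedge d\theta^{n+2-k}$; * if $k\ge n+1$, then $\Gamma\omega=\zeta\wedge d\theta^{k-n-1}$ for a $(2n+1-k)$-form $\zeta$ with $\theta\wedge\zeta=0$ and $\theta\wedge\omega=\zeta\wedge d\theta^{k-n}$ (in particular $\theta\wedge\omega=\Gamma\omega\wedge d\theta$). Set $\pi=1-d\Gamma-\Gamma d$. Then the formulas $$m_1=di,\qquad m_2=\pi\mu i^{\otimes2},\qquad m_3=\pi\mu(\Gamma\mu\otimes1-1\otimes\Gamma\mu)i^{\otimes3},\qquad m_k=0\ (k\ge4)$$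 define maps $\mathscr R^{\otimes k}\to\mathscr R$, and $(\mathscr R,m)$ is a $C_\infty$-algebra (the *Rumin algebra*). The de Rham algebra $(\mathscr A,d,\mu)$, with all higher operations zero, is a $C_\infty$-algebra, and the maps $f_k\colon\mathscr R^{\otimes k}\to\mathscr A$, $$f_1=i,\qquad f_2=-\Gamma\mu i^{\otimes2},\qquad f_k=0\ (k\ge3),$$ form a $C_\infty$-quasi-isomorphism $f\colon(\mathscr R,m)\to(\mathscr A,d,\mu)$. -/

import Mathlib

open scoped Manifold ContDiff Topology

noncomputable section

section Pointwise
variable {V : Type*} [AddCommGroup V] [Module ℝ V] [TopologicalSpace V]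
variable {W : Type*} [AddCommGroup W] [Module ℝ W] [TopologicalSpace W]

/-- Inhomogeneous exterior forms on `V`: a family consisting of one alternating `k`-form for every `k`.
For finite-dimensional `V` only finitely many of these can be nonzero, so that this is the
direct sum of the `Λ^k V*`. -/
abbrev ExtForm (V : Type*) [AddCommGroup V] [Module ℝ V] [TopologicalSpace V] : Type _ :=
  (k : ℕ) → V [⋀^Fin k]→L[ℝ] ℝ

/-- `a` has degree `z`: its components in all other degrees vanish (so `a = 0` if `z < 0`). -/
def ExtForm.IsHomogeneous (z : ℤ) (a : ExtForm V) : Prop :=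
  ∀ k : ℕ, (k : ℤ) ≠ z → a k = 0

/-- The exterior product of a `p`-form and a `q`-form: the sum over `(p, q)`-shuffles `σ` of
`sgn σ * a (v_{σ 1}, …, v_{σ p}) * b (v_{σ (p+1)}, …, v_{σ (p+q)})`. -/
def altWedge {p q k : ℕ} (h : p + q = k) (a : V [⋀^Fin p]→L[ℝ] ℝ) (b : V [⋀^Fin q]→L[ℝ] ℝ) :
    V [⋀^Fin k]→L[ℝ] ℝ :=
  { ((LinearMap.mul' ℝ ℝ).compAlternatingMap
      (a.toAlternatingMap.domCoprod b.toAlternatingMap)).domDomCongr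
      (finSumFinEquiv.trans (finCongr h)) with
    cont := by
      change Continuous fun v : Fin k → V => LinearMap.mul' ℝ ℝ
        ((∑ σ : Equiv.Perm.ModSumCongr (Fin p) (Fin q),
          AlternatingMap.domCoprod.summand a.toAlternatingMap b.toAlternatingMap σ)
          (fun i => v ((finSumFinEquiv.trans (finCongr h)) i)))
      simp only [sum_apply, map_sum]
      refine continuous_finsetSum _ fun σ _ => ?_
      induction σ using Quotient.inductionOn' with
      | h σ =>
        simp only [AlternatingMap.domCoprod.summand_mk'', smul_apply,
          MultilinearMap.domDomCongr_apply, MultilinearMap.domCoprod_apply, map_zsmul_unit,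
          LinearMap.mul'_apply]
        refine Continuous.const_smul (Continuous.mul ?_ ?_) _
        · exact a.cont.comp (continuous_pi fun i => continuous_apply _)
        · exact b.cont.comp (continuous_pi fun i => continuous_apply _) }

/-- The exterior product of inhomogeneous forms. -/
def ExtForm.wedge (a b : ExtForm V) : ExtForm V := fun k =>
  ∑ pq : Finset.HasAntidiagonal.antidiagonal k,
    altWedge (Finset.HasAntidiagonal.mem_antidiagonal.1 pq.2) (a pq.1.1) (b pq.1.2)

/-- `a.wedgePow b j` is `a ∧ b ∧ ⋯ ∧ b` with `j` factors `b`. -/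
def ExtForm.wedgePow (a b : ExtForm V) : ℕ → ExtForm V
  | 0 => a
  | j + 1 => (ExtForm.wedgePow a b j).wedge b

theorem altWedge_apply {p q k : ℕ} (h : p + q = k) (a : V [⋀^Fin p]→L[ℝ] ℝ)
    (b : V [⋀^Fin q]→L[ℝ] ℝ) (v : Fin k → V) :
    altWedge h a b v = LinearMap.mul' ℝ ℝ (a.toAlternatingMap.domCoprod b.toAlternatingMap
      (fun i => v ((finSumFinEquiv.trans (finCongr h)) i))) := rfl

theorem altWedge_add_left {p q k : ℕ} (h : p + q = k) (a a' : V [⋀^Fin p]→L[ℝ] ℝ)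
    (b : V [⋀^Fin q]→L[ℝ] ℝ) : altWedge h (a + a') b = altWedge h a b + altWedge h a' b := by
  ext v
  have := congrArg (fun f => LinearMap.mul' ℝ ℝ
    (f (fun i => v ((finSumFinEquiv.trans (finCongr h)) i))))
    (congrArg AlternatingMap.domCoprod'
      (TensorProduct.add_tmul a.toAlternatingMap a'.toAlternatingMap b.toAlternatingMap))
  simpa [altWedge_apply] using this

theorem altWedge_add_right {p q k : ℕ} (h : p + q = k) (a : V [⋀^Fin p]→L[ℝ] ℝ)
    (b b' : V [⋀^Fin q]→L[ℝ] ℝ) : altWedge h a (b + b') = altWedge h a b + altWedge h a b' := by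
  ext v
  have := congrArg (fun f => LinearMap.mul' ℝ ℝ
    (f (fun i => v ((finSumFinEquiv.trans (finCongr h)) i))))
    (congrArg AlternatingMap.domCoprod'
      (TensorProduct.tmul_add a.toAlternatingMap b.toAlternatingMap b'.toAlternatingMap))
  simpa [altWedge_apply] using this

theorem altWedge_smul_left {p q k : ℕ} (h : p + q = k) (c : ℝ) (a : V [⋀^Fin p]→L[ℝ] ℝ)
    (b : V [⋀^Fin q]→L[ℝ] ℝ) : altWedge h (c • a) b = c • altWedge h a b := by
  ext v
  have := congrArg (fun f => LinearMap.mul' ℝ ℝ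
    (f (fun i => v ((finSumFinEquiv.trans (finCongr h)) i))))
    ((AlternatingMap.domCoprod' (R' := ℝ)).map_smul c
      (a.toAlternatingMap ⊗ₜ[ℝ] b.toAlternatingMap))
  simpa [altWedge_apply, TensorProduct.smul_tmul'] using this

theorem altWedge_smul_right {p q k : ℕ} (h : p + q = k) (c : ℝ) (a : V [⋀^Fin p]→L[ℝ] ℝ)
    (b : V [⋀^Fin q]→L[ℝ] ℝ) : altWedge h a (c • b) = c • altWedge h a b := by
  ext v
  have := congrArg (fun f => LinearMap.mul' ℝ ℝ
    (f (fun i => v ((finSumFinEquiv.trans (finCongr h)) i))))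
    ((AlternatingMap.domCoprod' (R' := ℝ)).map_smul c
      (a.toAlternatingMap ⊗ₜ[ℝ] b.toAlternatingMap))
  rw [← TensorProduct.tmul_smul] at this
  simpa [altWedge_apply, -TensorProduct.tmul_smul] using this

theorem altWedge_compContinuousLinearMap {p q k : ℕ} (h : p + q = k) (a : V [⋀^Fin p]→L[ℝ] ℝ)
    (b : V [⋀^Fin q]→L[ℝ] ℝ) (f : W →L[ℝ] V) :
    (altWedge h a b).compContinuousLinearMap f =
      altWedge h (a.compContinuousLinearMap f) (b.compContinuousLinearMap f) := by
  ext v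
  simp only [altWedge_apply, ContinuousAlternatingMap.compContinuousLinearMap_apply,
    AlternatingMap.domCoprod_apply, sum_apply]
  congr 1
  refine Finset.sum_congr rfl fun σ _ => ?_
  induction σ using Quotient.inductionOn' with
  | h σ => rfl
theorem ExtForm.add_wedge (a a' b : ExtForm V) : (a + a').wedge b = a.wedge b + a'.wedge b := by
  funext k
  exact (Finset.sum_congr rfl fun _ _ => altWedge_add_left _ _ _ _).trans Finset.sum_add_distrib

theorem ExtForm.wedge_add (a b b' : ExtForm V) : a.wedge (b + b') = a.wedge b + a.wedge b' := by
  funext k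
  exact (Finset.sum_congr rfl fun _ _ => altWedge_add_right _ _ _ _).trans Finset.sum_add_distrib

theorem ExtForm.smul_wedge (c : ℝ) (a b : ExtForm V) : (c • a).wedge b = c • a.wedge b := by
  funext k
  exact (Finset.sum_congr rfl fun _ _ => altWedge_smul_left _ _ _ _).trans Finset.smul_sum.symm

theorem ExtForm.wedge_smul (c : ℝ) (a b : ExtForm V) : a.wedge (c • b) = c • a.wedge b := by
  funext k
  exact (Finset.sum_congr rfl fun _ _ => altWedge_smul_right _ _ _ _).trans Finset.smul_sum.symm

theorem ExtForm.add_wedgePow (a a' b : ExtForm V) (j : ℕ) :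
    (a + a').wedgePow b j = a.wedgePow b j + a'.wedgePow b j := by
  induction j with
  | zero => rfl
  | succ j ih => simp only [ExtForm.wedgePow, ih, ExtForm.add_wedge]

theorem ExtForm.smul_wedgePow (c : ℝ) (a b : ExtForm V) (j : ℕ) :
    (c • a).wedgePow b j = c • a.wedgePow b j := by
  induction j with
  | zero => rfl
  | succ j ih => simp only [ExtForm.wedgePow, ih, ExtForm.smul_wedge]

end Pointwise

instance (E : Type*) [NormedAddCommGroup E] [NormedSpace ℝ E] [FiniteDimensional ℝ E] (k : ℕ) :
    FiniteDimensional ℝ (E [⋀^Fin k]→L[ℝ] ℝ) := by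
  let φ : (E [⋀^Fin k]→L[ℝ] ℝ) →ₗ[ℝ] MultilinearMap ℝ (fun _ : Fin k => E) ℝ :=
    { toFun := fun f => f.toMultilinearMap
      map_add' := fun _ _ => rfl
      map_smul' := fun _ _ => rfl }
  refine FiniteDimensional.of_injective φ ?_
  intro f g hfg
  ext v
  exact congrArg (fun F => F v) hfg

section Fields
variable {E : Type*} [NormedAddCommGroup E] [NormedSpace ℝ E]
variable {M : Type*} [TopologicalSpace M] [ChartedSpace E M]

variable (E M) in
/-- (Not necessarily smooth) sections over `M` of the bundle of exterior forms on the tangent spaces. -/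
def FormField : Type _ := (x : M) → ExtForm (TangentSpace 𝓘(ℝ, E) x)

instance : AddCommGroup (FormField E M) :=
  inferInstanceAs (AddCommGroup ((x : M) → ExtForm (TangentSpace 𝓘(ℝ, E) x)))

instance : Module ℝ (FormField E M) :=
  inferInstanceAs (Module ℝ ((x : M) → ExtForm (TangentSpace 𝓘(ℝ, E) x)))

/-- The derivative at `y` of the inverse of the preferred chart at `x₀`. -/
def chartSymmDeriv (x₀ : M) (y : E) : E →L[ℝ] TangentSpace 𝓘(ℝ, E) ((chartAt E x₀).symm y) :=
  mfderiv 𝓘(ℝ, E) 𝓘(ℝ, E) (chartAt E x₀).symm y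

/-- The derivative at `x` of the preferred chart at `x`. -/
def chartDeriv (x : M) : TangentSpace 𝓘(ℝ, E) x →L[ℝ] E :=
  mfderiv 𝓘(ℝ, E) 𝓘(ℝ, E) (chartAt E x) x

/-- The degree `k` component of `α` read in the preferred chart `φ` at `x₀`: the pull-back of `α` by
`φ⁻¹`, a form on `φ.target ⊆ E` (its values off `φ.target` are irrelevant). -/
def FormField.inChart (α : FormField E M) (x₀ : M) (k : ℕ) (y : E) : E [⋀^Fin k]→L[ℝ] ℝ :=
  (α ((chartAt E x₀).symm y) k).compContinuousLinearMap (chartSymmDeriv x₀ y)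

/-- `α` is smooth on `U`: all its components are smooth in the charts. -/
def FormField.SmoothOn (α : FormField E M) (U : Set M) : Prop :=
  ∀ (x₀ : M) (k : ℕ), ContDiffOn ℝ ∞ (α.inChart x₀ k)
    ((chartAt E x₀).target ∩ (chartAt E x₀).symm ⁻¹' U)

/-- The exterior derivative, computed at `x` in the preferred chart at `x`. -/
def FormField.d (α : FormField E M) : FormField E M := fun x k =>
  match k with
  | 0 => 0
  | k + 1 => (extDeriv (α.inChart x k) (chartAt E x x)).compContinuousLinearMap (chartDeriv x)

/-- The exterior product of forms. -/
def FormField.wedge (α β : FormField E M) : FormField E M := fun x => (α x).wedge (β x)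

theorem FormField.inChart_add (α β : FormField E M) (x₀ : M) (k : ℕ) :
    (α + β).inChart x₀ k = α.inChart x₀ k + β.inChart x₀ k := rfl

theorem FormField.inChart_smul (c : ℝ) (α : FormField E M) (x₀ : M) (k : ℕ) :
    (c • α).inChart x₀ k = c • α.inChart x₀ k := rfl

variable (E M) in
/-- The space `𝒜 = ⨁ 𝒜^k` of smooth differential forms on `M`. -/
def deRham : Submodule ℝ (FormField E M) where
  carrier := {α | α.SmoothOn Set.univ}
  add_mem' := fun {a b} ha hb x₀ k => by
    rw [FormField.inChart_add]; exact (ha x₀ k).add (hb x₀ k)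
  zero_mem' := fun x₀ k => contDiffOn_const (c := 0)
  smul_mem' := fun c a ha x₀ k => by
    rw [FormField.inChart_smul]; exact (ha x₀ k).const_smul c

theorem FormField.inChart_wedge (α β : FormField E M) (x₀ : M) (k : ℕ) :
    (α.wedge β).inChart x₀ k = fun y => ∑ pq : Finset.HasAntidiagonal.antidiagonal k,
      altWedge (Finset.HasAntidiagonal.mem_antidiagonal.1 pq.2) (α.inChart x₀ pq.1.1 y)
        (β.inChart x₀ pq.1.2 y) := by
  funext y
  simp only [FormField.inChart, FormField.wedge, ExtForm.wedge]
  rw [← ContinuousAlternatingMap.compContinuousLinearMapₗ_apply, map_sum]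
  refine Finset.sum_congr rfl fun pq _ => ?_
  exact altWedge_compContinuousLinearMap _ _ _ _

theorem contDiff_bilin {F G H : Type*} [NormedAddCommGroup F] [NormedSpace ℝ F]
    [NormedAddCommGroup G] [NormedSpace ℝ G] [NormedAddCommGroup H] [NormedSpace ℝ H]
    [FiniteDimensional ℝ F] [FiniteDimensional ℝ G] (B : F →ₗ[ℝ] G →ₗ[ℝ] H) :
    ContDiff ℝ ∞ fun p : F × G => B p.1 p.2 := by
  let B' : F →L[ℝ] G →L[ℝ] H := LinearMap.toContinuousLinearMap
    ((LinearMap.toContinuousLinearMap (𝕜 := ℝ) (E := G) (F' := H)).toLinearMap ∘ₗ B)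
  exact B'.isBoundedBilinearMap.contDiff

theorem contDiffOn_comp₂ {D F G H : Type*} [NormedAddCommGroup D] [NormedSpace ℝ D]
    [NormedAddCommGroup F] [NormedSpace ℝ F] [NormedAddCommGroup G] [NormedSpace ℝ G]
    [NormedAddCommGroup H] [NormedSpace ℝ H] {B : F → G → H}
    (hB : ContDiff ℝ ∞ fun p : F × G => B p.1 p.2) {f : D → F} {g : D → G} {s : Set D}
    (hf : ContDiffOn ℝ ∞ f s) (hg : ContDiffOn ℝ ∞ g s) :
    ContDiffOn ℝ ∞ (fun y => B (f y) (g y)) s :=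
  hB.comp_contDiffOn (hf.prodMk hg)

theorem contDiff_altWedge [FiniteDimensional ℝ E] {p q k : ℕ} (h : p + q = k) :
    ContDiff ℝ ∞ fun x : (E [⋀^Fin p]→L[ℝ] ℝ) × (E [⋀^Fin q]→L[ℝ] ℝ) => altWedge h x.1 x.2 := by
  have h2 := contDiff_bilin (F := E [⋀^Fin p]→L[ℝ] ℝ) (G := E [⋀^Fin q]→L[ℝ] ℝ)
    (H := E [⋀^Fin k]→L[ℝ] ℝ) (LinearMap.mk₂ ℝ (altWedge h) (altWedge_add_left h)
      (altWedge_smul_left h) (altWedge_add_right h) (altWedge_smul_right h))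
  simpa only [LinearMap.mk₂_apply] using h2

theorem FormField.wedge_smooth [FiniteDimensional ℝ E] {α β : FormField E M} {U : Set M}
    (hα : α.SmoothOn U) (hβ : β.SmoothOn U) : (α.wedge β).SmoothOn U := by
  intro x₀ k
  rw [FormField.inChart_wedge]
  exact ContDiffOn.sum fun pq _ => contDiffOn_comp₂ (contDiff_altWedge _) (hα x₀ pq.1.1)
    (hβ x₀ pq.1.2)

theorem FormField.compContinuousLinearMap_congr (α : FormField E M) (k : ℕ) {p q : M}
    (h : p = q) (A : E →L[ℝ] TangentSpace 𝓘(ℝ, E) p) (B : E →L[ℝ] TangentSpace 𝓘(ℝ, E) q)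
    (hAB : (show E →L[ℝ] E from A) = B) :
    (α p k).compContinuousLinearMap A = (α q k).compContinuousLinearMap B := by
  subst h
  exact congrArg _ hAB

theorem chartTransition [IsManifold 𝓘(ℝ, E) ∞ M] (x₀ x : M) {z : E}
    (hz : z ∈ (chartAt E x₀).target) (hzx : (chartAt E x₀).symm z ∈ (chartAt E x).source) :
    ContDiffAt ℝ ∞ (chartAt E x ∘ (chartAt E x₀).symm) z := by
  have h1 : ContMDiffAt 𝓘(ℝ, E) 𝓘(ℝ, E) ∞ (chartAt E x₀).symm z :=
    contMDiffAt_symm_of_mem_maximalAtlas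
      (IsManifold.chart_mem_maximalAtlas (I := 𝓘(ℝ, E)) (n := ∞) x₀) hz
  have h2 : ContMDiffAt 𝓘(ℝ, E) 𝓘(ℝ, E) ∞ (chartAt E x) ((chartAt E x₀).symm z) :=
    contMDiffAt_of_mem_maximalAtlas
      (IsManifold.chart_mem_maximalAtlas (I := 𝓘(ℝ, E)) (n := ∞) x) hzx
  exact (h2.comp z h1).contDiffAt

theorem FormField.inChart_eq [IsManifold 𝓘(ℝ, E) ∞ M] (α : FormField E M) (x₀ x : M) (k : ℕ)
    {z : E} (hz : z ∈ (chartAt E x₀).target)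
    (hzx : (chartAt E x₀).symm z ∈ (chartAt E x).source) :
    α.inChart x₀ k z =
      (α.inChart x k ((chartAt E x ∘ (chartAt E x₀).symm) z)).compContinuousLinearMap
      (fderiv ℝ (chartAt E x ∘ (chartAt E x₀).symm) z) := by
  refine FormField.compContinuousLinearMap_congr α k ?_
    (chartSymmDeriv x₀ z)
    (chartSymmDeriv x ((chartAt E x ∘ (chartAt E x₀).symm) z) ∘L
      fderiv ℝ (chartAt E x ∘ (chartAt E x₀).symm) z) ?_
  · exact ((chartAt E x).left_inv hzx).symm
  · have hτ := (chartTransition x₀ x hz hzx).differentiableAt (by simp)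
    have h1 : MDifferentiableAt 𝓘(ℝ, E) 𝓘(ℝ, E) (chartAt E x).symm
        ((chartAt E x ∘ (chartAt E x₀).symm) z) :=
      (mdifferentiable_chart x).mdifferentiableAt_symm ((chartAt E x).map_source hzx)
    have h2 := mfderiv_comp (I := 𝓘(ℝ, E)) (I' := 𝓘(ℝ, E)) (I'' := 𝓘(ℝ, E)) z h1
      hτ.mdifferentiableAt
    have h3 : (chartAt E x).symm ∘ (chartAt E x ∘ (chartAt E x₀).symm) =ᶠ[𝓝 z]
        (chartAt E x₀).symm := by
      have hopen := (chartAt E x₀).symm.isOpen_inter_preimage (chartAt E x).open_source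
      filter_upwards [hopen.mem_nhds ⟨hz, hzx⟩] with w hw
      exact (chartAt E x).left_inv hw.2
    have h4 := h3.mfderiv_eq (I := 𝓘(ℝ, E)) (I' := 𝓘(ℝ, E))
    rw [mfderiv_eq_fderiv] at h2
    exact h4.symm.trans h2

theorem FormField.inChart_d [IsManifold 𝓘(ℝ, E) ∞ M] {α : FormField E M} {U : Set M}
    (hU : IsOpen U) (hα : α.SmoothOn U) (x₀ : M) (k : ℕ) {y : E}
    (hy : y ∈ (chartAt E x₀).target) (hyU : (chartAt E x₀).symm y ∈ U) :
    α.d.inChart x₀ (k + 1) y = extDeriv (α.inChart x₀ k) y := by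
  have key : ∀ x : M, x = (chartAt E x₀).symm y →
      α.d.inChart x₀ (k + 1) y = extDeriv (α.inChart x₀ k) y := by
    intro x hx
    have hzx : (chartAt E x₀).symm y ∈ (chartAt E x).source := hx ▸ mem_chart_source E x
    have hopen := (chartAt E x₀).symm.isOpen_inter_preimage (chartAt E x).open_source
    have hev : α.inChart x₀ k =ᶠ[𝓝 y] fun z =>
        (α.inChart x k ((chartAt E x ∘ (chartAt E x₀).symm) z)).compContinuousLinearMap
          (fderiv ℝ (chartAt E x ∘ (chartAt E x₀).symm) z) := by
      filter_upwards [hopen.mem_nhds ⟨hy, hzx⟩] with w hw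
      exact FormField.inChart_eq α x₀ x k hw.1 hw.2
    have hτ := chartTransition x₀ x hy hzx
    have hτy : (chartAt E x ∘ (chartAt E x₀).symm) y = chartAt E x x := by simp [hx]
    have hdiff : DifferentiableAt ℝ (α.inChart x k)
        ((chartAt E x ∘ (chartAt E x₀).symm) y) := by
      refine ((hα x k).contDiffAt ?_).differentiableAt (by simp)
      refine ((chartAt E x).symm.isOpen_inter_preimage hU).mem_nhds ⟨?_, ?_⟩
      · exact (chartAt E x).map_source hzx
      · simpa [(chartAt E x).left_inv hzx] using hyU
    rw [hev.extDeriv_eq, extDeriv_pullback hdiff hτ (by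
      rw [minSmoothness_of_isRCLikeNormedField]; exact WithTop.coe_le_coe.2 le_top)]
    rw [hτy]
    have h1 : MDifferentiableAt 𝓘(ℝ, E) 𝓘(ℝ, E) (chartAt E x₀).symm y :=
      (mdifferentiable_chart x₀).mdifferentiableAt_symm hy
    have h2 : MDifferentiableAt 𝓘(ℝ, E) 𝓘(ℝ, E) (chartAt E x) ((chartAt E x₀).symm y) :=
      (mdifferentiable_chart x).mdifferentiableAt hzx
    have h3 := mfderiv_comp (I := 𝓘(ℝ, E)) (I' := 𝓘(ℝ, E)) (I'' := 𝓘(ℝ, E)) y h2 h1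
    rw [mfderiv_eq_fderiv] at h3
    rw [h3]
    subst hx
    rfl
  exact key _ rfl

theorem FormField.d_smooth [IsManifold 𝓘(ℝ, E) ∞ M] {α : FormField E M} {U : Set M}
    (hU : IsOpen U) (hα : α.SmoothOn U) : α.d.SmoothOn U := by
  intro x₀ k
  cases k with
  | zero => exact contDiffOn_const (c := 0)
  | succ k =>
    have hopen := (chartAt E x₀).symm.isOpen_inter_preimage hU
    have h1 : ContDiffOn ℝ ∞ (extDeriv (α.inChart x₀ k))
        ((chartAt E x₀).target ∩ (chartAt E x₀).symm ⁻¹' U) :=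
      (ContinuousAlternatingMap.alternatizeUncurryFinCLM ℝ E ℝ).contDiff.comp_contDiffOn
        ((hα x₀ k).fderiv_of_isOpen hopen (by simp))
    exact h1.congr fun y hy => FormField.inChart_d hU hα x₀ k hy.1 hy.2

theorem FormField.differentiableAt_inChart {α : FormField E M} (hα : α.SmoothOn Set.univ)
    (x : M) (k : ℕ) : DifferentiableAt ℝ (α.inChart x k) (chartAt E x x) := by
  refine ((hα x k).contDiffAt ?_).differentiableAt (by simp)
  exact ((chartAt E x).symm.isOpen_inter_preimage isOpen_univ).mem_nhds
    ⟨mem_chart_target E x, trivial⟩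

/-- The exterior derivative as a linear map `d : 𝒜 → 𝒜`. -/
def deRham.d [IsManifold 𝓘(ℝ, E) ∞ M] : deRham E M →ₗ[ℝ] deRham E M where
  toFun α := ⟨α.1.d, FormField.d_smooth isOpen_univ α.2⟩
  map_add' α β := by
    refine Subtype.ext (funext fun x => funext fun k => ?_)
    cases k with
    | zero => exact (add_zero (0 : TangentSpace 𝓘(ℝ, E) x [⋀^Fin 0]→L[ℝ] ℝ)).symm
    | succ k =>
      change (extDeriv (α.1.inChart x k + β.1.inChart x k) _).compContinuousLinearMap _ = _
      rw [extDeriv_add (FormField.differentiableAt_inChart α.2 x k)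
        (FormField.differentiableAt_inChart β.2 x k)]
      rfl
  map_smul' c α := by
    refine Subtype.ext (funext fun x => funext fun k => ?_)
    cases k with
    | zero => exact (smul_zero (A := TangentSpace 𝓘(ℝ, E) x [⋀^Fin 0]→L[ℝ] ℝ) c).symm
    | succ k =>
      change (extDeriv (c • α.1.inChart x k) _).compContinuousLinearMap _ = _
      rw [extDeriv_smul]
      rfl

/-- The exterior product as a bilinear map `μ : 𝒜 × 𝒜 → 𝒜`. -/
def deRham.wedge [FiniteDimensional ℝ E] : deRham E M →ₗ[ℝ] deRham E M →ₗ[ℝ] deRham E M :=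
  LinearMap.mk₂ ℝ (fun α β => ⟨α.1.wedge β.1, FormField.wedge_smooth α.2 β.2⟩)
    (fun _ _ _ => Subtype.ext (funext fun _ => ExtForm.add_wedge _ _ _))
    (fun _ _ _ => Subtype.ext (funext fun _ => ExtForm.smul_wedge _ _ _))
    (fun _ _ _ => Subtype.ext (funext fun _ => ExtForm.wedge_add _ _ _))
    (fun _ _ _ => Subtype.ext (funext fun _ => ExtForm.wedge_smul _ _ _))

end Fields

section AInfinity

variable {𝕜 A B : Type*} [Field 𝕜] [AddCommGroup A] [Module 𝕜 A] [AddCommGroup B] [Module 𝕜 B]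

/-- Collections of linear maps `m_k : A^{⊗k} → B`, given as multilinear maps. Only the indices
`k ≥ 1` matter below. -/
abbrev Operations (𝕜 A B : Type*) [Field 𝕜] [AddCommGroup A] [Module 𝕜 A] [AddCommGroup B]
    [Module 𝕜 B] : Type _ :=
  (k : ℕ) → MultilinearMap 𝕜 (fun _ : Fin k => A) B

/-- `m_k` is homogeneous of degree `c - k` for all `k ≥ 1`. -/
def Operations.HasDegree (𝒜 : ℤ → Submodule 𝕜 A) (ℬ : ℤ → Submodule 𝕜 B) (c : ℤ)
    (m : Operations 𝕜 A B) : Prop :=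
  ∀ k : ℕ, 1 ≤ k → ∀ (deg : Fin k → ℤ) (a : Fin k → A), (∀ i, a i ∈ 𝒜 (deg i)) →
    m k a ∈ ℬ (∑ i, deg i + (c - k))

/-- The sequence `a_0, …, a_{r-1}, b, a_{r+s}, a_{r+s+1}, …`. -/
def spliceSeq (r s : ℕ) (b : A) (a : ℕ → A) : ℕ → A := fun j =>
  if j < r then a j else if j = r then b else a (j - 1 + s)

/-- The value of `∑_{r+s+t=n} (-1)^{r+st} g_{r+1+t} (1^{⊗r} ⊗ m_s ⊗ 1^{⊗t})`, `s ≥ 1`, at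
`a_0 ⊗ ⋯ ⊗ a_{n-1}`, where `a_i` is homogeneous of degree `deg i` and `m_s` of degree `2 - s`.
The Koszul sign is that of moving `m_s` past `a_0, …, a_{r-1}`. -/
def stasheffSum (m : Operations 𝕜 A A) (g : Operations 𝕜 A B) (n : ℕ) (deg : ℕ → ℤ) (a : ℕ → A) :
    B :=
  ∑ x ∈ (Finset.Nat.antidiagonalTuple 3 n).filter (fun x => 1 ≤ x 1),
    Int.negOnePow ((x 0 : ℤ) + x 1 * x 2 + (2 - x 1) * ∑ i ∈ Finset.range (x 0), deg i) •
      g (x 0 + 1 + x 2)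
        (fun j => spliceSeq (x 0) (x 1) (m (x 1) (fun i => a (x 0 + i))) a j)

/-- The value of `∑_{i_1+⋯+i_r=n} (-1)^ℓ m_r (f_{i_1} ⊗ ⋯ ⊗ f_{i_r})`, `ℓ = ∑_j (r-j)(i_j-1)`, at
`a_0 ⊗ ⋯ ⊗ a_{n-1}`, where `a_i` is homogeneous of degree `deg i` and `f_i` of degree `1 - i`.
The Koszul sign is that of moving each `f_{i_j}` past the arguments of the preceding factors. -/
def compositionSum (m : Operations 𝕜 B B) (f : Operations 𝕜 A B) (n : ℕ) (deg : ℕ → ℤ)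
    (a : ℕ → A) : B :=
  ∑ c : Composition n,
    Int.negOnePow (∑ j : Fin c.length,
      (((c.length : ℤ) - (j + 1)) * (c.blocksFun j - 1) +
        (1 - c.blocksFun j) * ∑ i ∈ Finset.range (c.sizeUpTo j), deg i)) •
      m c.length (fun j => f (c.blocksFun j) (fun i => a (c.sizeUpTo j + i)))

/-- `A_∞`-algebras: `A = ⨁ 𝒜 z` is a graded vector space, `m_k` has degree `2 - k`, and the Stasheff
relations hold. -/
structure IsAInfinityAlgebra (𝒜 : ℤ → Submodule 𝕜 A) (m : Operations 𝕜 A A) : Prop where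
  isInternal : DirectSum.IsInternal 𝒜
  hasDegree : m.HasDegree 𝒜 𝒜 2
  stasheff : ∀ n : ℕ, 1 ≤ n → ∀ (deg : ℕ → ℤ) (a : ℕ → A), (∀ i, a i ∈ 𝒜 (deg i)) →
    stasheffSum m m n deg a = 0

/-- `A_∞`-morphisms: `f_k` has degree `1 - k`, and the morphism relations hold. -/
structure IsAInfinityMorphism (𝒜 : ℤ → Submodule 𝕜 A) (m : Operations 𝕜 A A)
    (ℬ : ℤ → Submodule 𝕜 B) (m' : Operations 𝕜 B B) (f : Operations 𝕜 A B) : Prop where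
  hasDegree : f.HasDegree 𝒜 ℬ 1
  relations : ∀ n : ℕ, 1 ≤ n → ∀ (deg : ℕ → ℤ) (a : ℕ → A), (∀ i, a i ∈ 𝒜 (deg i)) →
    stasheffSum m f n deg a = compositionSum m' f n deg a

open Classical in
/-- The `(p, q)`-shuffles. -/
def shuffles (p q : ℕ) : Finset (Equiv.Perm (Fin (p + q))) :=
  Finset.univ.filter fun σ =>
    StrictMono (fun i : Fin p => σ (Fin.castAdd q i)) ∧
      StrictMono (fun j : Fin q => σ (Fin.natAdd p j))

/-- The Koszul sign of the rearrangement `x_{σ⁻¹ 1} ⊗ ⋯ ⊗ x_{σ⁻¹ n}` of elements `x_i` of degree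
`deg i`: a factor `(-1)^{deg i * deg j}` for every pair that is interchanged. -/
def koszulSign {n : ℕ} (σ : Equiv.Perm (Fin n)) (deg : Fin n → ℤ) : ℤˣ :=
  ∏ ij ∈ (Finset.univ : Finset (Fin n × Fin n)).filter
    (fun ij => ij.1 < ij.2 ∧ σ ij.2 < σ ij.1), Int.negOnePow (deg ij.1 * deg ij.2)

/-- `g_{p+q} ∘ ν_{p,q} = 0` for all `p, q ≥ 1`, with `ν_{p,q}` the shuffle product. -/
def Operations.VanishesOnShuffles (𝒜 : ℤ → Submodule 𝕜 A) (g : Operations 𝕜 A B) : Prop :=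
  ∀ p q : ℕ, 1 ≤ p → 1 ≤ q → ∀ (deg : Fin (p + q) → ℤ) (a : Fin (p + q) → A),
    (∀ i, a i ∈ 𝒜 (deg i)) →
    ∑ σ ∈ shuffles p q, (Equiv.Perm.sign σ * koszulSign σ deg) • g (p + q) (fun i => a (σ⁻¹ i)) = 0

/-- `C_∞`-algebras. -/
structure IsCInfinityAlgebra (𝒜 : ℤ → Submodule 𝕜 A) (m : Operations 𝕜 A A) : Prop
    extends IsAInfinityAlgebra 𝒜 m where
  shuffle : m.VanishesOnShuffles 𝒜

/-- `C_∞`-morphisms (between `C_∞`-algebras). -/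
structure IsCInfinityMorphism (𝒜 : ℤ → Submodule 𝕜 A) (m : Operations 𝕜 A A)
    (ℬ : ℤ → Submodule 𝕜 B) (m' : Operations 𝕜 B B) (f : Operations 𝕜 A B) : Prop
    extends IsAInfinityMorphism 𝒜 m ℬ m' f where
  shuffle : f.VanishesOnShuffles 𝒜

/-- The component `m_1` as a linear map. -/
def Operations.one (m : Operations 𝕜 A B) : A →ₗ[𝕜] B :=
  (MultilinearMap.ofSubsingleton 𝕜 A B (0 : Fin 1)).symm (m 1)

/-- The cocycles `ker m_1 ∩ A^z`. -/
def cocycles (𝒜 : ℤ → Submodule 𝕜 A) (m : Operations 𝕜 A A) (z : ℤ) : Submodule 𝕜 A :=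
  LinearMap.ker m.one ⊓ 𝒜 z

/-- The cohomology `H A^z = (ker m_1 ∩ A^z) / (im m_1 ∩ A^z)`. -/
abbrev Cohomology (𝒜 : ℤ → Submodule 𝕜 A) (m : Operations 𝕜 A A) (z : ℤ) : Type _ :=
  cocycles 𝒜 m z ⧸ (LinearMap.range m.one).submoduleOf (cocycles 𝒜 m z)

/-- The class of a cocycle. -/
def cohomologyClass {𝒜 : ℤ → Submodule 𝕜 A} {m : Operations 𝕜 A A} {z : ℤ} (a : A)
    (ha : a ∈ cocycles 𝒜 m z) : Cohomology 𝒜 m z :=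
  Submodule.Quotient.mk ⟨a, ha⟩

/-- `C_∞`-quasi-isomorphisms: `C_∞`-morphisms such that `[α] ↦ [f_1 α]` is a well-defined isomorphism
of the graded cohomology algebras, whose products are `[α] [β] = [m_2 (α ⊗ β)]`. -/
structure IsCInfinityQuasiIso (𝒜 : ℤ → Submodule 𝕜 A) (m : Operations 𝕜 A A)
    (ℬ : ℤ → Submodule 𝕜 B) (m' : Operations 𝕜 B B) (f : Operations 𝕜 A B) : Prop
    extends IsCInfinityMorphism 𝒜 m ℬ m' f where
  exists_equiv : ∃ e : (z : ℤ) → Cohomology 𝒜 m z ≃ₗ[𝕜] Cohomology ℬ m' z,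
    (∀ (z : ℤ) (a : A) (ha : a ∈ cocycles 𝒜 m z),
      ∃ hfa : f.one a ∈ cocycles ℬ m' z, e z (cohomologyClass a ha) = cohomologyClass _ hfa) ∧
    (∀ (p q : ℤ) (a b : A), a ∈ cocycles 𝒜 m p → b ∈ cocycles 𝒜 m q →
      ∃ (hab : m 2 ![a, b] ∈ cocycles 𝒜 m (p + q))
        (hfab : m' 2 ![f.one a, f.one b] ∈ cocycles ℬ m' (p + q)),
        e (p + q) (cohomologyClass _ hab) = cohomologyClass _ hfab)

end AInfinity

section Contact

variable {E : Type*} [NormedAddCommGroup E] [NormedSpace ℝ E]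
variable {M : Type*} [TopologicalSpace M] [ChartedSpace E M]

/-- The forms of degree `z`. -/
def deRham.grading (z : ℤ) : Submodule ℝ (deRham E M) where
  carrier := {α | ∀ x, (α.1 x).IsHomogeneous z}
  add_mem' := fun {a b} ha hb x k hk => by
    change a.1 x k + b.1 x k = 0
    rw [ha x k hk, hb x k hk, add_zero]
  zero_mem' := fun _ _ _ => rfl
  smul_mem' := fun c a ha x k hk => by
    change c • a.1 x k = 0
    rw [ha x k hk, smul_zero]

/-- The de Rham algebra `(𝒜, d, μ)` as a collection of operations: `m_1 = d`, `m_2 = μ`, and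
`m_k = 0` otherwise. -/
def deRham.operations [FiniteDimensional ℝ E] [IsManifold 𝓘(ℝ, E) ∞ M] :
    Operations ℝ (deRham E M) (deRham E M)
  | 1 => MultilinearMap.ofSubsingleton ℝ (deRham E M) (deRham E M) (0 : Fin 1) deRham.d
  | 2 => MultilinearMap.mk' (fun a => deRham.wedge (a 0) (a 1))
      (fun v i x y => by fin_cases i <;> simp)
      (fun v i c x => by fin_cases i <;> simp)
  | _ => 0

/-- `θ` is a smooth one-form on the open set `U` with `ker θ = ξ` there (outside `U` the values of `θ`
are irrelevant). -/
structure IsLocalDefiningForm (ξ : (x : M) → Submodule ℝ (TangentSpace 𝓘(ℝ, E) x)) (U : Set M)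
    (θ : FormField E M) : Prop where
  isOpen : IsOpen U
  smoothOn : θ.SmoothOn U
  isOneForm : ∀ x ∈ U, (θ x).IsHomogeneous 1
  mem_iff : ∀ x ∈ U, ∀ v, v ∈ ξ x ↔ θ x 1 (fun _ => v) = 0

variable (E M) in
/-- A contact structure on `M`, where `dim M = 2n + 1`: a smooth subbundle `ξ ⊆ TM` of rank `2n`
(smoothness of a hyperplane field: locally the kernel of a smooth one-form), such that
`θ ∧ (dθ)^n` vanishes nowhere if `θ` is a local one-form with `ker θ = ξ`. -/
structure ContactStructure (n : ℕ) where
  ξ : (x : M) → Submodule ℝ (TangentSpace 𝓘(ℝ, E) x)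
  finrank_eq : ∀ x, Module.finrank ℝ (ξ x) = 2 * n
  smooth : ∀ x, ∃ U θ, x ∈ U ∧ IsLocalDefiningForm ξ U θ
  nondegenerate : ∀ U θ, IsLocalDefiningForm ξ U θ → ∀ x ∈ U, (θ x).wedgePow (θ.d x) n ≠ 0

namespace ContactStructure

variable {n : ℕ} (C : ContactStructure E M n)

/-- `θ` is a local contact form, defined on `U`. -/
def IsContactForm (U : Set M) (θ : FormField E M) : Prop := IsLocalDefiningForm C.ξ U θ

/-- `α` is vertical: it is annihilated by the exterior product with any local contact form. -/
def IsVertical (α : deRham E M) : Prop :=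
  ∀ U θ, C.IsContactForm U θ → ∀ x ∈ U, (θ x).wedge (α.1 x) = 0

/-- The operator `Γ : 𝒜^k → 𝒜_0^{k-1}`. Given a local contact form `θ` and `α ∈ 𝒜^k`, it holds that
`θ ∧ α ∧ dθ^{n+1-k} = Γα ∧ dθ^{n+2-k}` if `k ≤ n`; and, if `k ≥ n + 1`, that
`Γα = ζ ∧ dθ^{k-n-1}` with `ζ` vertical of degree `2n+1-k` and `θ ∧ α = ζ ∧ dθ^{k-n}`.
All these conditions are pointwise. -/
structure IsLefschetzInverse (Γ : deRham E M →ₗ[ℝ] deRham E M) : Prop where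
  mem_grading : ∀ (k : ℤ), ∀ α ∈ deRham.grading k, Γ α ∈ deRham.grading (k - 1)
  isVertical : ∀ α, C.IsVertical (Γ α)
  low : ∀ (k : ℤ), k ≤ n → ∀ α ∈ deRham.grading k, ∀ U θ, C.IsContactForm U θ → ∀ x ∈ U,
    ((θ x).wedge (α.1 x)).wedgePow (θ.d x) (n + 1 - k).toNat =
      ((Γ α).1 x).wedgePow (θ.d x) (n + 2 - k).toNat
  high : ∀ (k : ℤ), n + 1 ≤ k → ∀ α ∈ deRham.grading k, ∀ U θ, C.IsContactForm U θ → ∀ x ∈ U,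
    ∃ ζ : ExtForm (TangentSpace 𝓘(ℝ, E) x), ζ.IsHomogeneous (2 * n + 1 - k) ∧
      (θ x).wedge ζ = 0 ∧
      (θ x).wedge (α.1 x) = ζ.wedgePow (θ.d x) (k - n).toNat ∧
      (Γ α).1 x = ζ.wedgePow (θ.d x) (k - n - 1).toNat

variable [IsManifold 𝓘(ℝ, E) ∞ M]

/-- The projection `π = 1 - dΓ - Γd`. -/
def proj (Γ : deRham E M →ₗ[ℝ] deRham E M) : deRham E M →ₗ[ℝ] deRham E M :=
  (LinearMap.id : deRham E M →ₗ[ℝ] deRham E M) - deRham.d ∘ₗ Γ - Γ ∘ₗ deRham.d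

/-- The Rumin space `ℛ^k`, as a subspace of `𝒜`; here `𝓛^j α = α ∧ dθ^j`. -/
def ruminDegree (k : ℤ) : Submodule ℝ (deRham E M) where
  carrier := {α | α ∈ deRham.grading k ∧ ∀ U θ, C.IsContactForm U θ → ∀ x ∈ U,
    (k ≤ n →
      ((θ x).wedge (α.1 x)).wedgePow (θ.d x) (n + 1 - k).toNat = 0 ∧
      ((θ x).wedge ((deRham.d α).1 x)).wedgePow (θ.d x) (n - k).toNat = 0) ∧
    (n + 1 ≤ k → (θ x).wedge (α.1 x) = 0 ∧ (θ x).wedge ((deRham.d α).1 x) = 0)}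
  add_mem' := by
    rintro a b ⟨ha, ha'⟩ ⟨hb, hb'⟩
    refine ⟨add_mem ha hb, fun U θ hθ x hx => ?_⟩
    have e₁ : (a + b).1 x = a.1 x + b.1 x := rfl
    have e₂ : (deRham.d (a + b)).1 x = (deRham.d a).1 x + (deRham.d b).1 x := by
      rw [map_add]; rfl
    obtain ⟨h₁, h₂⟩ := ha' U θ hθ x hx
    obtain ⟨h₃, h₄⟩ := hb' U θ hθ x hx
    rw [e₁, e₂]
    simp only [ExtForm.wedge_add, ExtForm.add_wedgePow]
    refine ⟨fun hk => ⟨?_, ?_⟩, fun hk => ⟨?_, ?_⟩⟩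
    · rw [(h₁ hk).1, (h₃ hk).1, add_zero]
    · rw [(h₁ hk).2, (h₃ hk).2, add_zero]
    · rw [(h₂ hk).1, (h₄ hk).1, add_zero]
    · rw [(h₂ hk).2, (h₄ hk).2, add_zero]
  zero_mem' := by
    refine ⟨zero_mem _, fun U θ hθ x hx => ?_⟩
    have e₁ : ((0 : deRham E M)).1 x = (0 : ℝ) • (0 : ExtForm (TangentSpace 𝓘(ℝ, E) x)) :=
      (zero_smul ℝ _).symm
    have e₂ : (deRham.d (0 : deRham E M)).1 x =
        (0 : ℝ) • (0 : ExtForm (TangentSpace 𝓘(ℝ, E) x)) := by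
      rw [map_zero]; exact (zero_smul ℝ _).symm
    rw [e₁, e₂]
    simp only [ExtForm.wedge_smul, ExtForm.smul_wedgePow]
    simp only [zero_smul, and_self, implies_true]
  smul_mem' := by
    rintro c a ⟨ha, ha'⟩
    refine ⟨Submodule.smul_mem _ c ha, fun U θ hθ x hx => ?_⟩
    have e₁ : (c • a).1 x = c • a.1 x := rfl
    have e₂ : (deRham.d (c • a)).1 x = c • (deRham.d a).1 x := by
      rw [map_smul]; rfl
    obtain ⟨h₁, h₂⟩ := ha' U θ hθ x hx
    rw [e₁, e₂]
    simp only [ExtForm.wedge_smul, ExtForm.smul_wedgePow]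
    refine ⟨fun hk => ⟨?_, ?_⟩, fun hk => ⟨?_, ?_⟩⟩
    · rw [(h₁ hk).1, smul_zero]
    · rw [(h₁ hk).2, smul_zero]
    · rw [(h₂ hk).1, smul_zero]
    · rw [(h₂ hk).2, smul_zero]

/-- `ℛ = ⨁ ℛ^k`, as a subspace of `𝒜`. -/
def rumin : Submodule ℝ (deRham E M) := ⨆ k : ℤ, C.ruminDegree k

/-- The grading of `ℛ`. -/
def ruminGrading (k : ℤ) : Submodule ℝ C.rumin := (C.ruminDegree k).submoduleOf C.rumin

end ContactStructure

end Contact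

end

/-! Everything rests on a pointwise Lefschetz isomorphism, which produces Γ, and on four algebraic
properties of Γ from which the homotopy-algebraic statements follow formally.

Fix a point and a contact form, with w = dθ, so that θ∧wⁿ ≠ 0. A form is vertical exactly when it is
divisible by θ; hence vertical q-forms correspond to (q-1)-forms on ker θ, and the product of two
vertical forms is zero. Multiplication by w^(n+1-q) is an isomorphism from vertical q-forms to
vertical (2n+2-q)-forms: it is injective by induction on q, contracting with vectors of ker θ
(`lefschetz_injective`), and both sides have dimension C(2n, q-1) (`finrank_ker_eq`). So the
equations for Γ have exactly one solution at each point. Another contact form equals cθ at the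
point, and its differential is c·dθ plus a vertical form; vertical forms multiply to zero, so the
equations define the same Γ (`IsLefschetzImage.change`). Γ is smooth because it is built from
solutions of injective linear systems with smooth coefficients (`contDiffOn_of_injective`).

Let V be the ideal of vertical forms. Then Γ takes values in V, Γ vanishes on V, V·V = 0, and ΓdΓ =
Γ. For the last: differentiating θ∧τ = 0 gives θ∧dτ = τ∧dθ, so τ = Γα itself solves the equations
for Γ(dτ) (`gamma_d_gamma_of_mem`).

What remains is algebra in a graded commutative differential algebra with such a Γ
(`IsVerticalHomotopy`). The map π = 1 - dΓ - Γd commutes with d and satisfies Γπ = 0, so it is a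
projection onto the forms with Γa = 0 and Γda = 0, which are the Rumin forms
(`mem_ruminDegree_iff`). Put T(a,b,c) = Γ(ab)c - (-1)^|a| aΓ(bc), so that m₃ = πT, with T vertical.
The relation in arity 3 says that T is a homotopy for the associativity of πμ (`triple_d`). The one
in arity 4 reduces to d(Γ(ab)·Γ(ce)) = 0 (`triple_proj`). In arity 5 each term vanishes because m₃
has vertical values, and beyond that no term survives. The morphism relations come from Γ(πa·b) =
Γ(ab) - Γd(Γa·b) and its mirror image, the shuffle relations from graded commutativity. Finally, Γ
is a chain homotopy from π to the identity, so the inclusion is an isomorphism in cohomology. -/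

set_option linter.unusedSectionVars false
set_option linter.unusedSimpArgs false
set_option linter.unnecessarySeqFocus false

noncomputable section

/-! ### Exterior products as antisymmetrizations: associativity and expansion along a one-form -/

section Antisymmetrization

/-- The antisymmetrization of a function of a family of vectors. -/
def altSum {ι V : Type*} [Fintype ι] [DecidableEq ι] (F : (ι → V) → ℝ) (v : ι → V) : ℝ :=
  ∑ σ : Equiv.Perm ι, ((Equiv.Perm.sign σ : ℤ) : ℝ) * F (v ∘ σ)

theorem sign_mul_self_real {ι : Type*} [Fintype ι] [DecidableEq ι] (σ : Equiv.Perm ι) :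
    ((Equiv.Perm.sign σ : ℤ) : ℝ) * ((Equiv.Perm.sign σ : ℤ) : ℝ) = 1 := by
  rw [← Int.cast_mul, ← Units.val_mul, Int.units_mul_self]; simp

/-- A permutation τ of the first block can be absorbed into the outer sum by the translation σ ↦ σ(τ
⊕ 1), whose sign cancels that of τ. Each τ therefore contributes the same amount. -/
theorem altSum_sum_left {V ι κ : Type*} [Fintype ι] [DecidableEq ι] [Fintype κ] [DecidableEq κ]
    (F : (ι → V) → ℝ) (G : (κ → V) → ℝ) :
    altSum (fun w : ι ⊕ κ → V => altSum F (w ∘ Sum.inl) * G (w ∘ Sum.inr)) =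
      fun v => (Fintype.card ι).factorial *
        altSum (fun w : ι ⊕ κ → V => F (w ∘ Sum.inl) * G (w ∘ Sum.inr)) v := by
  funext v
  simp only [altSum, Finset.sum_mul, Finset.mul_sum (s := Finset.univ (α := Equiv.Perm ι))]
  rw [Finset.sum_comm]
  rw [← Fintype.card_perm, ← nsmul_eq_mul, ← Finset.card_univ, ← Finset.sum_const]
  refine Finset.sum_congr rfl fun τ _ => ?_
  rw [← Equiv.sum_comp (Equiv.mulRight (Equiv.sumCongr τ (1 : Equiv.Perm κ)))
    (fun σ => ((Equiv.Perm.sign σ : ℤ) : ℝ) * (F ((v ∘ σ) ∘ Sum.inl) * G ((v ∘ σ) ∘ Sum.inr)))]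
  refine Finset.sum_congr rfl fun σ _ => ?_
  have h1 : ((v ∘ σ) ∘ Sum.inl) ∘ τ =
      (v ∘ ((Equiv.mulRight (Equiv.sumCongr τ (1 : Equiv.Perm κ))) σ)) ∘ Sum.inl := rfl
  have h2 : (v ∘ σ) ∘ Sum.inr =
      (v ∘ ((Equiv.mulRight (Equiv.sumCongr τ (1 : Equiv.Perm κ))) σ)) ∘ Sum.inr := rfl
  have h3 : ((Equiv.Perm.sign ((Equiv.mulRight (Equiv.sumCongr τ (1 : Equiv.Perm κ))) σ) : ℤ) : ℝ)
      = ((Equiv.Perm.sign σ : ℤ) : ℝ) * ((Equiv.Perm.sign τ : ℤ) : ℝ) := by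
    rw [Equiv.coe_mulRight, Equiv.Perm.sign_mul]
    have : Equiv.Perm.sign (Equiv.sumCongr τ (1 : Equiv.Perm κ)) = Equiv.Perm.sign τ := by
      have := Equiv.Perm.sign_sumCongr τ (1 : Equiv.Perm κ)
      rwa [Equiv.Perm.sign_one, mul_one] at this
    rw [this, Units.val_mul, Int.cast_mul]
  rw [h1, h2, h3]
  ring

theorem altSum_reindex {V ι κ : Type*} [Fintype ι] [DecidableEq ι] [Fintype κ] [DecidableEq κ]
    (e : ι ≃ κ) (F : (ι → V) → ℝ) (v : κ → V) :
    altSum (fun w : κ → V => F (w ∘ e)) v = altSum F (v ∘ e) := by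
  refine (Fintype.sum_equiv (Equiv.permCongr e) _ _ fun σ => ?_).symm
  rw [Equiv.Perm.sign_permCongr]
  congr 2
  funext i
  simp [Equiv.permCongr_apply]

theorem altSum_smul {V ι : Type*} [Fintype ι] [DecidableEq ι] (c : ℝ) (F : (ι → V) → ℝ)
    (v : ι → V) : altSum (fun w => c * F w) v = c * altSum F v := by
  simp only [altSum, Finset.mul_sum]
  exact Finset.sum_congr rfl fun _ _ => by ring

/-- Inclusion of the first block of indices. -/
def firstBlock {p q k : ℕ} (h : p + q = k) : Fin p → Fin k := fun i => ⟨i, by omega⟩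

/-- Inclusion of the second block of indices. -/
def secondBlock {p q k : ℕ} (h : p + q = k) : Fin q → Fin k := fun i => ⟨p + i, by omega⟩

theorem altSum_altSum_left {V : Type*} {p q k : ℕ} (h : p + q = k) (F : (Fin p → V) → ℝ)
    (G : (Fin q → V) → ℝ) (v : Fin k → V) :
    altSum (fun w : Fin k → V => altSum F (w ∘ firstBlock h) * G (w ∘ secondBlock h)) v =
      p.factorial *
        altSum (fun w : Fin k → V => F (w ∘ firstBlock h) * G (w ∘ secondBlock h)) v := by
  let e : Fin p ⊕ Fin q ≃ Fin k := finSumFinEquiv.trans (finCongr h)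
  have h1 : firstBlock h = e ∘ Sum.inl := by funext i; ext; simp [firstBlock, e]
  have h2 : secondBlock h = e ∘ Sum.inr := by funext i; ext; simp [secondBlock, e]
  have := altSum_reindex e (fun w : Fin p ⊕ Fin q → V => altSum F (w ∘ Sum.inl) * G (w ∘ Sum.inr)) v
  rw [altSum_sum_left] at this
  rw [h1, h2]
  refine this.trans ?_
  simp only [← altSum_reindex e, Fintype.card_fin]
  rfl

theorem altSum_altSum_right {V : Type*} {p q k : ℕ} (h : p + q = k) (F : (Fin p → V) → ℝ)
    (G : (Fin q → V) → ℝ) (v : Fin k → V) :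
    altSum (fun w : Fin k → V => F (w ∘ firstBlock h) * altSum G (w ∘ secondBlock h)) v =
      q.factorial *
        altSum (fun w : Fin k → V => F (w ∘ firstBlock h) * G (w ∘ secondBlock h)) v := by
  let e : Fin q ⊕ Fin p ≃ Fin k := (Equiv.sumComm _ _).trans (finSumFinEquiv.trans (finCongr h))
  have h1 : firstBlock h = e ∘ Sum.inr := by funext i; ext; simp [firstBlock, e]
  have h2 : secondBlock h = e ∘ Sum.inl := by funext i; ext; simp [secondBlock, e]
  have := altSum_reindex e (fun w : Fin q ⊕ Fin p → V => altSum G (w ∘ Sum.inl) * F (w ∘ Sum.inr)) v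
  rw [altSum_sum_left] at this
  rw [h1, h2]
  simp only [mul_comm (F _)]
  refine this.trans ?_
  simp only [← altSum_reindex e, Fintype.card_fin]
  rfl

variable {V : Type*} [AddCommGroup V] [Module ℝ V] [TopologicalSpace V]

theorem apply_comp_perm {k : ℕ} (a : V [⋀^Fin k]→L[ℝ] ℝ) (v : Fin k → V)
    (σ : Equiv.Perm (Fin k)) : a (v ∘ σ) = ((Equiv.Perm.sign σ : ℤ) : ℝ) * a v := by
  have := a.toAlternatingMap.map_perm v σ
  simp only [ContinuousAlternatingMap.coe_toAlternatingMap] at this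
  rw [this, Units.smul_def, zsmul_eq_mul]

theorem altSum_apply {k : ℕ} (a : V [⋀^Fin k]→L[ℝ] ℝ) (v : Fin k → V) :
    altSum (fun w => a w) v = k.factorial * a v := by
  simp only [altSum, apply_comp_perm, ← mul_assoc, sign_mul_self_real, one_mul,
    Finset.sum_const, Finset.card_univ, Fintype.card_perm, Fintype.card_fin, nsmul_eq_mul]

/-- The sum over shuffles runs over cosets of S_p × S_q. Passing to all permutations repeats each
term p!q! times and replaces the quotient by a sum that is easy to reindex. -/
theorem altWedge_eq_altSum {p q k : ℕ} (h : p + q = k) (a : V [⋀^Fin p]→L[ℝ] ℝ)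
    (b : V [⋀^Fin q]→L[ℝ] ℝ) (v : Fin k → V) :
    (p.factorial * q.factorial : ℝ) * altWedge h a b v =
      altSum (fun w : Fin k → V => a (w ∘ firstBlock h) * b (w ∘ secondBlock h)) v := by
  let e : Fin p ⊕ Fin q ≃ Fin k := finSumFinEquiv.trans (finCongr h)
  have h1 : firstBlock h = e ∘ Sum.inl := by funext i; ext; simp [firstBlock, e]
  have h2 : secondBlock h = e ∘ Sum.inr := by funext i; ext; simp [secondBlock, e]
  have h3 := altSum_reindex e (fun w : Fin p ⊕ Fin q → V => a (w ∘ Sum.inl) * b (w ∘ Sum.inr)) v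
  rw [h1, h2]
  refine Eq.trans ?_ h3.symm
  rw [altWedge_apply]
  have h4 := congrArg (fun f => LinearMap.mul' ℝ ℝ (f (v ∘ e)))
    (MultilinearMap.domCoprod_alternization_eq a.toAlternatingMap b.toAlternatingMap)
  simp only [Fintype.card_fin, AlternatingMap.smul_apply, map_nsmul] at h4
  rw [nsmul_eq_mul, Nat.cast_mul] at h4
  refine h4.symm.trans ?_
  rw [MultilinearMap.alternatization_apply, map_sum]
  refine Finset.sum_congr rfl fun σ _ => ?_
  rw [Units.smul_def, map_zsmul, zsmul_eq_mul]
  rfl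

/-- Up to nonzero factorials, both bracketings are the total antisymmetrization `S` of a ⊗ b ⊗ c:
antisymmetrizing an inner block once more only contributes m! on the left and l! on the right. -/
theorem altWedge_assoc {p q r m l k : ℕ} (h₁ : p + q = m) (h₂ : m + r = k) (h₃ : q + r = l)
    (h₄ : p + l = k) (a : V [⋀^Fin p]→L[ℝ] ℝ) (b : V [⋀^Fin q]→L[ℝ] ℝ)
    (c : V [⋀^Fin r]→L[ℝ] ℝ) :
    altWedge h₂ (altWedge h₁ a b) c = altWedge h₄ a (altWedge h₃ b c) := by
  ext v
  have e1 := altWedge_eq_altSum h₂ (altWedge h₁ a b) c v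
  have e2 := altWedge_eq_altSum h₄ a (altWedge h₃ b c) v
  have e3 := altSum_altSum_left h₂
    (fun w => a (w ∘ firstBlock h₁) * b (w ∘ secondBlock h₁)) (fun w => c w) v
  have e4 := altSum_altSum_right h₄ (fun w => a w)
    (fun w => b (w ∘ firstBlock h₃) * c (w ∘ secondBlock h₃)) v
  simp only [← altWedge_eq_altSum, mul_assoc, mul_left_comm (a _), altSum_smul] at e3 e4
  have i1 : ∀ w : Fin k → V, (w ∘ firstBlock h₂) ∘ firstBlock h₁ = w ∘ firstBlock h₄ := fun w => rfl
  have i2 : ∀ w : Fin k → V, (w ∘ firstBlock h₂) ∘ secondBlock h₁ =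
      (w ∘ secondBlock h₄) ∘ firstBlock h₃ := fun w => rfl
  have i3 : ∀ w : Fin k → V, w ∘ secondBlock h₂ = (w ∘ secondBlock h₄) ∘ secondBlock h₃ := by
    intro w; funext i
    simp only [Function.comp_apply, secondBlock]
    congr 1; ext; simp only []; omega
  simp only [i1, i2, i3] at e3
  simp only [i3, mul_left_comm (b _) (a _)] at e1 e2 e3 e4
  have hf : ∀ n : ℕ, (n.factorial : ℝ) ≠ 0 := fun n => by exact_mod_cast n.factorial_ne_zero
  set S := altSum (fun w : Fin k → V => a (w ∘ firstBlock h₄) *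
    (b ((w ∘ secondBlock h₄) ∘ firstBlock h₃) * c ((w ∘ secondBlock h₄) ∘ secondBlock h₃))) v
  have key : (p.factorial * q.factorial * r.factorial * m.factorial * l.factorial : ℝ) *
      altWedge h₂ (altWedge h₁ a b) c v =
      (p.factorial * q.factorial * r.factorial * m.factorial * l.factorial : ℝ) *
      altWedge h₄ a (altWedge h₃ b c) v := by
    linear_combination (l.factorial : ℝ) * e3 - (m.factorial : ℝ) * e4
  exact mul_left_cancel₀ (by simp [hf]) key

/-- Laplace expansion: the permutations of q + 1 letters are grouped by the image i of 0, and each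
group consists of q! equal terms. -/
theorem altWedge_oneForm_apply {q : ℕ} (h : 1 + q = q + 1) (φ : V [⋀^Fin 1]→L[ℝ] ℝ)
    (c : V [⋀^Fin q]→L[ℝ] ℝ) (v : Fin (q + 1) → V) :
    altWedge h φ c v =
      ∑ i : Fin (q + 1), (-1) ^ (i : ℕ) * (φ (fun _ => v i) * c (i.removeNth v)) := by
  have e1 := altWedge_eq_altSum h φ c v
  have hq : (q.factorial : ℝ) ≠ 0 := by exact_mod_cast q.factorial_ne_zero
  refine mul_left_cancel₀ hq ?_
  rw [Nat.factorial_one, Nat.cast_one, one_mul] at e1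
  rw [e1, altSum, Finset.univ_perm_fin_succ, ← Finset.univ_product_univ, Finset.sum_map,
    Finset.sum_product, Finset.mul_sum]
  refine Finset.sum_congr rfl fun i _ => ?_
  -- `decomposeFin` sends 0 to i by a transposition, whereas `removeNth` enumerates the other
  -- indices in increasing order. The permutation ρ mediates between the two: it is a cycle, and
  -- together with the transposition it has sign (-1)^i.
  obtain ⟨ρ, hρ, hρs⟩ : ∃ ρ : Equiv.Perm (Fin q),
      (∀ (σ : Equiv.Perm (Fin q)) (j : Fin q), Equiv.Perm.decomposeFin.symm (i, σ) j.succ =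
        i.succAbove (ρ (σ j))) ∧ ∀ σ : Equiv.Perm (Fin q),
        ((Equiv.Perm.sign (Equiv.Perm.decomposeFin.symm (i, σ)) : ℤ) : ℝ) =
          (-1) ^ (i : ℕ) * (((Equiv.Perm.sign ρ : ℤ) : ℝ) * ((Equiv.Perm.sign σ : ℤ) : ℝ)) := by
    refine Fin.cases ?_ (fun i => ?_) i
    · refine ⟨1, fun σ j => ?_, fun σ => ?_⟩
      · simp [Equiv.Perm.decomposeFin_symm_apply_succ]
      · simp [Equiv.Perm.decomposeFin.symm_sign]
    · refine ⟨i.cycleRange, fun σ j => ?_, fun σ => ?_⟩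
      · simp [Equiv.Perm.decomposeFin_symm_apply_succ, Fin.succAbove_cycleRange]
      · have h1 : ((-1 : ℝ) ^ (i : ℕ)) * (-1) ^ (i : ℕ) = 1 := by
          rw [← mul_pow]; simp
        rw [Equiv.Perm.decomposeFin.symm_sign, if_neg (Fin.succ_ne_zero i), Fin.sign_cycleRange]
        simp only [Units.val_mul, Units.val_neg, Units.val_one, Units.val_pow_eq_pow_val,
          Fin.val_succ, pow_succ]
        push_cast
        linear_combination (((Equiv.Perm.sign σ : ℤ) : ℝ)) * h1
  have hterm : ∀ σ : Equiv.Perm (Fin q),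
      ((Equiv.Perm.sign (Equiv.Perm.decomposeFin.symm (i, σ)) : ℤ) : ℝ) *
        (φ ((v ∘ (Equiv.Perm.decomposeFin.symm (i, σ))) ∘ firstBlock h) *
          c ((v ∘ (Equiv.Perm.decomposeFin.symm (i, σ))) ∘ secondBlock h)) =
      (-1) ^ (i : ℕ) * (φ (fun _ => v i) * c (i.removeNth v)) := by
    intro σ
    have h1 : (v ∘ (Equiv.Perm.decomposeFin.symm (i, σ))) ∘ firstBlock h = fun _ => v i := by
      funext j
      have : firstBlock h j = 0 := by ext; simp [firstBlock]
      simp [this]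
    have h2 : (v ∘ (Equiv.Perm.decomposeFin.symm (i, σ))) ∘ secondBlock h =
        (i.removeNth v) ∘ (ρ * σ) := by
      funext j
      have : secondBlock h j = j.succ := by ext; simp [secondBlock, add_comm]
      simp [this, hρ, Fin.removeNth]
    have h3 : ((Equiv.Perm.sign (ρ * σ) : ℤ) : ℝ) =
        ((Equiv.Perm.sign ρ : ℤ) : ℝ) * ((Equiv.Perm.sign σ : ℤ) : ℝ) := by
      rw [Equiv.Perm.sign_mul, Units.val_mul, Int.cast_mul]
    rw [h1, h2, apply_comp_perm, hρs, ← h3]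
    linear_combination (-1) ^ (i : ℕ) * (φ (fun _ => v i) * c (i.removeNth v)) *
      sign_mul_self_real (ρ * σ)
  refine (Finset.sum_congr rfl fun σ _ => hterm σ).trans ?_
  rw [Finset.sum_const, Finset.card_univ, Fintype.card_perm, Fintype.card_fin, nsmul_eq_mul]

theorem one_altWedge {q : ℕ} (h : 0 + q = q) (b : V [⋀^Fin q]→L[ℝ] ℝ) :
    altWedge h (ContinuousAlternatingMap.constOfIsEmpty ℝ V (Fin 0) (1 : ℝ)) b = b := by
  ext v
  have e := altWedge_eq_altSum h (ContinuousAlternatingMap.constOfIsEmpty ℝ V (Fin 0) (1 : ℝ)) b v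
  have h1 : secondBlock h = id := by funext i; ext; simp [secondBlock]
  have hq : (q.factorial : ℝ) ≠ 0 := by exact_mod_cast q.factorial_ne_zero
  simp only [ContinuousAlternatingMap.constOfIsEmpty_apply, one_mul, h1, Function.comp_id,
    altSum_apply, Nat.factorial_zero, Nat.cast_one] at e
  exact mul_left_cancel₀ hq e

theorem altWedge_one {q : ℕ} (h : q + 0 = q) (b : V [⋀^Fin q]→L[ℝ] ℝ) :
    altWedge h b (ContinuousAlternatingMap.constOfIsEmpty ℝ V (Fin 0) (1 : ℝ)) = b := by
  ext v
  have e := altWedge_eq_altSum h b (ContinuousAlternatingMap.constOfIsEmpty ℝ V (Fin 0) (1 : ℝ)) v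
  have h1 : firstBlock h = id := rfl
  have hq : (q.factorial : ℝ) ≠ 0 := by exact_mod_cast q.factorial_ne_zero
  simp only [ContinuousAlternatingMap.constOfIsEmpty_apply, mul_one, h1, Function.comp_id,
    altSum_apply, Nat.factorial_zero, Nat.cast_one] at e
  exact mul_left_cancel₀ hq e

end Antisymmetrization

/-! ### The exterior algebra as a graded ring -/

section ExteriorRing
variable {V : Type*} [AddCommGroup V] [Module ℝ V] [TopologicalSpace V]

theorem altWedge_zero_left {p q k : ℕ} (h : p + q = k) (b : V [⋀^Fin q]→L[ℝ] ℝ) :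
    altWedge h (0 : V [⋀^Fin p]→L[ℝ] ℝ) b = 0 := by
  simpa using altWedge_smul_left h 0 (0 : V [⋀^Fin p]→L[ℝ] ℝ) b

theorem altWedge_zero_right {p q k : ℕ} (h : p + q = k) (a : V [⋀^Fin p]→L[ℝ] ℝ) :
    altWedge h a (0 : V [⋀^Fin q]→L[ℝ] ℝ) = 0 := by
  simpa using altWedge_smul_right h 0 a (0 : V [⋀^Fin q]→L[ℝ] ℝ)

namespace ExtForm

theorem single_wedge_apply {p q k : ℕ} (h : p + q = k) (a : V [⋀^Fin p]→L[ℝ] ℝ)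
    (b : ExtForm V) : ExtForm.wedge (Pi.single p a) b k = altWedge h a (b q) := by
  refine (Finset.sum_eq_single (⟨(p, q), Finset.HasAntidiagonal.mem_antidiagonal.2 h⟩ :
    Finset.HasAntidiagonal.antidiagonal k) ?_ (fun h => (h (Finset.mem_univ _)).elim)).trans ?_
  · rintro ⟨⟨p', q'⟩, h'⟩ _ hne
    rw [Finset.HasAntidiagonal.mem_antidiagonal] at h'
    have : p' ≠ p := by rintro rfl; apply hne; simp at h'; simp; omega
    simp only [Pi.single_eq_of_ne this, altWedge_zero_left]
  · simp

theorem single_wedge_single {p q k : ℕ} (h : p + q = k) (a : V [⋀^Fin p]→L[ℝ] ℝ)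
    (b : V [⋀^Fin q]→L[ℝ] ℝ) :
    ExtForm.wedge (Pi.single p a) (Pi.single q b) = Pi.single k (altWedge h a b) := by
  funext j
  by_cases hj : j = k
  · subst hj; rw [single_wedge_apply h]; simp
  · rw [Pi.single_eq_of_ne hj]
    by_cases hp : p ≤ j
    · rw [single_wedge_apply (q := j - p) (by omega), Pi.single_eq_of_ne (by omega),
        altWedge_zero_right]
    · refine Finset.sum_eq_zero ?_
      rintro ⟨⟨p', q'⟩, h'⟩ _
      rw [Finset.HasAntidiagonal.mem_antidiagonal] at h'
      simp only at h'
      have : p' ≠ p := by omega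
      simp only [Pi.single_eq_of_ne this, altWedge_zero_left]

variable [FiniteDimensional ℝ V]

theorem apply_eq_zero_of_finrank_lt (a : ExtForm V) {k : ℕ} (hk : Module.finrank ℝ V < k) :
    a k = 0 := by
  ext v
  refine (a k).toAlternatingMap.map_linearDependent v fun h => ?_
  have := h.fintype_card_le_finrank
  simp at this
  omega

/-- An `ExtForm` is a family over all degrees, but forms above the dimension vanish. This is what
allows additive properties to be checked on homogeneous forms only. -/
theorem eq_sum_single (a : ExtForm V) :
    a = ∑ k ∈ Finset.range (Module.finrank ℝ V + 1), Pi.single k (a k) := by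
  funext j
  rw [Finset.sum_apply]
  by_cases hj : j ≤ Module.finrank ℝ V
  · rw [Finset.sum_eq_single j]
    · simp
    · intro b _ hb; exact Pi.single_eq_of_ne hb.symm _
    · intro h; simp at h; omega
  · rw [apply_eq_zero_of_finrank_lt a (by omega), Finset.sum_eq_zero]
    intro k hk
    rw [Finset.mem_range] at hk
    exact Pi.single_eq_of_ne (by omega) _

theorem induction_single {P : ExtForm V → Prop} (zero : P 0) (add : ∀ a b, P a → P b → P (a + b))
    (single : ∀ k a, P (Pi.single k a)) (a : ExtForm V) : P a := by
  rw [eq_sum_single a]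
  exact Finset.sum_induction _ P (fun a b => add a b) zero fun k _ => single k _

theorem zero_wedge' (a : ExtForm V) : ExtForm.wedge 0 a = 0 := by
  simpa using ExtForm.smul_wedge 0 0 a

theorem wedge_zero' (a : ExtForm V) : ExtForm.wedge a 0 = 0 := by
  simpa using ExtForm.wedge_smul 0 a 0

theorem wedge_assoc (a b c : ExtForm V) : (a.wedge b).wedge c = a.wedge (b.wedge c) := by
  induction a using induction_single with
  | zero => simp only [zero_wedge']
  | add a a' h h' => simp only [ExtForm.add_wedge, h, h']
  | single p a =>
  induction b using induction_single with
  | zero => simp only [zero_wedge', wedge_zero']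
  | add b b' h h' => simp only [ExtForm.add_wedge, ExtForm.wedge_add, h, h']
  | single q b =>
  induction c using induction_single with
  | zero => simp only [wedge_zero']
  | add c c' h h' => simp only [ExtForm.wedge_add, h, h']
  | single r c =>
  rw [single_wedge_single rfl, single_wedge_single rfl, single_wedge_single rfl,
    single_wedge_single (add_assoc p q r).symm]
  rw [altWedge_assoc]

/-- The constant form `1` of degree `0`. -/
def unit : ExtForm V := Pi.single 0 (ContinuousAlternatingMap.constOfIsEmpty ℝ V (Fin 0) (1 : ℝ))

theorem unit_wedge (a : ExtForm V) : unit.wedge a = a := by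
  funext k
  rw [unit, single_wedge_apply (zero_add k), one_altWedge]

theorem wedge_unit (a : ExtForm V) : a.wedge unit = a := by
  induction a using induction_single with
  | zero => exact zero_wedge' _
  | add a a' h h' => rw [ExtForm.add_wedge, h, h']
  | single p a => rw [unit, single_wedge_single (add_zero p), altWedge_one]

/-- The exterior algebra, with the exterior product as multiplication. -/
instance : Ring (ExtForm V) :=
  { (inferInstance : AddCommGroup (ExtForm V)) with
    mul := ExtForm.wedge
    one := unit
    mul_assoc := wedge_assoc
    one_mul := unit_wedge
    mul_one := wedge_unit
    zero_mul := zero_wedge'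
    mul_zero := wedge_zero'
    left_distrib := ExtForm.wedge_add
    right_distrib := ExtForm.add_wedge }

theorem wedge_eq_mul (a b : ExtForm V) : a.wedge b = a * b := rfl

theorem wedgePow_eq_mul_pow (a b : ExtForm V) (j : ℕ) : a.wedgePow b j = a * b ^ j := by
  induction j with
  | zero => rw [pow_zero, mul_one]; rfl
  | succ j ih => rw [pow_succ, ← mul_assoc, ← ih]; rfl

instance : Algebra ℝ (ExtForm V) :=
  Algebra.ofModule ExtForm.smul_wedge (fun c a b => ExtForm.wedge_smul c a b)

theorem single_mul_single {p q k : ℕ} (h : p + q = k) (a : V [⋀^Fin p]→L[ℝ] ℝ)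
    (b : V [⋀^Fin q]→L[ℝ] ℝ) :
    (Pi.single p a * Pi.single q b : ExtForm V) = Pi.single k (altWedge h a b) :=
  single_wedge_single h a b

/-- The automorphism of the exterior algebra which is `(-1)^k` in degree `k`. -/
def parity : ExtForm V →ₗ[ℝ] ExtForm V where
  toFun a k := (-1 : ℝ) ^ k • a k
  map_add' a b := by funext k; exact smul_add _ _ _
  map_smul' c a := by funext k; exact smul_comm ((-1 : ℝ) ^ k) c (a k)

theorem parity_apply (a : ExtForm V) (k : ℕ) : parity a k = (-1 : ℝ) ^ k • a k := rfl

theorem parity_single (k : ℕ) (a : V [⋀^Fin k]→L[ℝ] ℝ) :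
    parity (Pi.single k a) = (-1 : ℝ) ^ k • (Pi.single k a : ExtForm V) := by
  funext j
  rw [parity_apply, Pi.smul_apply]
  by_cases h : j = k
  · subst h; rfl
  · rw [Pi.single_eq_of_ne h, smul_zero, smul_zero]

theorem parity_mul (a b : ExtForm V) : parity (a * b) = parity a * parity b := by
  induction a using induction_single with
  | zero => simp
  | add a a' h h' => simp only [add_mul, map_add, h, h']
  | single p a =>
  induction b using induction_single with
  | zero => simp
  | add b b' h h' => simp only [mul_add, map_add, h, h']
  | single q b =>
  rw [single_mul_single rfl, parity_single, parity_single, parity_single, smul_mul_smul_comm,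
    single_mul_single rfl, pow_add]

theorem parity_one : parity (1 : ExtForm V) = 1 := by
  refine (parity_single 0 _).trans ?_
  rw [pow_zero, one_smul]; rfl

theorem IsHomogeneous.eq_single {k : ℕ} {a : ExtForm V} (h : a.IsHomogeneous k) :
    a = Pi.single k (a k) := by
  funext j
  by_cases hj : j = k
  · subst hj; simp
  · rw [Pi.single_eq_of_ne hj]; exact h j (by exact_mod_cast hj)

theorem isHomogeneous_single (k : ℕ) (a : V [⋀^Fin k]→L[ℝ] ℝ) :
    ExtForm.IsHomogeneous (k : ℤ) (Pi.single k a : ExtForm V) :=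
  fun j hj => Pi.single_eq_of_ne (by exact_mod_cast hj) _

theorem isHomogeneous_zero (z : ℤ) : ExtForm.IsHomogeneous z (0 : ExtForm V) := fun _ _ => rfl

theorem IsHomogeneous.eq_zero_of_neg {z : ℤ} (hz : z < 0) {a : ExtForm V}
    (h : a.IsHomogeneous z) : a = 0 := funext fun k => h k (by omega)

theorem IsHomogeneous.eq_zero_of_finrank_lt {z : ℤ} (hz : Module.finrank ℝ V < z) {a : ExtForm V}
    (h : a.IsHomogeneous z) : a = 0 := by
  funext k
  by_cases hk : (k : ℤ) = z
  · exact apply_eq_zero_of_finrank_lt a (by omega)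
  · exact h k hk

theorem IsHomogeneous.mul {p q : ℤ} {a b : ExtForm V} (ha : a.IsHomogeneous p)
    (hb : b.IsHomogeneous q) : (a * b).IsHomogeneous (p + q) := by
  by_cases hp : 0 ≤ p
  · by_cases hq : 0 ≤ q
    · lift p to ℕ using hp
      lift q to ℕ using hq
      rw [ha.eq_single, hb.eq_single, single_mul_single rfl]
      exact isHomogeneous_single (p + q) _
    · rw [hb.eq_zero_of_neg (by omega), mul_zero]; exact isHomogeneous_zero _
  · rw [ha.eq_zero_of_neg (by omega), zero_mul]; exact isHomogeneous_zero _

theorem IsHomogeneous.smul {p : ℤ} {a : ExtForm V} (ha : a.IsHomogeneous p) (c : ℝ) :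
    (c • a).IsHomogeneous p := fun k hk => by
  rw [Pi.smul_apply, ha k hk, smul_zero]

theorem IsHomogeneous.add {p : ℤ} {a b : ExtForm V} (ha : a.IsHomogeneous p)
    (hb : b.IsHomogeneous p) : (a + b).IsHomogeneous p := fun k hk => by
  rw [Pi.add_apply, ha k hk, hb k hk, add_zero]

theorem isHomogeneous_one : ExtForm.IsHomogeneous 0 (1 : ExtForm V) := isHomogeneous_single 0 _

theorem IsHomogeneous.pow {p : ℤ} {a : ExtForm V} (ha : a.IsHomogeneous p) (m : ℕ) :
    (a ^ m).IsHomogeneous (m * p) := by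
  induction m with
  | zero => rw [pow_zero, Nat.cast_zero, zero_mul]; exact isHomogeneous_one
  | succ m ih =>
    rw [pow_succ]
    have := ih.mul ha
    rwa [show (m : ℤ) * p + p = ((m + 1 : ℕ) : ℤ) * p by push_cast; ring] at this

theorem IsHomogeneous.parity_eq {z : ℤ} {a : ExtForm V} (ha : a.IsHomogeneous z) :
    parity a = (Int.negOnePow z : ℤˣ) • a := by
  funext k
  rw [parity_apply, Pi.smul_apply]
  by_cases hk : (k : ℤ) = z
  · subst hk
    rw [Int.negOnePow_def, zpow_natCast, Units.smul_def, Units.val_pow_eq_pow_val]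
    simp [← Int.cast_smul_eq_zsmul ℝ]
  · rw [ha k hk, smul_zero, smul_zero]

end ExtForm
end ExteriorRing

/-! ### Contraction with vectors and graded commutativity -/

section Contraction
variable {E : Type*} [NormedAddCommGroup E] [NormedSpace ℝ E] [FiniteDimensional ℝ E]

namespace ExtForm

/-- A linear functional as a form of degree one. -/
def oneForm (φ : E →L[ℝ] ℝ) : ExtForm E :=
  Pi.single (M := fun k => E [⋀^Fin k]→L[ℝ] ℝ) 1
    (ContinuousAlternatingMap.ofSubsingleton ℝ E ℝ (0 : Fin 1) φ)

theorem isHomogeneous_oneForm (φ : E →L[ℝ] ℝ) : (oneForm φ).IsHomogeneous 1 :=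
  isHomogeneous_single 1
    (ContinuousAlternatingMap.ofSubsingleton ℝ E ℝ (0 : Fin 1) φ)

theorem parity_oneForm (φ : E →L[ℝ] ℝ) : parity (oneForm φ) = -oneForm φ := by
  rw [oneForm, parity_single, pow_one, neg_one_smul]

theorem oneForm_mul_zero (φ : E →L[ℝ] ℝ) (a : ExtForm E) : (oneForm φ * a) 0 = 0 := by
  change ExtForm.wedge (oneForm φ) a 0 = 0
  refine Finset.sum_eq_zero ?_
  rintro ⟨⟨p', q'⟩, h'⟩ _
  rw [Finset.HasAntidiagonal.mem_antidiagonal] at h'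
  have : p' ≠ 1 := by simp at h'; omega
  simp only [oneForm, Pi.single_eq_of_ne this, altWedge_zero_left]

theorem oneForm_mul_succ (φ : E →L[ℝ] ℝ) (a : ExtForm E) (k : ℕ) (v : Fin (k + 1) → E) :
    (oneForm φ * a) (k + 1) v =
      ∑ i : Fin (k + 1), (-1) ^ (i : ℕ) * (φ (v i) * a k (i.removeNth v)) := by
  rw [oneForm, ← wedge_eq_mul, single_wedge_apply (add_comm 1 k), altWedge_oneForm_apply]
  rfl

/-- Contraction with a vector. -/
def contract (X : E) : ExtForm E →ₗ[ℝ] ExtForm E where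
  toFun a k := (a (k + 1)).curryLeft X
  map_add' a b := by funext k; ext v; rfl
  map_smul' c a := by funext k; ext v; rfl

theorem contract_apply (X : E) (a : ExtForm E) (k : ℕ) (v : Fin k → E) :
    contract X a k v = a (k + 1) (Matrix.vecCons X v) := rfl

theorem contract_oneForm_mul (X : E) (φ : E →L[ℝ] ℝ) (a : ExtForm E) :
    contract X (oneForm φ * a) = φ X • a - oneForm φ * contract X a := by
  funext k
  ext v
  rw [contract_apply, oneForm_mul_succ, Fin.sum_univ_succ]
  simp only [Pi.sub_apply, Pi.smul_apply, ContinuousAlternatingMap.sub_apply,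
    ContinuousAlternatingMap.smul_apply, smul_eq_mul]
  have h0 : (0 : Fin (k + 1)).removeNth (Matrix.vecCons X v) = v := by
    funext j; simp [Fin.removeNth]
  rw [h0, sub_eq_add_neg]
  congr 1
  · simp
  · cases k with
    | zero => rw [oneForm_mul_zero]; simp
    | succ k =>
      rw [oneForm_mul_succ, ← Finset.sum_neg_distrib]
      refine Finset.sum_congr rfl fun i _ => ?_
      have : i.succ.removeNth (Matrix.vecCons X v) = Matrix.vecCons X (i.removeNth v) := by
        funext j
        refine Fin.cases ?_ (fun j => ?_) j <;> simp [Fin.removeNth]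
      rw [this, contract_apply, Fin.val_succ, pow_succ]
      simp

/-- Expresses the alternatization behind `extDeriv` through exterior multiplication by coordinate
forms. It serves twice: for T = ι_(·)a it gives Euler's identity, and for a derivative it gives d =
∑ bⁱ ∧ ∂ᵢ. -/
theorem sum_coord_mul {ι : Type*} [Fintype ι] (b : Module.Basis ι ℝ E) (k : ℕ)
    (A : ι → ExtForm E) (T : E →L[ℝ] E [⋀^Fin k]→L[ℝ] ℝ) (hT : ∀ i, A i k = T (b i)) :
    (∑ i, oneForm (LinearMap.toContinuousLinearMap (b.coord i)) * A i) (k + 1) =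
      ContinuousAlternatingMap.alternatizeUncurryFin T := by
  ext v
  rw [Finset.sum_apply, ContinuousAlternatingMap.sum_apply,
    ContinuousAlternatingMap.alternatizeUncurryFin_apply]
  simp only [oneForm_mul_succ]
  rw [Finset.sum_comm]
  refine Finset.sum_congr rfl fun j _ => ?_
  have h1 : T (v j) = ∑ i, b.coord i (v j) • T (b i) := by
    conv_lhs => rw [← b.sum_repr (v j), map_sum]
    exact Finset.sum_congr rfl fun i _ => by rw [map_smul]; rfl
  rw [h1, ContinuousAlternatingMap.sum_apply, ← Finset.mul_sum, zsmul_eq_mul]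
  push_cast
  congr 1
  exact Finset.sum_congr rfl fun i _ => by rw [hT]; rfl

theorem alternatizeUncurryFin_curryLeft (k : ℕ) (a : E [⋀^Fin (k + 1)]→L[ℝ] ℝ) :
    ContinuousAlternatingMap.alternatizeUncurryFin a.curryLeft = ((k : ℝ) + 1) • a := by
  ext v
  have := congrArg (fun f => f v)
    (AlternatingMap.alternatizeUncurryFin_curryLeft a.toAlternatingMap)
  rw [AlternatingMap.alternatizeUncurryFin_apply] at this
  rw [ContinuousAlternatingMap.alternatizeUncurryFin_apply]
  refine Eq.trans ?_ (this.trans ?_)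
  · rfl
  · simp [nsmul_eq_mul]

/-- Euler's identity ∑ bⁱ ∧ ι_(bᵢ) a = deg(a)·a. After division by the degree it shows that
one-forms generate the exterior algebra. -/
theorem sum_coord_mul_contract {ι : Type*} [Fintype ι] (b : Module.Basis ι ℝ E) (k : ℕ)
    (a : E [⋀^Fin (k + 1)]→L[ℝ] ℝ) :
    ∑ i, oneForm (LinearMap.toContinuousLinearMap (b.coord i)) *
      (Pi.single k (a.curryLeft (b i)) : ExtForm E) = ((k : ℝ) + 1) • Pi.single (k + 1) a := by
  have h1 : ExtForm.IsHomogeneous (k + 1 : ℕ)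
      (∑ i, oneForm (LinearMap.toContinuousLinearMap (b.coord i)) *
        (Pi.single k (a.curryLeft (b i)) : ExtForm E)) := by
    refine Finset.sum_induction _ _ (fun a b ha hb => ha.add hb) (isHomogeneous_zero _) ?_
    intro i _
    have := (isHomogeneous_oneForm (LinearMap.toContinuousLinearMap (b.coord i))).mul
      (isHomogeneous_single k (a.curryLeft (b i)))
    rwa [show (1 : ℤ) + k = ((k + 1 : ℕ) : ℤ) by push_cast; ring] at this
  rw [h1.eq_single, sum_coord_mul b k _ a.curryLeft (fun i => by simp),
    alternatizeUncurryFin_curryLeft]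
  exact Pi.single_smul (f := fun k => E [⋀^Fin k]→L[ℝ] ℝ) (k + 1) ((k : ℝ) + 1) a

/-- The exterior algebra is generated by forms of degree one. -/
theorem induction_oneForm {P : ExtForm E → Prop} (one : P 1) (add : ∀ a b, P a → P b → P (a + b))
    (smul : ∀ (c : ℝ) a, P a → P (c • a)) (mul : ∀ φ a, P a → P (oneForm φ * a))
    (a : ExtForm E) : P a := by
  have zero : P 0 := by simpa using smul 0 1 one
  have single : ∀ (k : ℕ) (a : E [⋀^Fin k]→L[ℝ] ℝ), P (Pi.single k a) := by
    intro k
    induction k with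
    | zero =>
      intro a
      have : (Pi.single 0 a : ExtForm E) = (a ![]) • (1 : ExtForm E) := by
        refine Eq.trans ?_ (Pi.single_smul (f := fun k => E [⋀^Fin k]→L[ℝ] ℝ) 0 (a ![]) _)
        congr 1
        ext v
        rw [Subsingleton.elim v ![]]
        simp
      rw [this]
      exact smul _ _ one
    | succ k ih =>
      intro a
      have h1 := sum_coord_mul_contract (Module.finBasis ℝ E) k a
      have h2 : (Pi.single (k + 1) a : ExtForm E) = ((k : ℝ) + 1)⁻¹ • (((k : ℝ) + 1) •
          Pi.single (k + 1) a : ExtForm E) := by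
        rw [smul_smul, inv_mul_cancel₀ (by positivity), one_smul]
      rw [h2, ← h1]
      exact smul _ _ (Finset.sum_induction _ P add zero fun i _ => mul _ _ (ih _))
  exact induction_single zero add single a

theorem contract_one (X : E) : contract X (1 : ExtForm E) = 0 := by
  funext k
  change ContinuousAlternatingMap.curryLeft ((unit : ExtForm E) (k + 1)) X = 0
  rw [unit, Pi.single_eq_of_ne (by omega)]
  rfl

theorem contract_oneForm (X : E) (φ : E →L[ℝ] ℝ) : contract X (oneForm φ) = φ X • 1 := by
  have := contract_oneForm_mul X φ 1
  rwa [mul_one, contract_one, mul_zero, sub_zero] at this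

/-- Contraction is an antiderivation. By induction over generators only left multiplication by a
one-form has to be treated, and that is the Laplace expansion. -/
theorem contract_mul (X : E) (a b : ExtForm E) :
    contract X (a * b) = contract X a * b + parity a * contract X b := by
  induction a using induction_oneForm with
  | one => rw [one_mul, contract_one, zero_mul, parity_one, one_mul, zero_add]
  | add a a' h h' => simp only [add_mul, map_add, h, h']; abel
  | smul c a h => simp only [smul_mul_assoc, map_smul, h, smul_add]
  | mul φ a h =>
    rw [mul_assoc, contract_oneForm_mul, h, contract_oneForm_mul, parity_mul, parity_oneForm,
      sub_mul, smul_mul_assoc, mul_add, mul_assoc, neg_mul, neg_mul, mul_assoc]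
    abel

theorem eq_of_contract_eq {a b : ExtForm E} (h0 : a 0 = b 0)
    (h : ∀ X, contract X a = contract X b) : a = b := by
  funext k
  cases k with
  | zero => exact h0
  | succ k =>
    ext v
    have := congrArg (fun f : ExtForm E => f k (Matrix.vecTail v)) (h (Matrix.vecHead v))
    simpa only [contract_apply, Matrix.cons_head_tail] using this

/-- Both sides have no degree 0 part and have the same contraction φ(X)ψ - ψ(X)φ with every X, which
determines a form. -/
theorem oneForm_anticomm (φ ψ : E →L[ℝ] ℝ) : oneForm φ * oneForm ψ = -(oneForm ψ * oneForm φ) := by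
  refine eq_of_contract_eq ?_ fun X => ?_
  · rw [Pi.neg_apply, oneForm_mul_zero, oneForm_mul_zero, neg_zero]
  · rw [map_neg, contract_oneForm_mul, contract_oneForm_mul, contract_oneForm, contract_oneForm,
      mul_smul_comm, mul_smul_comm, mul_one, mul_one, neg_sub]

theorem oneForm_mul_comm (φ : E →L[ℝ] ℝ) (a : ExtForm E) :
    oneForm φ * a = parity a * oneForm φ := by
  induction a using induction_oneForm with
  | one => rw [parity_one, mul_one, one_mul]
  | add a a' h h' => simp only [mul_add, add_mul, map_add, h, h']
  | smul c a h => simp only [smul_mul_assoc, mul_smul_comm, map_smul, h]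
  | mul ψ a h =>
    rw [← mul_assoc, oneForm_anticomm, neg_mul, mul_assoc, h, parity_mul, parity_oneForm, neg_mul,
      neg_mul, mul_assoc]

theorem parity_pow_apply (z : ℕ) (a : ExtForm E) (k : ℕ) :
    (parity ^ z) a k = (-1 : ℝ) ^ (z * k) • a k := by
  induction z with
  | zero => simp
  | succ z ih =>
    rw [pow_succ', Module.End.mul_apply, parity_apply, ih, smul_smul, ← pow_add]
    ring_nf

theorem single_mul_comm {q : ℕ} (b : E [⋀^Fin q]→L[ℝ] ℝ) (a : ExtForm E) :
    a * Pi.single q b = Pi.single q b * (parity ^ q) a := by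
  induction a using induction_oneForm with
  | one =>
    have : (parity ^ q) (1 : ExtForm E) = 1 := by
      induction q with
      | zero => rfl
      | succ q ih => rw [pow_succ', Module.End.mul_apply, ih (b.curryLeft 0), parity_one]
    rw [this, mul_one, one_mul]
  | add a a' h h' => simp only [mul_add, add_mul, map_add, h, h']
  | smul c a h => simp only [smul_mul_assoc, mul_smul_comm, map_smul, h]
  | mul φ a h =>
    have : (parity ^ q) (oneForm φ * a) = (-1 : ℝ) ^ q • (oneForm φ * (parity ^ q) a) := by
      clear h
      induction q with
      | zero => simp
      | succ q ih =>
        rw [pow_succ', Module.End.mul_apply, ih (b.curryLeft 0), Module.End.mul_apply, map_smul,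
          parity_mul, parity_oneForm, pow_succ, mul_neg_one, neg_smul, neg_mul, smul_neg]
    rw [mul_assoc, h, ← mul_assoc, oneForm_mul_comm, parity_single, this, smul_mul_assoc,
      mul_smul_comm, smul_mul_assoc, mul_assoc]

/-- Graded commutativity of the exterior product. -/
theorem IsHomogeneous.mul_comm {p q : ℤ} {a b : ExtForm E} (ha : a.IsHomogeneous p)
    (hb : b.IsHomogeneous q) : a * b = (Int.negOnePow (p * q)) • (b * a) := by
  by_cases hp : 0 ≤ p
  · by_cases hq : 0 ≤ q
    · lift p to ℕ using hp
      lift q to ℕ using hq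
      have h1 : (parity ^ q) a = (Int.negOnePow (p * q)) • a := by
        funext k
        rw [parity_pow_apply, Pi.smul_apply]
        by_cases hk : k = p
        · subst hk
          rw [← Nat.cast_mul, Int.negOnePow_def, zpow_natCast, Units.smul_def,
            Units.val_pow_eq_pow_val, _root_.mul_comm q]
          simp [← Int.cast_smul_eq_zsmul ℝ]
        · rw [ha k (by exact_mod_cast hk), smul_zero, smul_zero]
      rw [hb.eq_single, single_mul_comm, h1, Units.smul_def, Units.smul_def, mul_smul_comm]
    · rw [hb.eq_zero_of_neg (by omega), mul_zero, zero_mul, smul_zero]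
  · rw [ha.eq_zero_of_neg (by omega), mul_zero, zero_mul, smul_zero]

end ExtForm
end Contraction

/-! ### The Lefschetz isomorphism on vertical forms at a point -/

section Lefschetz

theorem exists_mem_apply_eq_of_finrank_eq {K V W : Type*} [Field K] [AddCommGroup V] [Module K V]
    [AddCommGroup W] [Module K W] [FiniteDimensional K V] [FiniteDimensional K W] (f : V →ₗ[K] W)
    {S : Submodule K V} {T : Submodule K W} (hST : ∀ s ∈ S, f s ∈ T)
    (hinj : ∀ s ∈ S, f s = 0 → s = 0) (hd : Module.finrank K S = Module.finrank K T) (t : W)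
    (ht : t ∈ T) : ∃ s ∈ S, f s = t := by
  let L : S →ₗ[K] T := f.restrict hST
  have hL : Function.Injective L :=
    (injective_iff_map_eq_zero L).2 fun a ha => Subtype.ext (hinj a a.2 (congrArg Subtype.val ha))
  obtain ⟨s, hs⟩ := (LinearMap.injective_iff_surjective_of_finrank_eq_finrank hd).1 hL ⟨t, ht⟩
  exact ⟨s, s.2, congrArg Subtype.val hs⟩

variable {E : Type*} [NormedAddCommGroup E] [NormedSpace ℝ E] [FiniteDimensional ℝ E]

namespace ExtForm

theorem contract_add_left (X Y : E) (a : ExtForm E) :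
    contract (X + Y) a = contract X a + contract Y a := by
  funext k
  exact map_add (a (k + 1)).curryLeft X Y

theorem contract_smul_left (c : ℝ) (X : E) (a : ExtForm E) :
    contract (c • X) a = c • contract X a := by
  funext k
  exact map_smul (a (k + 1)).curryLeft c X

theorem contract_contract_self (X : E) (a : ExtForm E) : contract X (contract X a) = 0 := by
  funext k
  ext v
  rw [contract_apply, contract_apply]
  exact (a (k + 2)).map_eq_zero_of_eq _ (i := 0) (j := 1) rfl (by simp)

theorem contract_contract_swap (X Y : E) (a : ExtForm E) :
    contract X (contract Y a) = -contract Y (contract X a) := by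
  have h := contract_contract_self (X + Y) a
  rw [contract_add_left, contract_add_left, map_add, map_add, contract_contract_self,
    contract_contract_self, zero_add, add_zero] at h
  exact eq_neg_of_add_eq_zero_left h

theorem IsHomogeneous.contract {z : ℤ} {a : ExtForm E} (ha : a.IsHomogeneous z) (X : E) :
    (ExtForm.contract X a).IsHomogeneous (z - 1) := by
  intro k hk
  ext v
  rw [contract_apply, ha (k + 1) (by push_cast; omega)]
  rfl

theorem IsHomogeneous.exists_oneForm {a : ExtForm E} (ha : a.IsHomogeneous 1) :
    ∃ φ, a = oneForm φ := by
  refine ⟨(ContinuousAlternatingMap.ofSubsingleton ℝ E ℝ (0 : Fin 1)).symm (a 1), ?_⟩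
  rw [oneForm, Equiv.apply_symm_apply]
  exact IsHomogeneous.eq_single (k := 1) ha

theorem IsHomogeneous.commute_of_two {w : ExtForm E} (hw : w.IsHomogeneous 2) (a : ExtForm E) :
    Commute w a := by
  induction a using induction_single with
  | zero => exact Commute.zero_right w
  | add a b h h' => exact h.add_right h'
  | single k a =>
    have := hw.mul_comm (isHomogeneous_single k a)
    rwa [Int.negOnePow_even _ (even_two_mul _), one_smul] at this

theorem IsHomogeneous.parity_of_two {w : ExtForm E} (hw : w.IsHomogeneous 2) : parity w = w := by
  rw [hw.parity_eq, Int.negOnePow_even _ even_two, one_smul]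

theorem parity_pow (w : ExtForm E) (m : ℕ) : parity (w ^ m) = parity w ^ m := by
  induction m with
  | zero => rw [pow_zero, pow_zero, parity_one]
  | succ m ih => rw [pow_succ, pow_succ, parity_mul, ih]

/-- This is ι_X(w^m) = m·ι_X w ∧ w^(m-1), multiplied by w so that no exponent m - 1 appears and m =
0 needs no exception. -/
theorem contract_pow_mul {w : ExtForm E} (hw : w.IsHomogeneous 2) (X : E) (m : ℕ) :
    contract X (w ^ m) * w = (m : ℝ) • (contract X w * w ^ m) := by
  induction m with
  | zero => simp [contract_one]
  | succ m ih =>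
    rw [pow_succ, contract_mul, parity_pow, hw.parity_of_two, add_mul, ih,
      ((hw.commute_of_two (contract X w)).pow_left m).eq, smul_mul_assoc, mul_assoc]
    push_cast
    rw [add_smul, one_smul]

/-- The contact volume condition on a one-form and a two-form on a vector space. -/
structure IsContactPair (n : ℕ) (θ w : ExtForm E) : Prop where
  left : θ.IsHomogeneous 1
  right : w.IsHomogeneous 2
  mul_pow_ne_zero : θ * w ^ n ≠ 0

namespace IsContactPair
variable {n : ℕ} {θ w : ExtForm E} (h : IsContactPair n θ w)
include h

theorem ne_zero : θ ≠ 0 := by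
  rintro rfl
  exact h.mul_pow_ne_zero (zero_mul _)

/-- `T` is any vector normalized by θ(T) = 1. Nothing is asked of ι_T w: only the splitting of the
space into ℝT and ker θ will matter. -/
theorem exists_reeb : ∃ φ : E →L[ℝ] ℝ, ∃ T : E, θ = oneForm φ ∧ φ T = 1 := by
  obtain ⟨φ, hφ⟩ := h.left.exists_oneForm
  obtain ⟨v, hv⟩ : ∃ v, φ v ≠ 0 := by
    by_contra! hv
    apply h.ne_zero
    rw [hφ]
    have : φ = 0 := by ext v; exact hv v
    rw [this, oneForm]
    exact Pi.single_zero 1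
  exact ⟨φ, (φ v)⁻¹ • v, hφ, by rw [map_smul, smul_eq_mul, inv_mul_cancel₀ hv]⟩

theorem mul_self : θ * θ = 0 := by
  obtain ⟨φ, T, rfl, -⟩ := h.exists_reeb
  have h2 : (2 : ℝ) • (oneForm φ * oneForm φ) = 0 := by
    rw [two_smul]
    nth_rw 1 [oneForm_anticomm φ φ]
    exact neg_add_cancel _
  exact (smul_eq_zero.1 h2).resolve_left two_ne_zero

theorem mul_comm_left (a : ExtForm E) : θ * a = parity a * θ := by
  obtain ⟨φ, T, rfl, -⟩ := h.exists_reeb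
  exact oneForm_mul_comm φ a

/-- Contracting θ∧ζ = 0 with a vector T such that θ(T) = 1 gives ζ - θ∧ι_Tζ = 0. Thus vertical forms
are the multiples of θ. -/
theorem exists_eq_mul {ζ : ExtForm E} (hζ : θ * ζ = 0) : ∃ T, ζ = θ * contract T ζ := by
  obtain ⟨φ, T, rfl, hT⟩ := h.exists_reeb
  have := contract_oneForm_mul T φ ζ
  rw [hζ, map_zero, hT, one_smul] at this
  exact ⟨T, sub_eq_zero.1 this.symm⟩

/-- The product of two vertical forms vanishes. -/
theorem mul_eq_zero_of_vertical {a b : ExtForm E} (ha : θ * a = 0) (hb : θ * b = 0) :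
    a * b = 0 := by
  obtain ⟨T, hT⟩ := h.exists_eq_mul ha
  rw [hT, h.mul_comm_left, mul_assoc, hb, mul_zero]

theorem vertical_mul {a : ExtForm E} (ha : θ * a = 0) (b : ExtForm E) : θ * (a * b) = 0 := by
  rw [← mul_assoc, ha, zero_mul]

theorem mul_vertical (a : ExtForm E) {b : ExtForm E} (hb : θ * b = 0) : θ * (a * b) = 0 := by
  rw [← mul_assoc, h.mul_comm_left, mul_assoc, hb, mul_zero]

/-- Induction on q. A vertical 0-form vanishes, and a vertical one-form is a multiple of θ, to which
θ∧wⁿ ≠ 0 applies. For q ≥ 2 and X in ker θ, the form ι_Xζ satisfies the hypotheses in degree q - 1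
and so vanishes. Then η = ι_Tζ is killed by contraction with T and with all of ker θ, so η = 0 and ζ
= θ∧η = 0. -/
theorem lefschetz_injective (q : ℕ) : ∀ (_ : q ≤ n + 1) (ζ : ExtForm E), ζ.IsHomogeneous q →
    θ * ζ = 0 → ζ * w ^ (n + 1 - q) = 0 → ζ = 0 := by
  induction q with
  | zero =>
    intro _ ζ hζ hv _
    obtain ⟨T, hT⟩ := h.exists_eq_mul hv
    rw [hT, (hζ.contract T).eq_zero_of_neg (by simp), mul_zero]
  | succ q ih =>
    intro hq ζ hζ hv h0
    obtain ⟨φ, T, hφ, hT⟩ := h.exists_reeb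
    have hζT : ζ = θ * contract T ζ := by
      have := contract_oneForm_mul T φ ζ
      rw [← hφ, hv, map_zero, hT, one_smul] at this
      exact sub_eq_zero.1 this.symm
    cases q with
    | zero =>
      obtain ⟨ψ, rfl⟩ := IsHomogeneous.exists_oneForm (a := ζ) (by simpa using hζ)
      rw [contract_oneForm, mul_smul_comm, mul_one] at hζT
      rw [hζT, smul_mul_assoc, zero_add, Nat.add_sub_cancel] at h0
      rw [hζT, (smul_eq_zero.1 h0).resolve_right h.mul_pow_ne_zero, zero_smul]
    | succ q =>
      have hX : ∀ X, φ X = 0 → contract X ζ = 0 := by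
        intro X hX
        refine ih (by omega) _ ?_ ?_ ?_
        · have := hζ.contract X
          rwa [show ((q + 1 + 1 : ℕ) : ℤ) - 1 = (q + 1 : ℕ) by push_cast; ring] at this
        · have := contract_oneForm_mul X φ ζ
          rw [← hφ, hv, map_zero, hX, zero_smul, zero_sub] at this
          exact neg_eq_zero.1 this.symm
        · obtain ⟨m, hm⟩ : ∃ m, n + 1 - (q + 1 + 1) = m := ⟨_, rfl⟩
          rw [hm] at h0
          rw [show n + 1 - (q + 1) = m + 1 by omega]
          -- Contract ζ∧w^m = 0 with X and multiply by w. One term is ι_Xζ∧w^(m+1), the power that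
          -- the induction hypothesis asks for; the other contains ζ∧w^m up to parity and drops out.
          have h1 := congrArg (fun a => contract X a * w) h0
          simp only [contract_mul, add_mul, map_zero, zero_mul, mul_assoc,
            contract_pow_mul h.right] at h1
          rw [← pow_succ, mul_smul_comm, ← ((h.right.commute_of_two (contract X w)).pow_left m).eq,
            ← mul_assoc (parity ζ)] at h1
          have h2 := congrArg parity h0
          rw [parity_mul, parity_pow, h.right.parity_of_two, map_zero] at h2
          rwa [h2, zero_mul, smul_zero, add_zero] at h1
      have hη : contract T ζ = 0 := by
        refine eq_of_contract_eq ?_ fun v => ?_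
        · exact (hζ.contract T) 0 (by push_cast; omega)
        · have hv' : v = φ v • T + (v - φ v • T) := by abel
          rw [hv', contract_add_left, contract_smul_left, contract_contract_self, smul_zero,
            zero_add, contract_contract_swap, hX _ (by simp [hT]), map_zero, neg_zero, map_zero]
      rw [hζT, hη, mul_zero]

end IsContactPair

theorem finrank_alternating (k : ℕ) :
    Module.finrank ℝ (E [⋀^Fin k]→L[ℝ] ℝ) = (Module.finrank ℝ E).choose k := by
  let ψ : (E [⋀^Fin k]→L[ℝ] ℝ) →ₗ[ℝ] (E [⋀^Fin k]→ₗ[ℝ] ℝ) :=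
    ContinuousAlternatingMap.toAlternatingMapLinear
  have hψ : Function.Bijective ψ := by
    refine ⟨ContinuousAlternatingMap.toAlternatingMap_injective, fun f => ?_⟩
    refine ⟨{ f with cont := ?_ }, rfl⟩
    let b := Module.finBasis ℝ E
    -- Continuity is automatic: in a basis, f is a polynomial in the coordinates of its arguments.
    have h1 : ∀ v : Fin k → E, f v = ∑ r : Fin k → Fin (Module.finrank ℝ E),
        (∏ i, b.coord (r i) (v i)) * f (fun i => b (r i)) := by
      intro v
      have h2 : v = fun i => ∑ j, b.coord j (v i) • b j :=
        funext fun i => (b.sum_repr (v i)).symm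
      conv_lhs => rw [h2]
      refine (f.toMultilinearMap.map_sum _).trans ?_
      refine Finset.sum_congr rfl fun r _ => ?_
      exact f.toMultilinearMap.map_smul_univ _ _
    change Continuous fun v : Fin k → E => f v
    rw [show (fun v : Fin k → E => f v) = _ from funext h1]
    refine continuous_finsetSum _ fun r _ => Continuous.mul ?_ continuous_const
    refine continuous_finsetProd _ fun i _ => ?_
    exact (LinearMap.continuous_of_finiteDimensional (b.coord (r i))).comp (continuous_apply i)
  rw [(LinearEquiv.ofBijective ψ hψ).finrank_eq,
    exteriorPower.alternatingMapLinearEquiv.finrank_eq,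
    ← exteriorPower.finrank_eq ℝ k]
  exact Subspace.dual_finrank_eq

/-- Exterior multiplication of `q`-forms by `θ`. -/
def mulLeftDegree (θ : ExtForm E) (q : ℕ) : (E [⋀^Fin q]→L[ℝ] ℝ) →ₗ[ℝ] E [⋀^Fin (q + 1)]→L[ℝ] ℝ :=
  LinearMap.proj (q + 1) ∘ₗ LinearMap.mulLeft ℝ θ ∘ₗ
    LinearMap.single ℝ (fun k => E [⋀^Fin k]→L[ℝ] ℝ) q

/-- Exterior multiplication of `q`-forms on the right by an element of degree `r - q`. -/
def mulRightDegree (u : ExtForm E) (q r : ℕ) : (E [⋀^Fin q]→L[ℝ] ℝ) →ₗ[ℝ] E [⋀^Fin r]→L[ℝ] ℝ :=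
  LinearMap.proj r ∘ₗ LinearMap.mulRight ℝ u ∘ₗ
    LinearMap.single ℝ (fun k => E [⋀^Fin k]→L[ℝ] ℝ) q

theorem mulLeftDegree_apply {θ : ExtForm E} (hθ : θ.IsHomogeneous 1) {q : ℕ}
    (a : E [⋀^Fin q]→L[ℝ] ℝ) :
    θ * Pi.single q a = Pi.single (q + 1) (mulLeftDegree θ q a) := by
  have := hθ.mul (isHomogeneous_single q a)
  rw [show (1 : ℤ) + q = (q + 1 : ℕ) by push_cast; ring] at this
  exact this.eq_single

theorem mulRightDegree_apply {u : ExtForm E} {p q r : ℕ} (hu : u.IsHomogeneous p) (h : q + p = r)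
    (a : E [⋀^Fin q]→L[ℝ] ℝ) :
    Pi.single q a * u = Pi.single r (mulRightDegree u q r a) := by
  have := (isHomogeneous_single q a).mul hu
  rw [← Nat.cast_add, h] at this
  exact this.eq_single

theorem single_eq_zero_iff {q : ℕ} {a : E [⋀^Fin q]→L[ℝ] ℝ} :
    (Pi.single q a : ExtForm E) = 0 ↔ a = 0 := Pi.single_eq_zero_iff

namespace IsContactPair
variable {n : ℕ} {θ w : ExtForm E} (h : IsContactPair n θ w)
include h

theorem mem_ker_mulLeftDegree {q : ℕ} {a : E [⋀^Fin q]→L[ℝ] ℝ} :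
    a ∈ LinearMap.ker (mulLeftDegree θ q) ↔ θ * (Pi.single q a : ExtForm E) = 0 := by
  rw [mulLeftDegree_apply h.left, single_eq_zero_iff, LinearMap.mem_ker]

/-- Multiplication by a nonzero one-form gives an exact complex; exactness is the divisibility of
vertical forms by θ. It makes the dimension of the vertical forms computable by rank–nullity. -/
theorem range_mulLeftDegree (q : ℕ) :
    LinearMap.range (mulLeftDegree θ q) = LinearMap.ker (mulLeftDegree θ (q + 1)) := by
  ext a
  rw [h.mem_ker_mulLeftDegree]
  constructor
  · rintro ⟨b, rfl⟩
    rw [← mulLeftDegree_apply h.left, ← mul_assoc, h.mul_self, zero_mul]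
  · intro ha
    obtain ⟨T, hT⟩ := h.exists_eq_mul ha
    have h1 := (isHomogeneous_single (q + 1) a).contract T
    rw [show ((q + 1 : ℕ) : ℤ) - 1 = q by push_cast; ring] at h1
    rw [h1.eq_single, mulLeftDegree_apply h.left] at hT
    exact ⟨_, (Pi.single_injective _ hT).symm⟩

/-- Walking along the exact complex of θ, rank–nullity becomes Pascal's rule C(2n+1, q+1) = C(2n, q)
+ C(2n, q+1). -/
theorem finrank_ker_mulLeftDegree (hE : Module.finrank ℝ E = 2 * n + 1) (q : ℕ) :
    Module.finrank ℝ (LinearMap.ker (mulLeftDegree θ (q + 1))) = (2 * n).choose q := by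
  induction q with
  | zero =>
    have h1 := (mulLeftDegree θ 0).finrank_range_add_finrank_ker
    have h2 : LinearMap.ker (mulLeftDegree θ 0) = ⊥ := by
      rw [eq_bot_iff]
      intro a ha
      rw [h.mem_ker_mulLeftDegree] at ha
      obtain ⟨T, hT⟩ := h.exists_eq_mul ha
      rw [((isHomogeneous_single 0 a).contract T).eq_zero_of_neg (by simp), mul_zero,
        single_eq_zero_iff] at hT
      simp [hT]
    rw [h.range_mulLeftDegree, h2, finrank_bot, finrank_alternating] at h1
    simpa using h1
  | succ q ih =>
    have h1 := (mulLeftDegree θ (q + 1)).finrank_range_add_finrank_ker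
    rw [h.range_mulLeftDegree, ih, finrank_alternating, hE, Nat.choose_succ_succ'] at h1
    omega

theorem finrank_ker_eq (hE : Module.finrank ℝ E = 2 * n + 1) {q r : ℕ}
    (hqr : q + r = 2 * n + 2) :
    Module.finrank ℝ (LinearMap.ker (mulLeftDegree θ q)) =
      Module.finrank ℝ (LinearMap.ker (mulLeftDegree θ r)) := by
  -- The binomial formula starts in degree 1, so the extreme pair of degrees 0 and 2n + 2 is
  -- separate; both spaces are zero. All other pairs are matched by the symmetry of the binomial
  -- coefficients.
  have h0 : ∀ r, 2 * n + 2 = r → Module.finrank ℝ (LinearMap.ker (mulLeftDegree θ 0)) =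
      Module.finrank ℝ (LinearMap.ker (mulLeftDegree θ r)) := by
    rintro r rfl
    have h1 := (mulLeftDegree θ 0).finrank_range_add_finrank_ker
    rw [h.range_mulLeftDegree, h.finrank_ker_mulLeftDegree hE, finrank_alternating,
      Nat.choose_zero_right, Nat.choose_zero_right] at h1
    rw [h.finrank_ker_mulLeftDegree hE, Nat.choose_eq_zero_of_lt (by omega)]
    omega
  rcases q with _ | q
  · exact h0 r (by omega)
  rcases r with _ | r
  · exact (h0 (q + 1) (by omega)).symm
  rw [h.finrank_ker_mulLeftDegree hE, h.finrank_ker_mulLeftDegree hE]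
  exact Nat.choose_symm_of_eq_add (by omega)

/-- Lefschetz isomorphism for vertical forms. -/
theorem lefschetz_surjective (hE : Module.finrank ℝ E = 2 * n + 1) {q : ℕ} (hq : q ≤ n + 1)
    {β : ExtForm E} (hβ : β.IsHomogeneous (2 * n + 2 - q)) (hv : θ * β = 0) :
    ∃ ζ : ExtForm E, ζ.IsHomogeneous q ∧ θ * ζ = 0 ∧ ζ * w ^ (n + 1 - q) = β := by
  obtain ⟨r, hr⟩ : ∃ r, q + r = 2 * n + 2 := ⟨2 * n + 2 - q, by omega⟩
  have hpow : (w ^ (n + 1 - q)).IsHomogeneous ((2 * (n + 1 - q) : ℕ) : ℤ) := by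
    have := h.right.pow (n + 1 - q)
    rwa [show ((n + 1 - q : ℕ) : ℤ) * 2 = ((2 * (n + 1 - q) : ℕ) : ℤ) by push_cast; ring] at this
  have hsum : q + 2 * (n + 1 - q) = r := by omega
  rw [show (2 * (n : ℤ) + 2 - q) = (r : ℕ) by omega] at hβ
  -- Multiplication by w^(n+1-q) is injective between the vertical forms of degrees q and r, which
  -- have equal dimension, hence it is onto.
  obtain ⟨a, ha, hab⟩ := exists_mem_apply_eq_of_finrank_eq (mulRightDegree (w ^ (n + 1 - q)) q r)
    (S := LinearMap.ker (mulLeftDegree θ q)) (T := LinearMap.ker (mulLeftDegree θ r))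
    (fun a ha => by
      rw [h.mem_ker_mulLeftDegree] at ha ⊢
      rw [← mulRightDegree_apply hpow hsum, ← mul_assoc, ha, zero_mul])
    (fun a ha h0 => by
      refine single_eq_zero_iff.1 (h.lefschetz_injective q hq (Pi.single q a)
        (isHomogeneous_single q a) (h.mem_ker_mulLeftDegree.1 ha) ?_)
      rw [mulRightDegree_apply hpow hsum, h0]
      exact Pi.single_zero r)
    (h.finrank_ker_eq hE hr) (β r) (h.mem_ker_mulLeftDegree.2 (by rw [← hβ.eq_single, hv]))
  refine ⟨Pi.single q a, isHomogeneous_single q a, h.mem_ker_mulLeftDegree.1 ha, ?_⟩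
  rw [mulRightDegree_apply hpow hsum, hab, ← hβ.eq_single]

end IsContactPair

end ExtForm
end Lefschetz

/-! ### Exterior calculus on a vector space, and smooth dependence of solutions of linear systems -/

section Calculus
variable {E : Type*} [NormedAddCommGroup E] [NormedSpace ℝ E] [FiniteDimensional ℝ E]

/-- A bilinear map between finite-dimensional spaces as a continuous bilinear map. -/
def continuousBilinear {F G H : Type*} [NormedAddCommGroup F] [NormedSpace ℝ F]
    [NormedAddCommGroup G] [NormedSpace ℝ G] [NormedAddCommGroup H] [NormedSpace ℝ H]
    [FiniteDimensional ℝ F] [FiniteDimensional ℝ G] (B : F →ₗ[ℝ] G →ₗ[ℝ] H) : F →L[ℝ] G →L[ℝ] H :=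
  LinearMap.toContinuousLinearMap
    ((LinearMap.toContinuousLinearMap (𝕜 := ℝ) (E := G) (F' := H)).toLinearMap ∘ₗ B)

theorem extDeriv_zero (k : ℕ) (y : E) : extDeriv (fun _ : E => (0 : E [⋀^Fin k]→L[ℝ] ℝ)) y = 0 := by
  have h := extDeriv_fun_smul (x := y) (0 : ℝ) (fun _ : E => (0 : E [⋀^Fin k]→L[ℝ] ℝ))
  rw [zero_smul] at h
  exact h.trans (zero_smul ℝ _)

namespace ExtForm

/-- All components of a form on a vector space are smooth on `s`. -/
def SmoothOn (a : E → ExtForm E) (s : Set E) : Prop :=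
  ∀ k, ContDiffOn ℝ ∞ (fun y => a y k) s

theorem SmoothOn.mul {a b : E → ExtForm E} {s : Set E} (ha : SmoothOn a s) (hb : SmoothOn b s) :
    SmoothOn (fun y => a y * b y) s := by
  intro k
  change ContDiffOn ℝ ∞ (fun y => ∑ pq : Finset.HasAntidiagonal.antidiagonal k,
    altWedge (Finset.HasAntidiagonal.mem_antidiagonal.1 pq.2) (a y pq.1.1) (b y pq.1.2)) s
  exact ContDiffOn.sum fun pq _ => contDiffOn_comp₂ (contDiff_altWedge _) (ha pq.1.1) (hb pq.1.2)

theorem smoothOn_const (a : ExtForm E) (s : Set E) : SmoothOn (fun _ => a) s :=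
  fun _ => contDiffOn_const

theorem SmoothOn.pow {a : E → ExtForm E} {s : Set E} (ha : SmoothOn a s) (m : ℕ) :
    SmoothOn (fun y => a y ^ m) s := by
  induction m with
  | zero => simpa only [pow_zero] using smoothOn_const 1 s
  | succ m ih => simpa only [pow_succ] using ih.mul ha

/-- The exterior derivative of an inhomogeneous form on a vector space. -/
def extD (a : E → ExtForm E) (y : E) : ExtForm E
  | 0 => 0
  | k + 1 => extDeriv (fun z => a z k) y

/-- The directional derivative of an inhomogeneous form on a vector space. -/
def dirDeriv (a : E → ExtForm E) (y v : E) : ExtForm E := fun k => fderiv ℝ (fun z => a z k) y v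

theorem extD_eq_sum {ι : Type*} [Fintype ι] (b : Module.Basis ι ℝ E) (a : E → ExtForm E) (y : E) :
    extD a y = ∑ i, oneForm (LinearMap.toContinuousLinearMap (b.coord i)) *
      dirDeriv a y (b i) := by
  funext k
  cases k with
  | zero => rw [Finset.sum_apply, Finset.sum_eq_zero fun i _ => oneForm_mul_zero _ _]; rfl
  | succ k => rw [sum_coord_mul b k _ (fderiv ℝ (fun z => a z k) y) fun i => rfl]; rfl

/-- The exterior product of homogeneous forms as a continuous bilinear map. -/
def altWedgeL {p q k : ℕ} (h : p + q = k) :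
    (E [⋀^Fin p]→L[ℝ] ℝ) →L[ℝ] (E [⋀^Fin q]→L[ℝ] ℝ) →L[ℝ] E [⋀^Fin k]→L[ℝ] ℝ :=
  continuousBilinear (F := E [⋀^Fin p]→L[ℝ] ℝ) (G := E [⋀^Fin q]→L[ℝ] ℝ) (H := E [⋀^Fin k]→L[ℝ] ℝ)
    (LinearMap.mk₂ ℝ (altWedge h) (altWedge_add_left h) (altWedge_smul_left h)
      (altWedge_add_right h) (altWedge_smul_right h))

theorem dirDeriv_mul {a b : E → ExtForm E} {y : E}
    (ha : ∀ k, DifferentiableAt ℝ (fun z => a z k) y)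
    (hb : ∀ k, DifferentiableAt ℝ (fun z => b z k) y) (v : E) :
    dirDeriv (fun z => a z * b z) y v = dirDeriv a y v * b y + a y * dirDeriv b y v := by
  funext k
  have h1 : ∀ (pq : Finset.HasAntidiagonal.antidiagonal k), HasFDerivAt
      (fun z => altWedge (Finset.HasAntidiagonal.mem_antidiagonal.1 pq.2) (a z pq.1.1) (b z pq.1.2))
      _ y := fun pq =>
    (altWedgeL (Finset.HasAntidiagonal.mem_antidiagonal.1 pq.2)).hasFDerivAt_of_bilinear
      (ha pq.1.1).hasFDerivAt (hb pq.1.2).hasFDerivAt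
  have h2 := HasFDerivAt.fun_sum (u := Finset.univ) fun pq _ => h1 pq
  have h3 : fderiv ℝ (fun z => (a z * b z) k) y = _ := h2.fderiv
  rw [dirDeriv, h3, sum_apply, Pi.add_apply]
  change _ = (∑ pq : Finset.HasAntidiagonal.antidiagonal k, _) +
    ∑ pq : Finset.HasAntidiagonal.antidiagonal k, _
  rw [← Finset.sum_add_distrib]
  refine Finset.sum_congr rfl fun pq _ => ?_
  rw [add_comm]
  rfl

/-- With d = ∑ bⁱ ∧ ∂ᵢ this is the product rule for each ∂ᵢ; the parity comes from moving bⁱ past a.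
-/
theorem extD_mul {a b : E → ExtForm E} {y : E}
    (ha : ∀ k, DifferentiableAt ℝ (fun z => a z k) y)
    (hb : ∀ k, DifferentiableAt ℝ (fun z => b z k) y) :
    extD (fun z => a z * b z) y = extD a y * b y + parity (a y) * extD b y := by
  let B := Module.finBasis ℝ E
  rw [extD_eq_sum B, extD_eq_sum B a, extD_eq_sum B b, Finset.sum_mul, Finset.mul_sum,
    ← Finset.sum_add_distrib]
  refine Finset.sum_congr rfl fun i _ => ?_
  rw [dirDeriv_mul ha hb, mul_add, ← mul_assoc, ← mul_assoc, oneForm_mul_comm _ (a y),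
    mul_assoc (parity (a y))]

/-- Pull-back of inhomogeneous forms. -/
def pullback {V W : Type*} [AddCommGroup V] [Module ℝ V] [TopologicalSpace V] [AddCommGroup W]
    [Module ℝ W] [TopologicalSpace W] (f : W →L[ℝ] V) (a : ExtForm V) : ExtForm W :=
  fun k => (a k).compContinuousLinearMap f

theorem pullback_mul (f : E →L[ℝ] E) (a b : ExtForm E) :
    pullback f (a * b) = pullback f a * pullback f b := by
  funext k
  change (∑ pq : Finset.HasAntidiagonal.antidiagonal k, _ :
    E [⋀^Fin k]→L[ℝ] ℝ).compContinuousLinearMap f = _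
  rw [← ContinuousAlternatingMap.compContinuousLinearMapₗ_apply, map_sum]
  exact Finset.sum_congr rfl fun pq _ => altWedge_compContinuousLinearMap _ _ _ _

theorem pullback_add (f : E →L[ℝ] E) (a b : ExtForm E) :
    pullback f (a + b) = pullback f a + pullback f b := rfl

theorem pullback_zero (f : E →L[ℝ] E) : pullback f (0 : ExtForm E) = 0 := rfl

theorem pullback_one (f : E →L[ℝ] E) : pullback f (1 : ExtForm E) = 1 := by
  funext k
  change ((unit : ExtForm E) k).compContinuousLinearMap f = (unit : ExtForm E) k
  rw [unit]
  by_cases hk : k = 0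
  · subst hk; ext v; simp
  · rw [Pi.single_eq_of_ne hk]; rfl

theorem pullback_pow (f : E →L[ℝ] E) (a : ExtForm E) (m : ℕ) :
    pullback f (a ^ m) = pullback f a ^ m := by
  induction m with
  | zero => rw [pow_zero, pow_zero, pullback_one]
  | succ m ih => rw [pow_succ, pow_succ, pullback_mul, ih]

theorem pullback_parity (f : E →L[ℝ] E) (a : ExtForm E) :
    pullback f (parity a) = parity (pullback f a) := rfl

theorem IsHomogeneous.pullback {z : ℤ} {a : ExtForm E} (ha : a.IsHomogeneous z) (f : E →L[ℝ] E) :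
    (ExtForm.pullback f a).IsHomogeneous z := fun k hk => by
  rw [ExtForm.pullback, ha k hk]; rfl

theorem extD_isHomogeneous {a : E → ExtForm E} {y : E} {z : ℤ}
    (ha : ∀ᶠ x in 𝓝 y, (a x).IsHomogeneous z) : (extD a y).IsHomogeneous (z + 1) := by
  intro k hk
  cases k with
  | zero => rfl
  | succ k =>
    have : (fun x => a x k) =ᶠ[𝓝 y] fun _ => 0 := by
      filter_upwards [ha] with x hx
      exact hx k (by push_cast at hk; omega)
    change extDeriv (fun x => a x k) y = 0
    rw [this.extDeriv_eq]
    exact extDeriv_zero k y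

theorem extD_congr {a b : E → ExtForm E} {y : E} (h : ∀ᶠ x in 𝓝 y, a x = b x) :
    extD a y = extD b y := by
  funext k
  cases k with
  | zero => rfl
  | succ k =>
    refine Filter.EventuallyEq.extDeriv_eq ?_
    filter_upwards [h] with x hx
    rw [hx]

theorem extD_const_zero (y : E) : extD (fun _ : E => (0 : ExtForm E)) y = 0 := by
  funext k
  cases k with
  | zero => rfl
  | succ k => exact extDeriv_zero k y

theorem extD_extD {a : E → ExtForm E} {s : Set E} (hs : IsOpen s) (ha : SmoothOn a s) {y : E}
    (hy : y ∈ s) : extD (extD a) y = 0 := by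
  funext k
  match k with
  | 0 => rfl
  | 1 => exact extDeriv_zero 0 y
  | k + 2 =>
    refine extDeriv_extDeriv_apply ((ha k).contDiffAt (hs.mem_nhds hy)) ?_
    rw [minSmoothness_of_isRCLikeNormedField]; exact WithTop.coe_le_coe.2 le_top

end ExtForm

/-- Near y choose a left inverse S of T(y). Then S∘T(x) is the identity at x = y, hence invertible
nearby, and u(x) = (S∘T(x))⁻¹ S r(x) is smooth since inversion is. The system may be overdetermined.
-/
theorem contDiffOn_of_injective {D F G : Type*} [NormedAddCommGroup D] [NormedSpace ℝ D]
    [FiniteDimensional ℝ D]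
    [NormedAddCommGroup F] [NormedSpace ℝ F] [FiniteDimensional ℝ F] [NormedAddCommGroup G]
    [NormedSpace ℝ G] [FiniteDimensional ℝ G] {s : Set D} (hs : IsOpen s) {T : D → F →ₗ[ℝ] G}
    {u : D → F} {r : D → G} (hT : ∀ a, ContDiffOn ℝ ∞ (fun y => T y a) s)
    (hr : ContDiffOn ℝ ∞ r s) (hinj : ∀ y ∈ s, ∀ a, T y a = 0 → a = 0)
    (hu : ∀ y ∈ s, T y (u y) = r y) : ContDiffOn ℝ ∞ u s := by
  intro y hy
  refine ContDiffAt.contDiffWithinAt ?_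
  obtain ⟨S, hS⟩ := LinearMap.exists_leftInverse_of_injective (T y)
    (LinearMap.ker_eq_bot'.2 (hinj y hy))
  let A : D → F →L[ℝ] F := fun x => LinearMap.toContinuousLinearMap (S ∘ₗ T x)
  have hSc : ContDiff ℝ ∞ (fun g => S g) := (LinearMap.toContinuousLinearMap S).contDiff
  have hA : ContDiffOn ℝ ∞ A s := contDiffOn_clm_apply.2 fun a => hSc.comp_contDiffOn (hT a)
  have hAy : A y = (ContinuousLinearEquiv.refl ℝ F : F →L[ℝ] F) := by
    ext a; exact congrArg (fun f => f a) hS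
  have hAs := hA.contDiffAt (hs.mem_nhds hy)
  have hinv : ContDiffAt ℝ ∞ (fun x => ContinuousLinearMap.inverse (A x)) y := by
    have h1 : ContDiffAt ℝ ∞ (ContinuousLinearMap.inverse : (F →L[ℝ] F) → F →L[ℝ] F) (A y) := by
      rw [hAy]
      exact contDiffAt_map_inverse (ContinuousLinearEquiv.refl ℝ F)
    exact h1.comp y hAs
  have hSr : ContDiffAt ℝ ∞ (fun x => S (r x)) y :=
    hSc.contDiffAt.comp y (hr.contDiffAt (hs.mem_nhds hy))
  refine (hinv.clm_apply hSr).congr_of_eventuallyEq ?_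
  have hnhds : ∀ᶠ x in 𝓝 y, A x ∈ Set.range ((↑) : (F ≃L[ℝ] F) → F →L[ℝ] F) := by
    refine hAs.continuousAt ?_
    rw [hAy]
    exact ContinuousLinearEquiv.nhds (ContinuousLinearEquiv.refl ℝ F)
  filter_upwards [hnhds, hs.mem_nhds hy] with x hx hxs
  obtain ⟨e, he⟩ := hx
  have h1 : S (r x) = e (u x) := by
    rw [← hu x hxs]
    exact (congrArg (fun f => f (u x)) he).symm
  rw [h1, ← he, ContinuousLinearMap.inverse_equiv]
  simp

end Calculus

/-! ### Exterior calculus on the manifold, through charts -/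

section ManifoldCalculus
variable {E : Type*} [NormedAddCommGroup E] [NormedSpace ℝ E] [FiniteDimensional ℝ E]
variable {M : Type*} [TopologicalSpace M] [ChartedSpace E M]

open ExtForm

namespace FormField

/-- The value of a form field at a point, as a form on the model space. -/
def val (α : FormField E M) (x : M) : ExtForm E := α x

/-- A form field read in the preferred chart at `x₀`. -/
def rep (α : FormField E M) (x₀ : M) (y : E) : ExtForm E := fun k => α.inChart x₀ k y

theorem ext_val {α β : FormField E M} (h : ∀ x, α.val x = β.val x) : α = β := funext h

theorem val_wedge (α β : FormField E M) (x : M) : (α.wedge β).val x = α.val x * β.val x := rfl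

theorem SmoothOn.rep {α : FormField E M} {U : Set M} (h : α.SmoothOn U) (x₀ : M) :
    ExtForm.SmoothOn (α.rep x₀) ((chartAt E x₀).target ∩ (chartAt E x₀).symm ⁻¹' U) := h x₀

theorem rep_eq_pullback (α : FormField E M) (x₀ : M) (y : E) :
    α.rep x₀ y = pullback (show E →L[ℝ] E from chartSymmDeriv x₀ y)
      (α.val ((chartAt E x₀).symm y)) := rfl

theorem rep_wedge (α β : FormField E M) (x₀ : M) (y : E) :
    (α.wedge β).rep x₀ y = α.rep x₀ y * β.rep x₀ y := by
  rw [rep_eq_pullback, val_wedge, pullback_mul]; rfl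

theorem isOpen_chart_domain (x₀ : M) {U : Set M} (hU : IsOpen U) :
    IsOpen ((chartAt E x₀).target ∩ (chartAt E x₀).symm ⁻¹' U) :=
  (chartAt E x₀).symm.isOpen_inter_preimage hU

theorem mem_chart_domain {x : M} {U : Set M} (hx : x ∈ U) :
    chartAt E x x ∈ (chartAt E x).target ∩ (chartAt E x).symm ⁻¹' U :=
  ⟨mem_chart_target E x, by simpa using hx⟩

theorem SmoothOn.differentiableAt_rep {α : FormField E M} {U : Set M} (hU : IsOpen U)
    (h : α.SmoothOn U) {x : M} (hx : x ∈ U) (k : ℕ) :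
    DifferentiableAt ℝ (fun y => α.rep x y k) (chartAt E x x) :=
  ((h x k).contDiffAt ((isOpen_chart_domain x hU).mem_nhds (mem_chart_domain hx))).differentiableAt
    (by simp)

theorem val_d (α : FormField E M) (x : M) :
    α.d.val x = pullback (show E →L[ℝ] E from chartDeriv x)
      (extD (α.rep x) (chartAt E x x)) := by
  funext k
  cases k with
  | zero => rfl
  | succ k => rfl

variable [IsManifold 𝓘(ℝ, E) ∞ M]

theorem chartSymmDeriv_comp_chartDeriv (x : M) :
    (show E →L[ℝ] E from chartSymmDeriv x (chartAt E x x)) ∘L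
      (show E →L[ℝ] E from chartDeriv x) = ContinuousLinearMap.id ℝ E :=
  (mdifferentiable_chart (I := 𝓘(ℝ, E)) x).symm_comp_deriv (mem_chart_source E x)

/-- The derivative of the inverse chart has a right inverse g, and pulling back further by g
recovers the form. It keeps θ∧dθⁿ nonzero in charts. -/
theorem pullback_chartSymmDeriv_injective (x₀ : M) {y : E} (hy : y ∈ (chartAt E x₀).target)
    {a : ExtForm E} (h : pullback (show E →L[ℝ] E from chartSymmDeriv x₀ y) a = 0) : a = 0 := by
  obtain ⟨g, hg⟩ : ∃ g : E →L[ℝ] E,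
      (show E →L[ℝ] E from chartSymmDeriv x₀ y) ∘L g = ContinuousLinearMap.id ℝ E := by
    have h1 := (mdifferentiable_chart (I := 𝓘(ℝ, E)) x₀).symm_comp_deriv
      ((chartAt E x₀).map_target hy)
    rw [(chartAt E x₀).right_inv hy] at h1
    exact ⟨_, h1⟩
  have h2 := congrArg (pullback g) h
  rw [pullback_zero] at h2
  funext k
  ext v
  have h3 := congrArg (fun f : ExtForm E => f k v) h2
  have h4 : ∀ v, (show E →L[ℝ] E from chartSymmDeriv x₀ y) (g v) = v := fun v =>
    congrArg (fun f => f v) hg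
  change a k (fun i => (show E →L[ℝ] E from chartSymmDeriv x₀ y) (g (v i))) = 0 at h3
  simp only [h4] at h3
  exact h3

/-- The chart at x and its inverse have mutually inverse derivatives, so a form is recovered from
its chart representation. Pointwise identities on M thereby follow from identities on the model
space. -/
theorem val_eq_pullback (α : FormField E M) (x : M) :
    α.val x = pullback (show E →L[ℝ] E from chartDeriv x) (α.rep x (chartAt E x x)) := by
  funext k
  have h1 := FormField.compContinuousLinearMap_congr α k
    ((chartAt E x).left_inv (mem_chart_source E x))
    ((show E →L[ℝ] E from chartSymmDeriv x (chartAt E x x)) ∘L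
      (show E →L[ℝ] E from chartDeriv x)) (ContinuousLinearMap.id ℝ E)
      (chartSymmDeriv_comp_chartDeriv x)
  refine Eq.trans ?_ h1.symm
  ext v
  rfl

theorem rep_d {α : FormField E M} {U : Set M} (hU : IsOpen U) (hα : α.SmoothOn U) (x₀ : M) {y : E}
    (hy : y ∈ (chartAt E x₀).target ∩ (chartAt E x₀).symm ⁻¹' U) :
    α.d.rep x₀ y = extD (α.rep x₀) y := by
  funext k
  cases k with
  | zero => rfl
  | succ k => exact FormField.inChart_d hU hα x₀ k hy.1 hy.2

/-- The Leibniz rule. -/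
theorem val_d_wedge {α β : FormField E M} {U : Set M} (hU : IsOpen U) (hα : α.SmoothOn U)
    (hβ : β.SmoothOn U) {x : M} (hx : x ∈ U) :
    (α.wedge β).d.val x = α.d.val x * β.val x + parity (α.val x) * β.d.val x := by
  rw [val_d, val_d, val_d, val_eq_pullback α, val_eq_pullback β, ← pullback_parity,
    ← pullback_mul, ← pullback_mul, ← pullback_add,
    ← extD_mul (hα.differentiableAt_rep hU hx) (hβ.differentiableAt_rep hU hx)]
  simp only [← rep_wedge]

/-- Since d is local, a pullback-stable property known on an open set of M is needed only near the
image point in the chart. -/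
theorem eventually_rep {x : M} {U : Set M} (hU : IsOpen U) (hx : x ∈ U) {α : FormField E M}
    {P : ExtForm E → Prop} (hP : ∀ (f : E →L[ℝ] E) a, P a → P (pullback f a))
    (h : ∀ y ∈ U, P (α.val y)) : ∀ᶠ y in 𝓝 (chartAt E x x), P (α.rep x y) := by
  filter_upwards [(isOpen_chart_domain x hU).mem_nhds (mem_chart_domain hx)] with y hy
  exact hP _ _ (h _ hy.2)

theorem d_isHomogeneous {α : FormField E M} {U : Set M} (hU : IsOpen U) {z : ℤ}
    (h : ∀ y ∈ U, (α.val y).IsHomogeneous z) {x : M} (hx : x ∈ U) :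
    (α.d.val x).IsHomogeneous (z + 1) := by
  rw [val_d]
  exact (extD_isHomogeneous (eventually_rep hU hx (fun f a ha => ha.pullback f) h)).pullback _

theorem d_eq_zero_of_eq_zero {α : FormField E M} {U : Set M} (hU : IsOpen U)
    (h : ∀ y ∈ U, α.val y = 0) {x : M} (hx : x ∈ U) : α.d.val x = 0 := by
  rw [val_d, extD_congr (b := fun _ => 0) (eventually_rep (P := fun a => a = 0) hU hx
    (fun f a ha => by rw [ha, pullback_zero]) h), extD_const_zero, pullback_zero]

/-- The field dα is defined with a different chart at each point. Chart independence (`rep_d`) lets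
the single chart at x represent it in a whole neighbourhood, where d² = 0 is known. -/
theorem val_d_d {α : FormField E M} {U : Set M} (hU : IsOpen U) (hα : α.SmoothOn U) {x : M}
    (hx : x ∈ U) : α.d.d.val x = 0 := by
  have hy := mem_chart_domain (E := E) hx
  have ho := isOpen_chart_domain (E := E) x hU
  rw [val_d, extD_congr (b := extD (α.rep x)), extD_extD ho (hα.rep x) hy, pullback_zero]
  filter_upwards [ho.mem_nhds hy] with y hy
  exact rep_d hU hα x hy

end FormField

end ManifoldCalculus

/-! ### The equations defining Γ at a point -/

section LefschetzImage
variable {E : Type*} [NormedAddCommGroup E] [NormedSpace ℝ E] [FiniteDimensional ℝ E]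

open ExtForm

/-- The conditions on `τ = Γ α`, where `α` has degree `k`, at a point. -/
structure IsLefschetzImage (n : ℕ) (θ w : ExtForm E) (k : ℤ) (α τ : ExtForm E) : Prop where
  homogeneous : τ.IsHomogeneous (k - 1)
  vertical : θ * τ = 0
  low : k ≤ n → θ * α * w ^ (n + 1 - k).toNat = τ * w ^ (n + 2 - k).toNat
  high : n + 1 ≤ k → ∃ ζ : ExtForm E, ζ.IsHomogeneous (2 * n + 1 - k) ∧ θ * ζ = 0 ∧
    θ * α = ζ * w ^ (k - n).toNat ∧ τ = ζ * w ^ (k - n - 1).toNat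

namespace ExtForm.IsContactPair
variable {n : ℕ} {θ w : ExtForm E} (h : IsContactPair n θ w)
include h

theorem eq_zero_of_mul_pow_eq_zero {z : ℤ} (hz : z ≤ n + 1) {ζ : ExtForm E}
    (hζ : ζ.IsHomogeneous z) (hv : θ * ζ = 0) {m : ℕ} (hm : m + z = n + 1)
    (h0 : ζ * w ^ m = 0) : ζ = 0 := by
  by_cases hz0 : 0 ≤ z
  · lift z to ℕ using hz0
    refine h.lefschetz_injective z (by omega) ζ hζ hv ?_
    rwa [show n + 1 - z = m by omega]
  · exact hζ.eq_zero_of_neg (by omega)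

theorem exists_mul_pow_eq (hE : Module.finrank ℝ E = 2 * n + 1) {z : ℤ} (hz : z ≤ n + 1)
    {β : ExtForm E} {m : ℕ} (hm : m + z = n + 1) (hβ : β.IsHomogeneous (2 * n + 2 - z))
    (hv : θ * β = 0) :
    ∃ ζ : ExtForm E, ζ.IsHomogeneous z ∧ θ * ζ = 0 ∧ ζ * w ^ m = β := by
  by_cases hz0 : 0 ≤ z
  · lift z to ℕ using hz0
    have := h.lefschetz_surjective hE (q := z) (by omega) hβ hv
    rwa [show n + 1 - z = m by omega] at this
  · rw [hβ.eq_zero_of_finrank_lt (by rw [hE]; push_cast; omega)]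
    exact ⟨0, isHomogeneous_zero _, mul_zero _, zero_mul _⟩

/-- For k ≤ n the vertical form θ∧α∧w^(n+1-k) has degree 2n+2-(k-1), so the isomorphism in degree k
- 1 gives τ. For k > n the form θ∧α has degree 2n+2-(2n+1-k), and the isomorphism in degree 2n + 1 -
k gives ζ. -/
theorem exists_isLefschetzImage (hE : Module.finrank ℝ E = 2 * n + 1) {k : ℤ} {α : ExtForm E}
    (hα : α.IsHomogeneous k) : ∃ τ, IsLefschetzImage n θ w k α τ := by
  have hθα := h.left.mul hα
  have hv : θ * (θ * α) = 0 := by rw [← mul_assoc, h.mul_self, zero_mul]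
  by_cases hk : k ≤ n
  · obtain ⟨τ, h1, h2, h3⟩ := h.exists_mul_pow_eq hE (z := k - 1) (by omega)
      (β := θ * α * w ^ (n + 1 - k).toNat) (m := (n + 2 - k).toNat) (by omega)
      (by
        have := hθα.mul (h.right.pow (n + 1 - k).toNat)
        rwa [show (1 + k + ((n + 1 - k).toNat : ℤ) * 2) = 2 * n + 2 - (k - 1) by omega] at this)
      (h.vertical_mul hv _)
    exact ⟨τ, h1, h2, fun _ => h3.symm, fun hk' => by omega⟩
  · obtain ⟨ζ, h1, h2, h3⟩ := h.exists_mul_pow_eq hE (z := 2 * n + 1 - k) (by omega)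
      (β := θ * α) (m := (k - n).toNat) (by omega)
      (by rwa [show (1 + k) = 2 * (n : ℤ) + 2 - (2 * n + 1 - k) by omega] at hθα) hv
    refine ⟨ζ * w ^ (k - n - 1).toNat, ?_, h.vertical_mul h2 _, fun hk' => by omega,
      fun _ => ⟨ζ, h1, h2, h3.symm, rfl⟩⟩
    have := h1.mul (h.right.pow (k - n - 1).toNat)
    rwa [show (2 * n + 1 - k + ((k - n - 1).toNat : ℤ) * 2) = k - 1 by omega] at this

end ExtForm.IsContactPair

namespace IsLefschetzImage
variable {n : ℕ} {θ w : ExtForm E} {k : ℤ} {α β τ σ : ExtForm E}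

/-- Lefschetz injectivity determines τ in low degrees and the auxiliary ζ, hence τ, in high degrees.
-/
theorem unique (h : IsContactPair n θ w) (h₁ : IsLefschetzImage n θ w k α τ)
    (h₂ : IsLefschetzImage n θ w k α σ) : τ = σ := by
  have key : ∀ {z : ℤ} {a b : ExtForm E} {m : ℕ}, z ≤ n + 1 → m + z = n + 1 → a.IsHomogeneous z →
      b.IsHomogeneous z → θ * a = 0 → θ * b = 0 → a * w ^ m = b * w ^ m → a = b := by
    intro z a b m hz hm ha hb hva hvb hab
    have := h.eq_zero_of_mul_pow_eq_zero hz (ζ := a + (-1 : ℝ) • b) (ha.add (hb.smul _))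
      (by rw [mul_add, hva, mul_smul_comm, hvb, smul_zero, add_zero]) hm
      (by rw [add_mul, smul_mul_assoc, hab, neg_one_smul, add_neg_cancel])
    rwa [neg_one_smul, add_neg_eq_zero] at this
  by_cases hk : k ≤ n
  · exact key (m := (n + 2 - k).toNat) (by omega) (by omega) h₁.homogeneous h₂.homogeneous
      h₁.vertical h₂.vertical ((h₁.low hk).symm.trans (h₂.low hk))
  · obtain ⟨ζ, a1, a2, a3, rfl⟩ := h₁.high (by omega)
    obtain ⟨ξ, b1, b2, b3, rfl⟩ := h₂.high (by omega)
    rw [key (m := (k - n).toNat) (by omega) (by omega) a1 b1 a2 b2 (a3.symm.trans b3)]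

theorem add (h₁ : IsLefschetzImage n θ w k α τ) (h₂ : IsLefschetzImage n θ w k β σ) :
    IsLefschetzImage n θ w k (α + β) (τ + σ) where
  homogeneous := h₁.homogeneous.add h₂.homogeneous
  vertical := by rw [mul_add, h₁.vertical, h₂.vertical, add_zero]
  low hk := by rw [mul_add, add_mul, add_mul, h₁.low hk, h₂.low hk]
  high hk := by
    obtain ⟨ζ, a1, a2, a3, a4⟩ := h₁.high hk
    obtain ⟨ξ, b1, b2, b3, b4⟩ := h₂.high hk
    exact ⟨ζ + ξ, a1.add b1, by rw [mul_add, a2, b2, add_zero],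
      by rw [mul_add, add_mul, a3, b3], by rw [add_mul, a4, b4]⟩

theorem smul (c : ℝ) (h₁ : IsLefschetzImage n θ w k α τ) :
    IsLefschetzImage n θ w k (c • α) (c • τ) where
  homogeneous := h₁.homogeneous.smul c
  vertical := by rw [mul_smul_comm, h₁.vertical, smul_zero]
  low hk := by rw [mul_smul_comm, smul_mul_assoc, smul_mul_assoc, h₁.low hk]
  high hk := by
    obtain ⟨ζ, a1, a2, a3, a4⟩ := h₁.high hk
    exact ⟨c • ζ, a1.smul c, by rw [mul_smul_comm, a2, smul_zero],
      by rw [mul_smul_comm, smul_mul_assoc, a3], by rw [smul_mul_assoc, a4]⟩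

theorem pullback (h : IsLefschetzImage n θ w k α τ) (f : E →L[ℝ] E) :
    IsLefschetzImage n (ExtForm.pullback f θ) (ExtForm.pullback f w) k (ExtForm.pullback f α)
      (ExtForm.pullback f τ) where
  homogeneous := h.homogeneous.pullback f
  vertical := by rw [← pullback_mul, h.vertical, pullback_zero]
  low hk := by
    simp only [← pullback_mul, ← pullback_pow]
    rw [h.low hk]
  high hk := by
    obtain ⟨ζ, a1, a2, a3, a4⟩ := h.high hk
    simp only [← pullback_mul, ← pullback_pow]
    exact ⟨ExtForm.pullback f ζ, a1.pullback f, by rw [← pullback_mul, a2, pullback_zero],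
      by rw [a3, pullback_mul], by rw [a4, pullback_mul]⟩

/-- On vertical forms, multiplication by (cw + v)^m is c^m times multiplication by w^m, because v is
vertical and vertical forms multiply to zero. In low degrees both sides of the equation thus scale
by c^(n+2-k). -/
theorem change (h : IsContactPair n θ w) (hi : IsLefschetzImage n θ w k α τ) {c : ℝ} (hc : c ≠ 0)
    {v : ExtForm E} (hv : θ * v = 0) : IsLefschetzImage n (c • θ) (c • w + v) k α τ := by
  have key : ∀ {a : ExtForm E} (m : ℕ), θ * a = 0 → a * (c • w + v) ^ m = c ^ m • (a * w ^ m) := by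
    intro a m ha
    induction m with
    | zero => simp
    | succ m ih =>
      rw [pow_succ, ← mul_assoc, ih, mul_add, smul_mul_assoc, smul_mul_assoc,
        h.mul_eq_zero_of_vertical (h.vertical_mul ha _) hv, smul_zero, add_zero, mul_smul_comm,
        smul_smul, ← pow_succ, mul_assoc, ← pow_succ]
  have hθα : θ * (θ * α) = 0 := by rw [← mul_assoc, h.mul_self, zero_mul]
  refine ⟨hi.homogeneous, by rw [smul_mul_assoc, hi.vertical, smul_zero], fun hk => ?_,
    fun hk => ?_⟩
  · rw [smul_mul_assoc, smul_mul_assoc, key _ hθα, key _ hi.vertical, hi.low hk, smul_smul,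
      ← pow_succ', show (n + 1 - k).toNat + 1 = (n + 2 - k).toNat by omega]
  · obtain ⟨ζ, a1, a2, a3, a4⟩ := hi.high hk
    obtain ⟨m, hm⟩ : ∃ m, (k - n - 1).toNat = m := ⟨_, rfl⟩
    rw [hm] at a4
    rw [show (k - n).toNat = m + 1 by omega] at a3 ⊢
    rw [hm]
    have hcm : (c ^ m)⁻¹ * c ^ m = 1 := inv_mul_cancel₀ (pow_ne_zero m hc)
    -- With m = k - n - 1, the factor c^(-m) keeps τ fixed; the other equation carries one more
    -- power of w, and its extra c matches the c in cθ∧α.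
    refine ⟨(c ^ m)⁻¹ • ζ, a1.smul _, ?_, ?_, ?_⟩
    · rw [mul_smul_comm, smul_mul_assoc, a2, smul_zero, smul_zero]
    · rw [smul_mul_assoc, smul_mul_assoc, key _ a2, a3, smul_smul, pow_succ c, ← mul_assoc, hcm,
        one_mul]
    · rw [smul_mul_assoc, key _ a2, smul_smul, hcm, one_smul, a4]

end IsLefschetzImage

section Smoothness

theorem smoothOn_of_mul_pow {n : ℕ} {s : Set E} (hs : IsOpen s) {θ w ζ β : E → ExtForm E}
    (hc : ∀ y ∈ s, IsContactPair n (θ y) (w y)) (hθ : SmoothOn θ s) (hw : SmoothOn w s)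
    (hβ : SmoothOn β s) {z : ℤ} (hz : z ≤ n + 1) {m : ℕ} (hm : m + z = n + 1)
    (hhom : ∀ y ∈ s, (ζ y).IsHomogeneous z) (hv : ∀ y ∈ s, θ y * ζ y = 0)
    (he : ∀ y ∈ s, ζ y * w y ^ m = β y) : SmoothOn ζ s := by
  intro j
  by_cases hj : (j : ℤ) = z
  · subst hj
    obtain ⟨r, hr⟩ : ∃ r, j + 2 * m = r := ⟨_, rfl⟩
    have hpow : ∀ y ∈ s, (w y ^ m).IsHomogeneous ((2 * m : ℕ) : ℤ) := fun y hy => by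
      have := (hc y hy).right.pow m
      rwa [show (m : ℤ) * 2 = ((2 * m : ℕ) : ℤ) by push_cast; ring] at this
    -- ζ solves the linear system θ∧ζ = 0, ζ∧w^m = β, with smooth coefficients. Both equations are
    -- needed: Lefschetz injectivity holds only on vertical forms.
    refine contDiffOn_of_injective hs
      (T := fun y => (mulLeftDegree (θ y) j).prod (mulRightDegree (w y ^ m) j r))
      (r := fun y => (0, β y r)) (fun a => ?_) (contDiffOn_const.prodMk (hβ r)) ?_ ?_
    · exact ((hθ.mul (smoothOn_const (Pi.single j a) s)) (j + 1)).prodMk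
        (((smoothOn_const (Pi.single j a) s).mul (hw.pow m)) r)
    · intro y hy a ha
      have h1 : mulLeftDegree (θ y) j a = 0 := congrArg Prod.fst ha
      have h2 : mulRightDegree (w y ^ m) j r a = 0 := congrArg Prod.snd ha
      refine single_eq_zero_iff.1 ((hc y hy).eq_zero_of_mul_pow_eq_zero hz
        (isHomogeneous_single j a) ?_ hm ?_)
      · rw [mulLeftDegree_apply (hc y hy).left, h1]; exact Pi.single_zero _
      · rw [mulRightDegree_apply (hpow y hy) hr, h2]; exact Pi.single_zero _
    · intro y hy
      have h1 := hv y hy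
      have h2 := he y hy
      rw [(hhom y hy).eq_single] at h1 h2
      refine Prod.ext ?_ ?_
      · exact congrArg (fun f : ExtForm E => f (j + 1)) h1
      · exact congrArg (fun f : ExtForm E => f r) h2
  · exact contDiffOn_const.congr fun y hy => hhom y hy j hj

theorem IsLefschetzImage.smoothOn {n : ℕ} {s : Set E} (hs : IsOpen s) {θ w α τ : E → ExtForm E}
    (hc : ∀ y ∈ s, IsContactPair n (θ y) (w y)) (hθ : SmoothOn θ s) (hw : SmoothOn w s)
    (hα : SmoothOn α s) {k : ℤ} (h : ∀ y ∈ s, IsLefschetzImage n (θ y) (w y) k (α y) (τ y)) :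
    SmoothOn τ s := by
  by_cases hk : k ≤ n
  · exact smoothOn_of_mul_pow hs hc hθ hw ((hθ.mul hα).mul (hw.pow (n + 1 - k).toNat))
      (z := k - 1) (m := (n + 2 - k).toNat) (by omega) (by omega)
      (fun y hy => (h y hy).homogeneous) (fun y hy => (h y hy).vertical)
      (fun y hy => ((h y hy).low hk).symm)
  -- The existential ζ is chosen point by point without any continuity; as it is unique on s, the
  -- choice is smooth there.
  · have hζ : ∀ y, ∃ ζ : ExtForm E, y ∈ s → (ζ.IsHomogeneous (2 * n + 1 - k) ∧ θ y * ζ = 0 ∧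
        θ y * α y = ζ * w y ^ (k - n).toNat ∧ τ y = ζ * w y ^ (k - n - 1).toNat) := fun y => by
      by_cases hy : y ∈ s
      · obtain ⟨ζ, hζ⟩ := (h y hy).high (by omega)
        exact ⟨ζ, fun _ => hζ⟩
      · exact ⟨0, fun hy' => (hy hy').elim⟩
    choose ζ hζ using hζ
    have h1 : SmoothOn ζ s := smoothOn_of_mul_pow hs hc hθ hw (hθ.mul hα)
      (z := 2 * n + 1 - k) (m := (k - n).toNat) (by omega) (by omega)
      (fun y hy => (hζ y hy).1) (fun y hy => (hζ y hy).2.1) (fun y hy => (hζ y hy).2.2.1.symm)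
    intro j
    refine ((h1.mul (hw.pow (k - n - 1).toNat)) j).congr fun y hy => ?_
    exact congrArg (fun f : ExtForm E => f j) (hζ y hy).2.2.2

end Smoothness

end LefschetzImage

/-! ### The operator Γ on smooth forms -/

section GammaOperator
variable {E : Type*} [NormedAddCommGroup E] [NormedSpace ℝ E] [FiniteDimensional ℝ E]
variable {M : Type*} [TopologicalSpace M] [ChartedSpace E M]

open ExtForm

theorem ExtForm.IsContactPair.isLefschetzImage_zero {n : ℕ} {θ w : ExtForm E} {k : ℤ}
    {α : ExtForm E} (h : θ * α = 0) : IsLefschetzImage n θ w k α 0 :=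
  ⟨isHomogeneous_zero _, mul_zero _, fun _ => by rw [h, zero_mul, zero_mul],
    fun _ => ⟨0, isHomogeneous_zero _, mul_zero _, by rw [h, zero_mul], by rw [zero_mul]⟩⟩

theorem ExtForm.pullback_single (f : E →L[ℝ] E) (k : ℕ) (a : E [⋀^Fin k]→L[ℝ] ℝ) :
    pullback f (Pi.single k a : ExtForm E) = Pi.single k (a.compContinuousLinearMap f) := by
  rw [((isHomogeneous_single k a).pullback f).eq_single]
  simp [pullback]

theorem ExtForm.IsHomogeneous.mul_apply {θ : ExtForm E} (hθ : θ.IsHomogeneous 1) (a : ExtForm E)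
    (k : ℕ) : (θ * a) (k + 1) = (θ * (Pi.single k (a k) : ExtForm E)) (k + 1) := by
  rw [IsHomogeneous.eq_single (k := 1) hθ, ← wedge_eq_mul, ← wedge_eq_mul,
    single_wedge_apply (add_comm 1 k), single_wedge_apply (add_comm 1 k), Pi.single_eq_same]

theorem ExtForm.IsContactPair.mul_single_eq_zero {n : ℕ} {θ w : ExtForm E}
    (h : IsContactPair n θ w) {a : ExtForm E} (ha : θ * a = 0) (k : ℕ) :
    θ * (Pi.single k (a k) : ExtForm E) = 0 := by
  have h1 := h.left.mul (isHomogeneous_single k (a k))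
  rw [show (1 : ℤ) + k = (k + 1 : ℕ) by push_cast; ring] at h1
  rw [h1.eq_single, ← h.left.mul_apply, ha]
  exact Pi.single_zero _

namespace ContactStructure

variable {n : ℕ} (C : ContactStructure E M n)

variable {C} in
theorem IsContactForm.isContactPair {U : Set M} {θ : FormField E M} (hθ : C.IsContactForm U θ)
    {x : M} (hx : x ∈ U) [IsManifold 𝓘(ℝ, E) ∞ M] :
    IsContactPair n (θ.val x) (θ.d.val x) := by
  refine ⟨hθ.isOneForm x hx, ?_, ?_⟩
  · exact FormField.d_isHomogeneous (z := 1) hθ.isOpen (fun y hy => hθ.isOneForm y hy) hx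
  · rw [← wedgePow_eq_mul_pow]
    exact C.nondegenerate U θ hθ x hx

variable [IsManifold 𝓘(ℝ, E) ∞ M]

-- Two functionals with the same kernel are proportional. The factor is produced at a single point
-- only; neither its smoothness nor its derivative will be needed.
variable {C} in
theorem IsContactForm.exists_eq_smul {U U' : Set M} {θ θ' : FormField E M}
    (hθ : C.IsContactForm U θ) (hθ' : C.IsContactForm U' θ') {x : M} (hx : x ∈ U)
    (hx' : x ∈ U') : ∃ c : ℝ, c ≠ 0 ∧ θ'.val x = c • θ.val x := by
  obtain ⟨φ, T, hφ, hT⟩ := (hθ.isContactPair hx).exists_reeb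
  obtain ⟨ψ, -, hψ, -⟩ := (hθ'.isContactPair hx').exists_reeb
  have h1 : ∀ v : E, θ.val x 1 (fun _ => v) = φ v := fun v => by
    rw [hφ, oneForm, Pi.single_eq_same]; rfl
  have h2 : ∀ v : E, θ'.val x 1 (fun _ => v) = ψ v := fun v => by
    rw [hψ, oneForm, Pi.single_eq_same]; rfl
  have h3 : ∀ v : E, φ v = 0 ↔ ψ v = 0 := fun v => by
    rw [← h1, ← h2]
    exact (hθ.mem_iff x hx v).symm.trans (hθ'.mem_iff x hx' v)
  refine ⟨ψ T, fun h => ?_, ?_⟩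
  · rw [← h3 T, hT] at h
    exact one_ne_zero h
  · have h4 : ψ = ψ T • φ := by
      ext v
      have := (h3 (v - φ v • T)).1 (by simp [hT])
      rw [map_sub, map_smul, sub_eq_zero] at this
      rw [this]
      simp [mul_comm]
    rw [hψ, hφ]
    conv_lhs => rw [h4]
    exact Pi.single_smul (f := fun k => E [⋀^Fin k]→L[ℝ] ℝ) 1 (ψ T)
      (ContinuousAlternatingMap.ofSubsingleton ℝ E ℝ (0 : Fin 1) φ)

variable {C} in
/-- Differentiating `θ ∧ τ = 0`. -/
theorem IsContactForm.mul_val_d {U : Set M} {θ τ : FormField E M} (hθ : C.IsContactForm U θ)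
    {W : Set M} (hW : IsOpen W) (hWU : W ⊆ U) (hτ : τ.SmoothOn W)
    (h : ∀ y ∈ W, θ.val y * τ.val y = 0) {x : M} (hx : x ∈ W) :
    θ.val x * τ.d.val x = θ.d.val x * τ.val x := by
  have hs : θ.SmoothOn W := fun x₀ k => (hθ.smoothOn x₀ k).mono
    (Set.inter_subset_inter_right _ (Set.preimage_mono hWU))
  have h1 := FormField.val_d_wedge hW hs hτ hx
  rw [FormField.d_eq_zero_of_eq_zero (α := θ.wedge τ) hW h hx] at h1
  obtain ⟨φ, -, hφ, -⟩ := (hθ.isContactPair (hWU hx)).exists_reeb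
  rw [hφ, parity_oneForm, neg_mul, ← sub_eq_add_neg, eq_comm, sub_eq_zero, ← hφ] at h1
  exact h1.symm

-- Differentiating θ∧θ' = 0 gives θ∧dθ' = dθ∧θ' = c·θ∧dθ at x, so dθ' - c·dθ is vertical there. This
-- is the change of contact form under which the defining equations are invariant.
variable {C} in
theorem IsContactForm.isLefschetzImage {U U' : Set M} {θ θ' : FormField E M}
    (hθ : C.IsContactForm U θ) (hθ' : C.IsContactForm U' θ') {x : M} (hx : x ∈ U)
    (hx' : x ∈ U') {k : ℤ} {a τ : ExtForm E}
    (h : IsLefschetzImage n (θ.val x) (θ.d.val x) k a τ) :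
    IsLefschetzImage n (θ'.val x) (θ'.d.val x) k a τ := by
  obtain ⟨c, hc, hcx⟩ := hθ.exists_eq_smul hθ' hx hx'
  have hp := hθ.isContactPair hx
  have hs : θ'.SmoothOn (U ∩ U') := fun x₀ k => (hθ'.smoothOn x₀ k).mono
    (Set.inter_subset_inter_right _ (Set.preimage_mono Set.inter_subset_right))
  have h1 := hθ.mul_val_d (hθ.isOpen.inter hθ'.isOpen) Set.inter_subset_left hs
    (fun y hy => by
      obtain ⟨c, -, hc⟩ := hθ.exists_eq_smul hθ' hy.1 hy.2
      rw [hc, mul_smul_comm, (hθ.isContactPair hy.1).mul_self, smul_zero]) ⟨hx, hx'⟩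
  rw [hcx, mul_smul_comm, (hp.right.commute_of_two _).eq] at h1
  have h2 : θ'.d.val x = c • θ.d.val x + (θ'.d.val x - c • θ.d.val x) := by abel
  rw [hcx, h2]
  refine h.change hp hc ?_
  rw [mul_sub, h1, mul_smul_comm, sub_self]

/-- `τ` is the value of `Γ` at `x` on `a`, where `a` has degree `k`. -/
def IsGammaAt (x : M) (k : ℤ) (a τ : ExtForm E) : Prop :=
  ∀ U θ, C.IsContactForm U θ → x ∈ U → IsLefschetzImage n (θ.val x) (θ.d.val x) k a τ

variable {C} {x : M} {k : ℤ} {a b τ σ : ExtForm E}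

theorem IsContactForm.isGammaAt {U : Set M} {θ : FormField E M} (hθ : C.IsContactForm U θ)
    (hx : x ∈ U) (h : IsLefschetzImage n (θ.val x) (θ.d.val x) k a τ) : C.IsGammaAt x k a τ :=
  fun _ _ hθ' hx' => hθ.isLefschetzImage hθ' hx hx' h

theorem IsGammaAt.add (h₁ : C.IsGammaAt x k a τ) (h₂ : C.IsGammaAt x k b σ) :
    C.IsGammaAt x k (a + b) (τ + σ) := fun U θ hθ hx => (h₁ U θ hθ hx).add (h₂ U θ hθ hx)

theorem IsGammaAt.smul (c : ℝ) (h₁ : C.IsGammaAt x k a τ) : C.IsGammaAt x k (c • a) (c • τ) :=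
  fun U θ hθ hx => (h₁ U θ hθ hx).smul c

theorem isGammaAt_zero : C.IsGammaAt x k 0 0 := fun _ _ _ _ =>
  IsContactPair.isLefschetzImage_zero (mul_zero _)

theorem IsGammaAt.unique (h₁ : C.IsGammaAt x k a τ) (h₂ : C.IsGammaAt x k a σ) : τ = σ := by
  obtain ⟨U, θ, hx, hθ⟩ := C.smooth x
  exact (h₁ U θ hθ hx).unique (IsContactForm.isContactPair (C := C) hθ hx) (h₂ U θ hθ hx)

theorem IsGammaAt.homogeneous (h : C.IsGammaAt x k a τ) : τ.IsHomogeneous (k - 1) := by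
  obtain ⟨U, θ, hx, hθ⟩ := C.smooth x
  exact (h U θ hθ hx).homogeneous

variable (C) in
theorem exists_isGammaAt (hE : Module.finrank ℝ E = 2 * n + 1) (x : M) {k : ℤ} {a : ExtForm E}
    (ha : a.IsHomogeneous k) : ∃ τ, C.IsGammaAt x k a τ := by
  obtain ⟨U, θ, hx, hθ⟩ := C.smooth x
  obtain ⟨τ, hτ⟩ := (IsContactForm.isContactPair (C := C) hθ hx).exists_isLefschetzImage hE ha
  exact ⟨τ, IsContactForm.isGammaAt hθ hx hτ⟩

variable (hE : Module.finrank ℝ E = 2 * n + 1)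

variable (C) in
/-- The value of `Γ` at a point on the component of degree `k`. -/
def gammaDegree (x : M) (k : ℕ) (a : ExtForm E) : ExtForm E :=
  (C.exists_isGammaAt hE x (isHomogeneous_single k (a k))).choose

theorem gammaDegree_spec (x : M) (k : ℕ) (a : ExtForm E) :
    C.IsGammaAt x k (Pi.single k (a k)) (C.gammaDegree hE x k a) :=
  (C.exists_isGammaAt hE x (isHomogeneous_single k (a k))).choose_spec

variable (C) in
/-- The operator `Γ` at a point. -/
def gammaAt (x : M) : ExtForm E →ₗ[ℝ] ExtForm E where
  -- Γ lowers degrees by one, so component j of the image comes from component j + 1. Linearity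
  -- follows from uniqueness.
  toFun a j := C.gammaDegree hE x (j + 1) a j
  map_add' a b := by
    funext j
    have h := (gammaDegree_spec (C := C) hE x (j + 1) a).add
      (gammaDegree_spec (C := C) hE x (j + 1) b)
    rw [← Pi.single_add] at h
    have h' := (gammaDegree_spec (C := C) hE x (j + 1) (a + b)).unique
      (σ := C.gammaDegree hE x (j + 1) a + C.gammaDegree hE x (j + 1) b) h
    exact congrFun h' j
  map_smul' c a := by
    funext j
    have h := (gammaDegree_spec (C := C) hE x (j + 1) a).smul c
    rw [← Pi.single_smul] at h
    have h' := (gammaDegree_spec (C := C) hE x (j + 1) (c • a)).unique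
      (σ := c • C.gammaDegree hE x (j + 1) a) h
    exact congrFun h' j

theorem gammaAt_spec (ha : a.IsHomogeneous k) : C.IsGammaAt x k a (C.gammaAt hE x a) := by
  obtain ⟨τ, hτ⟩ := C.exists_isGammaAt hE x ha
  suffices C.gammaAt hE x a = τ by rwa [this]
  funext j
  by_cases hj : ((j + 1 : ℕ) : ℤ) = k
  · subst hj
    have h := gammaDegree_spec (C := C) hE x (j + 1) a
    rw [← ha.eq_single] at h
    change C.gammaDegree hE x (j + 1) a j = τ j
    exact congrArg (fun f : ExtForm E => f j) (h.unique hτ)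
  · have h := gammaDegree_spec (C := C) hE x (j + 1) a
    rw [ha (j + 1) hj, Pi.single_zero] at h
    rw [hτ.homogeneous j (by push_cast at hj; omega)]
    change C.gammaDegree hE x (j + 1) a j = 0
    exact congrArg (fun f : ExtForm E => f j) (h.unique isGammaAt_zero)

theorem gammaAt_eq (ha : a.IsHomogeneous k) (h : C.IsGammaAt x k a τ) : C.gammaAt hE x a = τ :=
  (gammaAt_spec hE ha).unique h

theorem gammaAt_apply_single (x : M) (a : ExtForm E) (j : ℕ) :
    C.gammaAt hE x a j = C.gammaAt hE x (Pi.single (j + 1) (a (j + 1))) j := by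
  rw [gammaAt_eq hE (isHomogeneous_single _ _) (gammaDegree_spec (C := C) hE x (j + 1) a)]
  rfl

theorem IsContactForm.mul_gammaAt {U : Set M} {θ : FormField E M} (hθ : C.IsContactForm U θ)
    (hx : x ∈ U) (a : ExtForm E) : θ.val x * C.gammaAt hE x a = 0 := by
  induction a using induction_single with
  | zero => rw [map_zero, mul_zero]
  | add a b ha hb => rw [map_add, mul_add, ha, hb, add_zero]
  | single k a => exact (gammaAt_spec hE (isHomogeneous_single k a) U θ hθ hx).vertical

theorem IsContactForm.gammaAt_eq_zero {U : Set M} {θ : FormField E M} (hθ : C.IsContactForm U θ)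
    (hx : x ∈ U) {a : ExtForm E} (ha : θ.val x * a = 0) : C.gammaAt hE x a = 0 := by
  funext j
  rw [gammaAt_apply_single, gammaAt_eq hE (isHomogeneous_single _ _) (hθ.isGammaAt hx
    (IsContactPair.isLefschetzImage_zero ((hθ.isContactPair hx).mul_single_eq_zero ha (j + 1))))]

theorem IsContactForm.isContactPair_rep {U : Set M} {θ : FormField E M}
    (hθ : C.IsContactForm U θ) (x₀ : M) {y : E}
    (hy : y ∈ (chartAt E x₀).target ∩ (chartAt E x₀).symm ⁻¹' U) :
    IsContactPair n (θ.rep x₀ y) (θ.d.rep x₀ y) := by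
  have h := hθ.isContactPair hy.2
  rw [FormField.rep_eq_pullback, FormField.rep_eq_pullback]
  refine ⟨h.left.pullback _, h.right.pullback _, fun h0 => h.mul_pow_ne_zero ?_⟩
  rw [← pullback_pow, ← pullback_mul] at h0
  exact FormField.pullback_chartSymmDeriv_injective x₀ hy.1 h0

variable (C) in
/-- The operator `Γ` on fields of forms. -/
def gammaField (α : FormField E M) : FormField E M := fun x => C.gammaAt hE x (α.val x)

/-- Smoothness is local, so a single contact form near the point may be used. As the equations are
natural under pullback, Γ read in the chart solves the chart version of the system. -/
theorem gammaField_smoothOn {α : FormField E M} (hα : α.SmoothOn Set.univ) :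
    (C.gammaField hE α).SmoothOn Set.univ := by
  intro x₀ j y₀ hy₀
  obtain ⟨U, θ, hx, hθ⟩ := C.smooth ((chartAt E x₀).symm y₀)
  replace hθ : C.IsContactForm U θ := hθ
  have ho := FormField.isOpen_chart_domain (E := E) x₀ hθ.isOpen
  have hs : y₀ ∈ (chartAt E x₀).target ∩ (chartAt E x₀).symm ⁻¹' U := ⟨hy₀.1, hx⟩
  have hd : θ.d.SmoothOn U := FormField.d_smooth hθ.isOpen hθ.smoothOn
  -- Component j of Γα depends only on the component of α of degree j + 1, which is isolated because
  -- the equations concern homogeneous forms.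
  have h1 : ExtForm.SmoothOn (fun y => (Pi.single (j + 1) (α.rep x₀ y (j + 1)) : ExtForm E))
      ((chartAt E x₀).target ∩ (chartAt E x₀).symm ⁻¹' U) := by
    intro i
    by_cases hi : i = j + 1
    · subst hi
      simp only [Pi.single_eq_same]
      exact (hα x₀ (j + 1)).mono (Set.inter_subset_inter_right _ (Set.subset_univ _))
    · simp only [Pi.single_eq_of_ne hi]
      exact contDiffOn_const
  have h2 := IsLefschetzImage.smoothOn ho (fun y hy => hθ.isContactPair_rep x₀ hy)
    (hθ.smoothOn.rep x₀) (hd.rep x₀) h1 (k := (j + 1 : ℕ))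
    (τ := fun y => pullback (show E →L[ℝ] E from chartSymmDeriv x₀ y)
      (C.gammaAt hE ((chartAt E x₀).symm y)
        (Pi.single (j + 1) (α.val ((chartAt E x₀).symm y) (j + 1)))))
    (fun y hy => by
      have h3 := (gammaAt_spec (C := C) hE (isHomogeneous_single (j + 1)
        (α.val ((chartAt E x₀).symm y) (j + 1))) U θ hθ hy.2).pullback
          (show E →L[ℝ] E from chartSymmDeriv x₀ y)
      rw [pullback_single] at h3
      exact h3)
  refine ((h2 j).contDiffAt (ho.mem_nhds hs)).contDiffWithinAt.congr (fun y hy => ?_) ?_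
  · exact congrArg (fun f : E [⋀^Fin j]→L[ℝ] ℝ => f.compContinuousLinearMap
      (show E →L[ℝ] E from chartSymmDeriv x₀ y))
      (gammaAt_apply_single (C := C) hE ((chartAt E x₀).symm y) _ j)
  · exact congrArg (fun f : E [⋀^Fin j]→L[ℝ] ℝ => f.compContinuousLinearMap
      (show E →L[ℝ] E from chartSymmDeriv x₀ y₀))
      (gammaAt_apply_single (C := C) hE ((chartAt E x₀).symm y₀) _ j)

variable (C) in
/-- The operator `Γ` on smooth forms. -/
def gamma : deRham E M →ₗ[ℝ] deRham E M where
  toFun α := ⟨C.gammaField hE α.1, gammaField_smoothOn hE α.2⟩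
  map_add' α β := Subtype.ext (funext fun x => map_add (C.gammaAt hE x) (α.1.val x) (β.1.val x))
  map_smul' c α := Subtype.ext (funext fun x => map_smul (C.gammaAt hE x) c (α.1.val x))

/-- Passes from conditions on fields to pointwise conditions in the exterior ring. Verticality stays
separate because it is demanded of all forms, not just homogeneous ones. -/
theorem isLefschetzInverse_iff (Γ : deRham E M →ₗ[ℝ] deRham E M) : C.IsLefschetzInverse Γ ↔
    (∀ α, C.IsVertical (Γ α)) ∧ ∀ (k : ℤ), ∀ α ∈ deRham.grading k, ∀ x,
      C.IsGammaAt x k (α.1.val x) ((Γ α).1.val x) := by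
  constructor
  · intro h
    refine ⟨h.isVertical, fun k α hα x U θ hθ hx => ⟨h.mem_grading k α hα x,
      h.isVertical α U θ hθ x hx, fun hk => ?_, fun hk => ?_⟩⟩
    · have := h.low k hk α hα U θ hθ x hx
      rw [← wedgePow_eq_mul_pow, ← wedgePow_eq_mul_pow]
      exact this
    · obtain ⟨ζ, h1, h2, h3, h4⟩ := h.high k hk α hα U θ hθ x hx
      simp only [← wedgePow_eq_mul_pow]
      exact ⟨ζ, h1, h2, h3, h4⟩
  · rintro ⟨h1, h2⟩
    refine ⟨fun k α hα x => (h2 k α hα x).homogeneous, h1, fun k hk α hα U θ hθ x hx => ?_,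
      fun k hk α hα U θ hθ x hx => ?_⟩
    · have := (h2 k α hα x U θ hθ hx).low hk
      rw [← wedgePow_eq_mul_pow, ← wedgePow_eq_mul_pow] at this
      exact this
    · have := (h2 k α hα x U θ hθ hx).high hk
      simp only [← wedgePow_eq_mul_pow] at this
      exact this

theorem isLefschetzInverse_gamma : C.IsLefschetzInverse (C.gamma hE) :=
  (isLefschetzInverse_iff _).2 ⟨fun α _ _ hθ x hx =>
    IsContactForm.mul_gammaAt (C := C) hE hθ hx (α.1.val x),
    fun _ _ hα x => gammaAt_spec hE (hα x)⟩

theorem gamma_eq_zero_of_isVertical {α : deRham E M} (h : C.IsVertical α) : C.gamma hE α = 0 := by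
  refine Subtype.ext (FormField.ext_val fun x => ?_)
  obtain ⟨U, θ, hx, hθ⟩ := C.smooth x
  exact IsContactForm.gammaAt_eq_zero hE hθ hx (h U θ hθ x hx)

theorem gamma_eq_of_isGammaAt {k : ℤ} {α β : deRham E M} (hα : α ∈ deRham.grading k)
    (h : ∀ x, C.IsGammaAt x k (α.1.val x) (β.1.val x)) : C.gamma hE α = β :=
  Subtype.ext (FormField.ext_val fun x => gammaAt_eq hE (hα x) (h x))

end ContactStructure

namespace deRham

/-- The component of degree `k`. -/
def component (k : ℕ) : deRham E M →ₗ[ℝ] deRham E M where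
  toFun α := ⟨fun x => Pi.single k (α.1 x k), fun x₀ j => by
    by_cases hj : j = k
    · subst hj
      exact (α.2 x₀ j).congr fun y _ => by simp [FormField.inChart]
    · refine (contDiffOn_const (c := 0)).congr fun y _ => ?_
      simp only [FormField.inChart, Pi.single_eq_of_ne hj]
      rfl⟩
  map_add' α β := Subtype.ext (funext fun x =>
    Pi.single_add (f := fun k => E [⋀^Fin k]→L[ℝ] ℝ) k (α.1.val x k) (β.1.val x k))
  map_smul' c α := Subtype.ext (funext fun x =>
    Pi.single_smul (f := fun k => E [⋀^Fin k]→L[ℝ] ℝ) k c (α.1.val x k))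

theorem component_mem (k : ℕ) (α : deRham E M) : component k α ∈ grading (E := E) (M := M) k :=
  fun x => isHomogeneous_single (V := E) k (α.1.val x k)

theorem component_eq_self {k : ℕ} {α : deRham E M} (h : α ∈ grading (E := E) (M := M) k) :
    component k α = α :=
  Subtype.ext (FormField.ext_val fun x => (IsHomogeneous.eq_single (V := E) (k := k)
    (a := α.1.val x) (h x)).symm)

theorem component_eq_zero {k : ℕ} {z : ℤ} (hz : z ≠ k) {α : deRham E M}
    (h : α ∈ grading (E := E) (M := M) z) : component k α = 0 :=
  Subtype.ext (FormField.ext_val fun x => by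
    have : α.1.val x k = 0 := h x k (Ne.symm hz)
    change (Pi.single k (α.1.val x k) : ExtForm E) = 0
    rw [this, Pi.single_zero])

theorem sum_component (α : deRham E M) :
    α = ∑ k ∈ Finset.range (Module.finrank ℝ E + 1), component k α := by
  refine Subtype.ext (funext fun x => ?_)
  rw [AddSubmonoidClass.coe_finsetSum]
  refine (eq_sum_single (α.1.val x)).trans ?_
  exact (Finset.sum_apply (M := fun x : M => ExtForm (TangentSpace 𝓘(ℝ, E) x)) x
    (Finset.range (Module.finrank ℝ E + 1)) fun k => (component k α).1).symm

theorem eq_zero_of_neg {z : ℤ} (hz : z < 0) {α : deRham E M}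
    (h : α ∈ grading (E := E) (M := M) z) : α = 0 :=
  Subtype.ext (FormField.ext_val fun x => IsHomogeneous.eq_zero_of_neg (V := E) hz (h x))

theorem iSup_grading : ⨆ z, grading (E := E) (M := M) z = ⊤ := by
  rw [eq_top_iff]
  intro α _
  rw [sum_component α]
  exact Submodule.sum_mem _ fun k _ => Submodule.mem_iSup_of_mem (k : ℤ) (component_mem k α)

end deRham

end GammaOperator

/-! ### Explicit Stasheff sums when operations of arity at least 4 vanish -/

theorem Int.negOnePow_ofNat (k : ℕ) [k.AtLeastTwo] :
    Int.negOnePow (no_index (OfNat.ofNat k)) = (-1) ^ k := by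
  change Int.negOnePow ((k : ℕ) : ℤ) = _
  rw [Int.negOnePow_def, zpow_natCast]

section FiniteSums

variable {𝕜 A B : Type*} [Field 𝕜] [AddCommGroup A] [Module 𝕜 A] [AddCommGroup B] [Module 𝕜 B]

/-- The summand of the Stasheff sum for the decomposition `n = r + s + t`. -/
def stasheffTerm (m : Operations 𝕜 A A) (g : Operations 𝕜 A B) (deg : ℕ → ℤ) (a : ℕ → A)
    (r s t : ℕ) : B :=
  Int.negOnePow ((r : ℤ) + s * t + (2 - s) * ∑ i ∈ Finset.range r, deg i) •
    g (r + 1 + t) (fun j => spliceSeq r s (m s (fun i => a (r + i))) a j)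

theorem stasheffTerm_eq_zero {m : Operations 𝕜 A A} {g : Operations 𝕜 A B}
    (hm : ∀ k, 4 ≤ k → m k = 0) (hg : ∀ k, 4 ≤ k → g k = 0) (deg : ℕ → ℤ) (a : ℕ → A)
    {r s t : ℕ} (h : 4 ≤ s ∨ 3 ≤ r + t) : stasheffTerm m g deg a r s t = 0 := by
  rw [stasheffTerm]
  rcases h with h | h
  -- The value of the vanishing operation m_s sits in slot r of g.
  · rw [hm s h, MultilinearMap.map_coord_zero _ (⟨r, by omega⟩ : Fin (r + 1 + t)), smul_zero]
    simp [spliceSeq]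
  · rw [hg _ (by omega), zero_apply, smul_zero]

theorem stasheffSum_eq_sum {m : Operations 𝕜 A A} {g : Operations 𝕜 A B}
    (hm : ∀ k, 4 ≤ k → m k = 0) (hg : ∀ k, 4 ≤ k → g k = 0) (n : ℕ) (deg : ℕ → ℤ) (a : ℕ → A)
    (S : Finset (Fin 3 → ℕ))
    (hS : S ⊆ (Finset.Nat.antidiagonalTuple 3 n).filter (fun x => 1 ≤ x 1))
    (h : ∀ x ∈ (Finset.Nat.antidiagonalTuple 3 n).filter (fun x => 1 ≤ x 1), x ∉ S →
      4 ≤ x 1 ∨ 3 ≤ x 0 + x 2) :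
    stasheffSum m g n deg a = ∑ x ∈ S, stasheffTerm m g deg a (x 0) (x 1) (x 2) :=
  (Finset.sum_subset hS fun x hx hxS => stasheffTerm_eq_zero hm hg deg a (h x hx hxS)).symm

/-- A nonzero term needs s ≤ 3 and r + 1 + t ≤ 3, so r + s + t ≤ 5. -/
theorem stasheffSum_eq_zero {m : Operations 𝕜 A A} {g : Operations 𝕜 A B}
    (hm : ∀ k, 4 ≤ k → m k = 0) (hg : ∀ k, 4 ≤ k → g k = 0) {n : ℕ} (hn : 6 ≤ n) (deg : ℕ → ℤ)
    (a : ℕ → A) : stasheffSum m g n deg a = 0 := by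
  rw [stasheffSum_eq_sum hm hg n deg a ∅ (Finset.empty_subset _), Finset.sum_empty]
  intro x hx _
  rw [Finset.mem_filter, Finset.Nat.mem_antidiagonalTuple, Fin.sum_univ_three] at hx
  omega

variable (m : Operations 𝕜 A A) (g : Operations 𝕜 A B) (deg : ℕ → ℤ) (a : ℕ → A)

variable {m g a deg} in
theorem stasheffTerm_eq {r s t : ℕ} (u : ℤˣ) (y : Fin s → A) (z : Fin (r + 1 + t) → A)
    (hu : Int.negOnePow ((r : ℤ) + s * t + (2 - s) * ∑ i ∈ Finset.range r, deg i) = u)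
    (hy : (fun i : Fin s => a (r + i)) = y)
    (hz : (fun j : Fin (r + 1 + t) => spliceSeq r s (m s y) a j) = z) :
    stasheffTerm m g deg a r s t = u • g (r + 1 + t) z := by
  rw [stasheffTerm, hu, hy, hz]

theorem stasheffSum_one (hm : ∀ k, 4 ≤ k → m k = 0) (hg : ∀ k, 4 ≤ k → g k = 0) :
    stasheffSum m g 1 deg a =
      g 1 ![m 1 ![a 0]] := by
  have h0 : stasheffTerm m g deg a 0 1 0 =
      (1 : ℤˣ) • g 1 ![m 1 ![a 0]] :=
    stasheffTerm_eq _ ![a 0] _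
      (by simp [Finset.sum_range_succ, Int.negOnePow_add, Int.negOnePow_sub, Int.negOnePow_ofNat,
        pow_succ, mul_comm])
      (by funext i; fin_cases i <;> rfl) (by funext i; fin_cases i <;> rfl)
  rw [stasheffSum_eq_sum hm hg 1 deg a
    {![0, 1, 0]}
    (by decide) (by decide)]
  rw [Finset.sum_singleton]
  refine
    h0.trans ?_
  rw [one_smul]

theorem stasheffSum_two (hm : ∀ k, 4 ≤ k → m k = 0) (hg : ∀ k, 4 ≤ k → g k = 0) :
    stasheffSum m g 2 deg a =
      g 1 ![m 2 ![a 0, a 1]] - g 2 ![m 1 ![a 0], a 1]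
      - (deg 0).negOnePow • g 2 ![a 0, m 1 ![a 1]] := by
  have h0 : stasheffTerm m g deg a 0 2 0 =
      (1 : ℤˣ) • g 1 ![m 2 ![a 0, a 1]] :=
    stasheffTerm_eq _ ![a 0, a 1] _
      (by simp [Finset.sum_range_succ, Int.negOnePow_add, Int.negOnePow_sub, Int.negOnePow_ofNat,
        pow_succ, mul_comm])
      (by funext i; fin_cases i <;> rfl) (by funext i; fin_cases i <;> rfl)
  have h1 : stasheffTerm m g deg a 0 1 1 =
      (-1 : ℤˣ) • g 2 ![m 1 ![a 0], a 1] :=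
    stasheffTerm_eq _ ![a 0] _
      (by simp [Finset.sum_range_succ, Int.negOnePow_add, Int.negOnePow_sub, Int.negOnePow_ofNat,
        pow_succ, mul_comm])
      (by funext i; fin_cases i <;> rfl) (by funext i; fin_cases i <;> rfl)
  have h2 : stasheffTerm m g deg a 1 1 0 =
      (-(deg 0).negOnePow : ℤˣ) • g 2 ![a 0, m 1 ![a 1]] :=
    stasheffTerm_eq _ ![a 1] _
      (by simp [Finset.sum_range_succ, Int.negOnePow_add, Int.negOnePow_sub, Int.negOnePow_ofNat,
        pow_succ, mul_comm])
      (by funext i; fin_cases i <;> rfl) (by funext i; fin_cases i <;> rfl)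
  rw [stasheffSum_eq_sum hm hg 2 deg a
    {![0, 2, 0], ![0, 1, 1], ![1, 1, 0]}
    (by decide) (by decide)]
  rw [Finset.sum_insert (by decide), Finset.sum_insert (by decide),
    Finset.sum_singleton]
  refine
    (congrArg₂ _ h0 (congrArg₂ _ h1 h2)).trans ?_
  simp only [Units.neg_smul, one_smul]
  abel

theorem stasheffSum_three (hm : ∀ k, 4 ≤ k → m k = 0) (hg : ∀ k, 4 ≤ k → g k = 0) :
    stasheffSum m g 3 deg a =
      g 3 ![m 1 ![a 0], a 1, a 2] + (deg 0).negOnePow • g 3 ![a 0, m 1 ![a 1], a 2]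
      + ((deg 0).negOnePow * (deg 1).negOnePow) • g 3 ![a 0, a 1, m 1 ![a 2]]
      + g 2 ![m 2 ![a 0, a 1], a 2] - g 2 ![a 0, m 2 ![a 1, a 2]]
      + g 1 ![m 3 ![a 0, a 1, a 2]] := by
  have h0 : stasheffTerm m g deg a 0 1 2 =
      (1 : ℤˣ) • g 3 ![m 1 ![a 0], a 1, a 2] :=
    stasheffTerm_eq _ ![a 0] _
      (by simp [Finset.sum_range_succ, Int.negOnePow_add, Int.negOnePow_sub, Int.negOnePow_ofNat,
        pow_succ, mul_comm])
      (by funext i; fin_cases i <;> rfl) (by funext i; fin_cases i <;> rfl)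
  have h1 : stasheffTerm m g deg a 1 1 1 =
      ((deg 0).negOnePow : ℤˣ) • g 3 ![a 0, m 1 ![a 1], a 2] :=
    stasheffTerm_eq _ ![a 1] _
      (by simp [Finset.sum_range_succ, Int.negOnePow_add, Int.negOnePow_sub, Int.negOnePow_ofNat,
        pow_succ, mul_comm])
      (by funext i; fin_cases i <;> rfl) (by funext i; fin_cases i <;> rfl)
  have h2 : stasheffTerm m g deg a 2 1 0 =
      ((deg 0).negOnePow * (deg 1).negOnePow : ℤˣ) • g 3 ![a 0, a 1, m 1 ![a 2]] :=
    stasheffTerm_eq _ ![a 2] _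
      (by simp [Finset.sum_range_succ, Int.negOnePow_add, Int.negOnePow_sub, Int.negOnePow_ofNat,
        pow_succ, mul_comm])
      (by funext i; fin_cases i <;> rfl) (by funext i; fin_cases i <;> rfl)
  have h3 : stasheffTerm m g deg a 0 2 1 =
      (1 : ℤˣ) • g 2 ![m 2 ![a 0, a 1], a 2] :=
    stasheffTerm_eq _ ![a 0, a 1] _
      (by simp [Finset.sum_range_succ, Int.negOnePow_add, Int.negOnePow_sub, Int.negOnePow_ofNat,
        pow_succ, mul_comm])
      (by funext i; fin_cases i <;> rfl) (by funext i; fin_cases i <;> rfl)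
  have h4 : stasheffTerm m g deg a 1 2 0 =
      (-1 : ℤˣ) • g 2 ![a 0, m 2 ![a 1, a 2]] :=
    stasheffTerm_eq _ ![a 1, a 2] _
      (by simp [Finset.sum_range_succ, Int.negOnePow_add, Int.negOnePow_sub, Int.negOnePow_ofNat,
        pow_succ, mul_comm])
      (by funext i; fin_cases i <;> rfl) (by funext i; fin_cases i <;> rfl)
  have h5 : stasheffTerm m g deg a 0 3 0 =
      (1 : ℤˣ) • g 1 ![m 3 ![a 0, a 1, a 2]] :=
    stasheffTerm_eq _ ![a 0, a 1, a 2] _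
      (by simp [Finset.sum_range_succ, Int.negOnePow_add, Int.negOnePow_sub, Int.negOnePow_ofNat,
        pow_succ, mul_comm])
      (by funext i; fin_cases i <;> rfl) (by funext i; fin_cases i <;> rfl)
  rw [stasheffSum_eq_sum hm hg 3 deg a
    {![0, 1, 2], ![1, 1, 1], ![2, 1, 0], ![0, 2, 1], ![1, 2, 0], ![0, 3, 0]}
    (by decide) (by decide)]
  rw [Finset.sum_insert (by decide), Finset.sum_insert (by decide),
    Finset.sum_insert (by decide), Finset.sum_insert (by decide),
    Finset.sum_insert (by decide), Finset.sum_singleton]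
  refine
    (congrArg₂ _ h0 (congrArg₂ _ h1 (congrArg₂ _ h2 (congrArg₂ _ h3 (congrArg₂ _ h4 h5))))).trans ?_
  simp only [Units.neg_smul, one_smul]
  abel

theorem stasheffSum_four (hm : ∀ k, 4 ≤ k → m k = 0) (hg : ∀ k, 4 ≤ k → g k = 0) :
    stasheffSum m g 4 deg a =
      g 3 ![m 2 ![a 0, a 1], a 2, a 3] - g 3 ![a 0, m 2 ![a 1, a 2], a 3]
      + g 3 ![a 0, a 1, m 2 ![a 2, a 3]] - g 2 ![m 3 ![a 0, a 1, a 2], a 3]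
      - (deg 0).negOnePow • g 2 ![a 0, m 3 ![a 1, a 2, a 3]] := by
  have h0 : stasheffTerm m g deg a 0 2 2 =
      (1 : ℤˣ) • g 3 ![m 2 ![a 0, a 1], a 2, a 3] :=
    stasheffTerm_eq _ ![a 0, a 1] _
      (by simp [Finset.sum_range_succ, Int.negOnePow_add, Int.negOnePow_sub, Int.negOnePow_ofNat,
        pow_succ, mul_comm])
      (by funext i; fin_cases i <;> rfl) (by funext i; fin_cases i <;> rfl)
  have h1 : stasheffTerm m g deg a 1 2 1 =
      (-1 : ℤˣ) • g 3 ![a 0, m 2 ![a 1, a 2], a 3] :=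
    stasheffTerm_eq _ ![a 1, a 2] _
      (by simp [Finset.sum_range_succ, Int.negOnePow_add, Int.negOnePow_sub, Int.negOnePow_ofNat,
        pow_succ, mul_comm])
      (by funext i; fin_cases i <;> rfl) (by funext i; fin_cases i <;> rfl)
  have h2 : stasheffTerm m g deg a 2 2 0 =
      (1 : ℤˣ) • g 3 ![a 0, a 1, m 2 ![a 2, a 3]] :=
    stasheffTerm_eq _ ![a 2, a 3] _
      (by simp [Finset.sum_range_succ, Int.negOnePow_add, Int.negOnePow_sub, Int.negOnePow_ofNat,
        pow_succ, mul_comm])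
      (by funext i; fin_cases i <;> rfl) (by funext i; fin_cases i <;> rfl)
  have h3 : stasheffTerm m g deg a 0 3 1 =
      (-1 : ℤˣ) • g 2 ![m 3 ![a 0, a 1, a 2], a 3] :=
    stasheffTerm_eq _ ![a 0, a 1, a 2] _
      (by simp [Finset.sum_range_succ, Int.negOnePow_add, Int.negOnePow_sub, Int.negOnePow_ofNat,
        pow_succ, mul_comm])
      (by funext i; fin_cases i <;> rfl) (by funext i; fin_cases i <;> rfl)
  have h4 : stasheffTerm m g deg a 1 3 0 =
      (-(deg 0).negOnePow : ℤˣ) • g 2 ![a 0, m 3 ![a 1, a 2, a 3]] :=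
    stasheffTerm_eq _ ![a 1, a 2, a 3] _
      (by simp [Finset.sum_range_succ, Int.negOnePow_add, Int.negOnePow_sub, Int.negOnePow_ofNat,
        pow_succ, mul_comm])
      (by funext i; fin_cases i <;> rfl) (by funext i; fin_cases i <;> rfl)
  rw [stasheffSum_eq_sum hm hg 4 deg a
    {![0, 2, 2], ![1, 2, 1], ![2, 2, 0], ![0, 3, 1], ![1, 3, 0]}
    (by decide) (by decide)]
  rw [Finset.sum_insert (by decide), Finset.sum_insert (by decide),
    Finset.sum_insert (by decide), Finset.sum_insert (by decide),
    Finset.sum_singleton]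
  refine
    (congrArg₂ _ h0 (congrArg₂ _ h1 (congrArg₂ _ h2 (congrArg₂ _ h3 h4)))).trans ?_
  simp only [Units.neg_smul, one_smul]
  abel

theorem stasheffSum_five (hm : ∀ k, 4 ≤ k → m k = 0) (hg : ∀ k, 4 ≤ k → g k = 0) :
    stasheffSum m g 5 deg a =
      g 3 ![m 3 ![a 0, a 1, a 2], a 3, a 4]
      + (deg 0).negOnePow • g 3 ![a 0, m 3 ![a 1, a 2, a 3], a 4]
      + ((deg 0).negOnePow * (deg 1).negOnePow) • g 3 ![a 0, a 1, m 3 ![a 2, a 3, a 4]] := by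
  have h0 : stasheffTerm m g deg a 0 3 2 =
      (1 : ℤˣ) • g 3 ![m 3 ![a 0, a 1, a 2], a 3, a 4] :=
    stasheffTerm_eq _ ![a 0, a 1, a 2] _
      (by simp [Finset.sum_range_succ, Int.negOnePow_add, Int.negOnePow_sub, Int.negOnePow_ofNat,
        pow_succ, mul_comm])
      (by funext i; fin_cases i <;> rfl) (by funext i; fin_cases i <;> rfl)
  have h1 : stasheffTerm m g deg a 1 3 1 =
      ((deg 0).negOnePow : ℤˣ) • g 3 ![a 0, m 3 ![a 1, a 2, a 3], a 4] :=
    stasheffTerm_eq _ ![a 1, a 2, a 3] _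
      (by simp [Finset.sum_range_succ, Int.negOnePow_add, Int.negOnePow_sub, Int.negOnePow_ofNat,
        pow_succ, mul_comm])
      (by funext i; fin_cases i <;> rfl) (by funext i; fin_cases i <;> rfl)
  have h2 : stasheffTerm m g deg a 2 3 0 =
      ((deg 0).negOnePow * (deg 1).negOnePow : ℤˣ) • g 3 ![a 0, a 1, m 3 ![a 2, a 3, a 4]] :=
    stasheffTerm_eq _ ![a 2, a 3, a 4] _
      (by simp [Finset.sum_range_succ, Int.negOnePow_add, Int.negOnePow_sub, Int.negOnePow_ofNat,
        pow_succ, mul_comm])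
      (by funext i; fin_cases i <;> rfl) (by funext i; fin_cases i <;> rfl)
  rw [stasheffSum_eq_sum hm hg 5 deg a
    {![0, 3, 2], ![1, 3, 1], ![2, 3, 0]}
    (by decide) (by decide)]
  rw [Finset.sum_insert (by decide), Finset.sum_insert (by decide),
    Finset.sum_singleton]
  refine
    (congrArg₂ _ h0 (congrArg₂ _ h1 h2)).trans ?_
  simp only [Units.neg_smul, one_smul]
  abel

end FiniteSums

/-! ### Explicit composition sums when operations of arity at least 3 vanish -/

section CompositionSums

variable {𝕜 A B : Type*} [Field 𝕜] [AddCommGroup A] [Module 𝕜 A] [AddCommGroup B] [Module 𝕜 B]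

/-- The summand of `compositionSum` at a composition. -/
def compositionTerm (m : Operations 𝕜 B B) (f : Operations 𝕜 A B) {n : ℕ} (deg : ℕ → ℤ)
    (a : ℕ → A) (c : Composition n) : B :=
  Int.negOnePow (∑ j : Fin c.length,
    (((c.length : ℤ) - (j + 1)) * (c.blocksFun j - 1) +
      (1 - c.blocksFun j) * ∑ i ∈ Finset.range (c.sizeUpTo j), deg i)) •
    m c.length (fun j => f (c.blocksFun j) (fun i => a (c.sizeUpTo j + i)))

theorem compositionTerm_eq_zero {m : Operations 𝕜 B B} {f : Operations 𝕜 A B}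
    (hm : ∀ k, 3 ≤ k → m k = 0) (hf : ∀ k, 3 ≤ k → f k = 0) {n : ℕ} (deg : ℕ → ℤ) (a : ℕ → A)
    (c : Composition n) (h : 3 ≤ c.length ∨ ∃ b ∈ c.blocks, 3 ≤ b) :
    compositionTerm m f deg a c = 0 := by
  rw [compositionTerm]
  rcases h with h | ⟨b, hb, h⟩
  · rw [hm _ h, zero_apply, smul_zero]
  · obtain ⟨i, rfl⟩ := List.mem_iff_get.1 hb
    rw [MultilinearMap.map_coord_zero _ (i : Fin c.length), smul_zero]
    change f (c.blocksFun i) _ = 0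
    rw [show f (c.blocksFun i) = 0 from hf _ h, zero_apply]

theorem compositionSum_eq_sum {m : Operations 𝕜 B B} {f : Operations 𝕜 A B}
    (hm : ∀ k, 3 ≤ k → m k = 0) (hf : ∀ k, 3 ≤ k → f k = 0) (n : ℕ) (deg : ℕ → ℤ) (a : ℕ → A)
    (S : Finset (Composition n))
    (h : ∀ c : Composition n, c ∉ S → 3 ≤ c.length ∨ ∃ b ∈ c.blocks, 3 ≤ b) :
    compositionSum m f n deg a = ∑ c ∈ S, compositionTerm m f deg a c :=
  (Finset.sum_subset (Finset.subset_univ S) fun c _ hc =>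
    compositionTerm_eq_zero hm hf deg a c (h c hc)).symm

/-- Sorts out the compositions that can contribute: at most two blocks, each of size at most 2. The
survivors are (1); (2), (1,1); (1,2), (2,1); (2,2). -/
theorem Composition.length_or_block {n : ℕ} (hn : 1 ≤ n) (c : Composition n) :
    (3 ≤ c.length ∨ ∃ b ∈ c.blocks, 3 ≤ b) ∨ c.blocks = [n] ∨
      ∃ i j, c.blocks = [i, j] ∧ i + j = n ∧ 1 ≤ i ∧ i ≤ 2 ∧ 1 ≤ j ∧ j ≤ 2 := by
  obtain ⟨l, hl, hs⟩ := c
  match l, @hl, hs with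
  | [], _, hs => simp at hs; omega
  | [x], _, hs => exact Or.inr (Or.inl (by simpa using hs))
  | [x, y], hl, hs =>
    have hx : 0 < x := hl (by simp)
    have hy : 0 < y := hl (by simp)
    by_cases h3 : 3 ≤ x
    · exact Or.inl (Or.inr ⟨x, by simp, h3⟩)
    by_cases h4 : 3 ≤ y
    · exact Or.inl (Or.inr ⟨y, by simp, h4⟩)
    · exact Or.inr (Or.inr ⟨x, y, rfl, by simpa using hs, by omega, by omega, by omega, by omega⟩)
  | x :: y :: z :: t, _, _ =>
    refine Or.inl (Or.inl ?_)
    simp [Composition.length]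

theorem compositionTerm_single (m : Operations 𝕜 B B) (f : Operations 𝕜 A B) {n : ℕ}
    (deg : ℕ → ℤ) (a : ℕ → A) (h1 : ∀ {x}, x ∈ [n] → 0 < x) (h2 : [n].sum = n) :
    compositionTerm m f deg a ⟨[n], h1, h2⟩ = m 1 ![f n fun i => a i] := by
  have e : (fun j => f ((⟨[n], h1, h2⟩ : Composition n).blocksFun j)
      (fun i => a ((⟨[n], h1, h2⟩ : Composition n).sizeUpTo j + i))) = ![f n fun i => a i] := by
    funext j
    fin_cases j
    exact congrArg (f n) (funext fun i => congrArg a (Nat.zero_add _))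
  have e' : (∑ j : Fin (⟨[n], h1, h2⟩ : Composition n).length,
    ((((⟨[n], h1, h2⟩ : Composition n).length : ℤ) - (j + 1)) *
      ((⟨[n], h1, h2⟩ : Composition n).blocksFun j - 1) +
      (1 - (⟨[n], h1, h2⟩ : Composition n).blocksFun j) *
        ∑ i ∈ Finset.range ((⟨[n], h1, h2⟩ : Composition n).sizeUpTo j), deg i)) = 0 := by
    refine (Fin.sum_univ_one (M := ℤ) _).trans ?_
    simp [Composition.length]
  rw [compositionTerm, e', Int.negOnePow_zero, one_smul]
  exact congrArg (m 1) e

/-- Of the sign, the first block contributes only i - 1, since nothing precedes it, and the second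
only the Koszul sign of moving f_j past the first i arguments, since r - j = 0 there. -/
theorem compositionTerm_pair (m : Operations 𝕜 B B) (f : Operations 𝕜 A B) {n : ℕ}
    (deg : ℕ → ℤ) (a : ℕ → A) (i j : ℕ) (h1 : ∀ {x}, x ∈ [i, j] → 0 < x) (h2 : [i, j].sum = n) :
    compositionTerm m f deg a ⟨[i, j], h1, h2⟩ =
      Int.negOnePow ((i - 1) + (1 - j) * ∑ x ∈ Finset.range i, deg x) •
        m 2 ![f i fun x => a x, f j fun x => a (i + x)] := by
  have e : (fun k => f ((⟨[i, j], h1, h2⟩ : Composition n).blocksFun k)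
      (fun x => a ((⟨[i, j], h1, h2⟩ : Composition n).sizeUpTo k + x))) =
      ![f i fun x => a x, f j fun x => a (i + x)] := by
    funext k
    fin_cases k
    · exact congrArg (f i) (funext fun x => congrArg a (Nat.zero_add _))
    · rfl
  have e' : (∑ k : Fin (⟨[i, j], h1, h2⟩ : Composition n).length,
    ((((⟨[i, j], h1, h2⟩ : Composition n).length : ℤ) - (k + 1)) *
      ((⟨[i, j], h1, h2⟩ : Composition n).blocksFun k - 1) +
      (1 - (⟨[i, j], h1, h2⟩ : Composition n).blocksFun k) *
        ∑ x ∈ Finset.range ((⟨[i, j], h1, h2⟩ : Composition n).sizeUpTo k), deg x)) =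
      (i - 1) + (1 - j) * ∑ x ∈ Finset.range i, deg x := by
    refine (Fin.sum_univ_two (M := ℤ) _).trans ?_
    change (((2 : ℕ) : ℤ) - (((0 : ℕ) : ℤ) + 1)) * ((i : ℤ) - 1) +
      (1 - (i : ℤ)) * ∑ x ∈ Finset.range 0, deg x + ((((2 : ℕ) : ℤ) - (((1 : ℕ) : ℤ) + 1)) *
      ((j : ℤ) - 1) + (1 - (j : ℤ)) * ∑ x ∈ Finset.range i, deg x) = _
    push_cast
    rw [Finset.range_zero, Finset.sum_empty]
    ring
  rw [compositionTerm, e']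
  exact congrArg _ (congrArg (m 2) e)

variable {m : Operations 𝕜 B B} {f : Operations 𝕜 A B} (deg : ℕ → ℤ) (a : ℕ → A)

theorem compositionSum_one (hm : ∀ k, 3 ≤ k → m k = 0) (hf : ∀ k, 3 ≤ k → f k = 0) :
    compositionSum m f 1 deg a = m 1 ![f 1 ![a 0]] := by
  have hS : ∀ c : Composition 1, c ∉ ({⟨[1], by simp, by simp⟩} : Finset (Composition 1)) →
      3 ≤ c.length ∨ ∃ b ∈ c.blocks, 3 ≤ b := by
    intro c hc
    rcases c.length_or_block (by omega) with h | h | ⟨i, j, h, h'⟩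
    · exact h
    · exact absurd (Finset.mem_singleton.2 (Composition.ext h)) hc
    · omega
  rw [compositionSum_eq_sum hm hf 1 deg a _ hS, Finset.sum_singleton, compositionTerm_single]
  · exact congrArg (m 1) (congrArg (fun x => ![f 1 x]) (by funext i; fin_cases i; rfl))
  · simp

theorem compositionSum_two (hm : ∀ k, 3 ≤ k → m k = 0) (hf : ∀ k, 3 ≤ k → f k = 0) :
    compositionSum m f 2 deg a = m 1 ![f 2 ![a 0, a 1]] + m 2 ![f 1 ![a 0], f 1 ![a 1]] := by
  have hS : ∀ c : Composition 2, c ∉ ({⟨[2], by simp, by simp⟩, ⟨[1, 1], by simp, by simp⟩} :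
      Finset (Composition 2)) → 3 ≤ c.length ∨ ∃ b ∈ c.blocks, 3 ≤ b := by
    intro c hc
    rcases c.length_or_block (by omega) with h | h | ⟨i, j, h, h'⟩
    · exact h
    · exact absurd (by simp [Composition.ext_iff, h]) hc
    · obtain ⟨rfl, rfl⟩ : i = 1 ∧ j = 1 := by omega
      exact absurd (by simp [Composition.ext_iff, h]) hc
  rw [compositionSum_eq_sum hm hf 2 deg a _ hS,
    Finset.sum_insert (by simp [Composition.ext_iff]), Finset.sum_singleton,
    compositionTerm_single, compositionTerm_pair]
  · refine congrArg₂ _ ?_ ?_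
    · exact congrArg (m 1) (congrArg (fun x => ![f 2 x]) (by funext i; fin_cases i <;> rfl))
    · simp only [Nat.cast_one, sub_self, zero_mul, add_zero, Int.negOnePow_zero, one_smul]
      exact congrArg (m 2) (congrArg₂ (fun x y => ![f 1 x, f 1 y])
        (by funext i; fin_cases i; rfl) (by funext i; fin_cases i; rfl))
  all_goals simp

theorem compositionSum_three (hm : ∀ k, 3 ≤ k → m k = 0) (hf : ∀ k, 3 ≤ k → f k = 0) :
    compositionSum m f 3 deg a = (deg 0).negOnePow • m 2 ![f 1 ![a 0], f 2 ![a 1, a 2]] -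
      m 2 ![f 2 ![a 0, a 1], f 1 ![a 2]] := by
  have hS : ∀ c : Composition 3, c ∉ ({⟨[1, 2], by simp, by simp⟩, ⟨[2, 1], by simp, by simp⟩} :
      Finset (Composition 3)) → 3 ≤ c.length ∨ ∃ b ∈ c.blocks, 3 ≤ b := by
    intro c hc
    rcases c.length_or_block (by omega) with h | h | ⟨i, j, h, h'⟩
    · exact h
    · exact Or.inr ⟨3, by simp [h], le_rfl⟩
    · obtain ⟨rfl, rfl⟩ | ⟨rfl, rfl⟩ : (i = 1 ∧ j = 2) ∨ (i = 2 ∧ j = 1) := by omega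
      · exact absurd (by simp [Composition.ext_iff, h]) hc
      · exact absurd (by simp [Composition.ext_iff, h]) hc
  rw [compositionSum_eq_sum hm hf 3 deg a _ hS,
    Finset.sum_insert (by simp [Composition.ext_iff]), Finset.sum_singleton,
    compositionTerm_pair, compositionTerm_pair]
  have h1 : Int.negOnePow ((((1 : ℕ) : ℤ) - 1) +
      (1 - ((2 : ℕ) : ℤ)) * ∑ x ∈ Finset.range 1, deg x) = (deg 0).negOnePow := by
    simp
  have h2 : Int.negOnePow ((((2 : ℕ) : ℤ) - 1) +
      (1 - ((1 : ℕ) : ℤ)) * ∑ x ∈ Finset.range 2, deg x) = -1 := by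
    simp
  · rw [h1, h2, Units.neg_smul, one_smul, sub_eq_add_neg]
    refine congrArg₂ (fun x y => (deg 0).negOnePow • x + -y) ?_ ?_
    · exact congrArg (m 2) (congrArg₂ (fun x y => ![f 1 x, f 2 y])
        (by funext i; fin_cases i; rfl) (by funext i; fin_cases i <;> rfl))
    · exact congrArg (m 2) (congrArg₂ (fun x y => ![f 2 x, f 1 y])
        (by funext i; fin_cases i <;> rfl) (by funext i; fin_cases i; rfl))
  all_goals simp

theorem compositionSum_four (hm : ∀ k, 3 ≤ k → m k = 0) (hf : ∀ k, 3 ≤ k → f k = 0) :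
    compositionSum m f 4 deg a = (-(deg 0 + deg 1).negOnePow) •
      m 2 ![f 2 ![a 0, a 1], f 2 ![a 2, a 3]] := by
  have hS : ∀ c : Composition 4, c ∉ ({⟨[2, 2], by simp, by simp⟩} : Finset (Composition 4)) →
      3 ≤ c.length ∨ ∃ b ∈ c.blocks, 3 ≤ b := by
    intro c hc
    rcases c.length_or_block (by omega) with h | h | ⟨i, j, h, h'⟩
    · exact h
    · exact Or.inr ⟨4, by simp [h], by omega⟩
    · obtain ⟨rfl, rfl⟩ : i = 2 ∧ j = 2 := by omega
      exact absurd (by simp [Composition.ext_iff, h]) hc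
  rw [compositionSum_eq_sum hm hf 4 deg a _ hS, Finset.sum_singleton, compositionTerm_pair]
  · refine congrArg₂ _ ?_ ?_
    · simp [Int.negOnePow_add, Finset.sum_range_succ, mul_comm]
    · exact congrArg (m 2) (congrArg₂ (fun x y => ![f 2 x, f 2 y])
        (by funext i; fin_cases i <;> rfl) (by funext i; fin_cases i <;> rfl))
  · simp

theorem compositionSum_eq_zero (hm : ∀ k, 3 ≤ k → m k = 0) (hf : ∀ k, 3 ≤ k → f k = 0) {n : ℕ}
    (hn : 5 ≤ n) : compositionSum m f n deg a = 0 := by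
  rw [compositionSum_eq_sum hm hf n deg a ∅, Finset.sum_empty]
  intro c hc
  rcases c.length_or_block (by omega) with h | h | ⟨i, j, h, h'⟩
  · exact h
  · exact Or.inr ⟨n, by simp [h], by omega⟩
  · omega

end CompositionSums

/-! ### Shuffles of at most three elements -/

section Shuffles

variable {𝕜 A B : Type*} [Field 𝕜] [AddCommGroup A] [Module 𝕜 A] [AddCommGroup B] [Module 𝕜 B]

theorem shuffles_one_one : shuffles 1 1 = {1, Equiv.swap (0 : Fin 2) 1} := by
  ext σ
  simp only [shuffles, Finset.mem_filter, Finset.mem_univ, true_and]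
  revert σ
  unfold StrictMono
  decide

theorem shuffles_one_two : shuffles 1 2 =
    {1, Equiv.swap (0 : Fin 3) 1, finRotate 3 * finRotate 3} := by
  ext σ
  simp only [shuffles, Finset.mem_filter, Finset.mem_univ, true_and]
  revert σ
  unfold StrictMono
  decide

theorem shuffles_two_one : shuffles 2 1 =
    {1, Equiv.swap (1 : Fin 3) 2, finRotate 3} := by
  ext σ
  simp only [shuffles, Finset.mem_filter, Finset.mem_univ, true_and]
  revert σ
  unfold StrictMono
  decide

theorem koszulSign_eq {n : ℕ} (σ : Equiv.Perm (Fin n)) (deg : Fin n → ℤ)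
    (S : Finset (Fin n × Fin n))
    (hS : (Finset.univ : Finset (Fin n × Fin n)).filter (fun ij => ij.1 < ij.2 ∧ σ ij.2 < σ ij.1)
      = S) : koszulSign σ deg = ∏ ij ∈ S, Int.negOnePow (deg ij.1 * deg ij.2) := by
  rw [koszulSign, hS]

theorem sum_shuffles_one_one (g : Operations 𝕜 A B) (deg : Fin (1 + 1) → ℤ)
    (a : Fin (1 + 1) → A) :
    ∑ σ ∈ shuffles 1 1, (Equiv.Perm.sign σ * koszulSign σ deg) • g (1 + 1) (fun i => a (σ⁻¹ i)) =
      g 2 ![a 0, a 1] - (deg 0 * deg 1).negOnePow • g 2 ![a 1, a 0] := by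
  rw [shuffles_one_one, Finset.sum_insert (by decide), Finset.sum_singleton,
    koszulSign_eq 1 deg ∅ (by decide), koszulSign_eq _ deg {((0 : Fin 2), (1 : Fin 2))} (by decide),
    Finset.prod_empty, Finset.prod_singleton, Equiv.Perm.sign_one,
    show Equiv.Perm.sign (Equiv.swap (0 : Fin 2) 1) = -1 by decide, one_mul, one_smul, neg_one_mul,
    Units.neg_smul, sub_eq_add_neg]
  refine congrArg₂ (fun x y => x + -((deg 0 * deg 1).negOnePow • y)) ?_ ?_
  · exact congrArg (g 2) (by funext i; fin_cases i <;> rfl)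
  · exact congrArg (g 2) (by funext i; fin_cases i <;> rfl)

theorem sum_shuffles_one_two (g : Operations 𝕜 A B) (deg : Fin (1 + 2) → ℤ)
    (a : Fin (1 + 2) → A) :
    ∑ σ ∈ shuffles 1 2, (Equiv.Perm.sign σ * koszulSign σ deg) • g (1 + 2) (fun i => a (σ⁻¹ i)) =
      g 3 ![a 0, a 1, a 2] - (deg 0 * deg 1).negOnePow • g 3 ![a 1, a 0, a 2] +
        ((deg 0 * deg 1).negOnePow * (deg 0 * deg 2).negOnePow) • g 3 ![a 1, a 2, a 0] := by
  rw [shuffles_one_two, Finset.sum_insert (by decide), Finset.sum_insert (by decide),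
    Finset.sum_singleton,
    koszulSign_eq 1 deg ∅ (by decide), koszulSign_eq _ deg {((0 : Fin 3), (1 : Fin 3))} (by decide),
    koszulSign_eq _ deg {((0 : Fin 3), (1 : Fin 3)), ((0 : Fin 3), (2 : Fin 3))} (by decide),
    Finset.prod_empty, Finset.prod_singleton, Finset.prod_pair (by decide), Equiv.Perm.sign_one,
    show Equiv.Perm.sign (Equiv.swap (0 : Fin 3) 1) = -1 by decide,
    show Equiv.Perm.sign (finRotate 3 * finRotate 3) = 1 by decide, one_mul, one_mul, one_smul,
    neg_one_mul, Units.neg_smul, ← add_assoc, ← sub_eq_add_neg]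
  refine congrArg₂ (fun x y => x + ((deg 0 * deg 1).negOnePow * (deg 0 * deg 2).negOnePow) • y)
    (congrArg₂ (fun x y => x - (deg 0 * deg 1).negOnePow • y) ?_ ?_) ?_
  · exact congrArg (g 3) (by funext i; fin_cases i <;> rfl)
  · exact congrArg (g 3) (by funext i; fin_cases i <;> rfl)
  · exact congrArg (g 3) (by funext i; fin_cases i <;> rfl)

theorem sum_shuffles_two_one (g : Operations 𝕜 A B) (deg : Fin (2 + 1) → ℤ)
    (a : Fin (2 + 1) → A) :
    ∑ σ ∈ shuffles 2 1, (Equiv.Perm.sign σ * koszulSign σ deg) • g (2 + 1) (fun i => a (σ⁻¹ i)) =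
      g 3 ![a 0, a 1, a 2] - (deg 1 * deg 2).negOnePow • g 3 ![a 0, a 2, a 1] +
        ((deg 0 * deg 2).negOnePow * (deg 1 * deg 2).negOnePow) • g 3 ![a 2, a 0, a 1] := by
  rw [shuffles_two_one, Finset.sum_insert (by decide), Finset.sum_insert (by decide),
    Finset.sum_singleton,
    koszulSign_eq 1 deg ∅ (by decide), koszulSign_eq _ deg {((1 : Fin 3), (2 : Fin 3))} (by decide),
    koszulSign_eq _ deg {((0 : Fin 3), (2 : Fin 3)), ((1 : Fin 3), (2 : Fin 3))} (by decide),
    Finset.prod_empty, Finset.prod_singleton, Finset.prod_pair (by decide), Equiv.Perm.sign_one,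
    show Equiv.Perm.sign (Equiv.swap (1 : Fin 3) 2) = -1 by decide,
    show Equiv.Perm.sign (finRotate 3) = 1 by decide, one_mul, one_mul, one_smul,
    neg_one_mul, Units.neg_smul, ← add_assoc, ← sub_eq_add_neg]
  refine congrArg₂ (fun x y => x + ((deg 0 * deg 2).negOnePow * (deg 1 * deg 2).negOnePow) • y)
    (congrArg₂ (fun x y => x - (deg 1 * deg 2).negOnePow • y) ?_ ?_) ?_
  · exact congrArg (g 3) (by funext i; fin_cases i <;> rfl)
  · exact congrArg (g 3) (by funext i; fin_cases i <;> rfl)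
  · exact congrArg (g 3) (by funext i; fin_cases i <;> rfl)

/-- With g_k = 0 for k ≥ 4 only the shuffle types (1,1), (1,2) and (2,1) remain. -/
theorem Operations.vanishesOnShuffles_of_le_three {𝒜 : ℤ → Submodule 𝕜 A} {g : Operations 𝕜 A B}
    (hg : ∀ k, 4 ≤ k → g k = 0)
    (h2 : ∀ (p q : ℤ) (a b : A), a ∈ 𝒜 p → b ∈ 𝒜 q →
      g 2 ![a, b] = (p * q).negOnePow • g 2 ![b, a])
    (h12 : ∀ (p q r : ℤ) (a b c : A), a ∈ 𝒜 p → b ∈ 𝒜 q → c ∈ 𝒜 r →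
      g 3 ![a, b, c] - (p * q).negOnePow • g 3 ![b, a, c] +
        ((p * q).negOnePow * (p * r).negOnePow) • g 3 ![b, c, a] = 0)
    (h21 : ∀ (p q r : ℤ) (a b c : A), a ∈ 𝒜 p → b ∈ 𝒜 q → c ∈ 𝒜 r →
      g 3 ![a, b, c] - (q * r).negOnePow • g 3 ![a, c, b] +
        ((p * r).negOnePow * (q * r).negOnePow) • g 3 ![c, a, b] = 0) :
    g.VanishesOnShuffles 𝒜 := by
  intro p q hp hq deg a ha
  by_cases h : 4 ≤ p + q
  · exact Finset.sum_eq_zero fun σ _ => by rw [hg _ h, zero_apply, smul_zero]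
  obtain ⟨rfl, rfl⟩ | ⟨rfl, rfl⟩ | ⟨rfl, rfl⟩ :
      (p = 1 ∧ q = 1) ∨ (p = 1 ∧ q = 2) ∨ (p = 2 ∧ q = 1) := by omega
  · rw [sum_shuffles_one_one, h2 _ _ _ _ (ha 0) (ha 1), sub_self]
  · rw [sum_shuffles_one_two, h12 _ _ _ _ _ _ (ha 0) (ha 1) (ha 2)]
  · rw [sum_shuffles_two_one, h21 _ _ _ _ _ _ (ha 0) (ha 1) (ha 2)]

end Shuffles

/-! ### The algebra of a vertical homotopy Γ -/

section Homotopy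

variable {𝕜 A : Type*} [Field 𝕜] [NonUnitalRing A] [Module 𝕜 A] [IsScalarTower 𝕜 A A]
  [SMulCommClass 𝕜 A A]

/-- `A = ⨁ 𝒜 z` is a graded commutative differential algebra. -/
structure IsCommDGA (𝒜 : ℤ → Submodule 𝕜 A) (d : A →ₗ[𝕜] A) : Prop where
  isInternal : DirectSum.IsInternal 𝒜
  d_mem : ∀ {p : ℤ} {a : A}, a ∈ 𝒜 p → d a ∈ 𝒜 (p + 1)
  mul_mem : ∀ {p q : ℤ} {a b : A}, a ∈ 𝒜 p → b ∈ 𝒜 q → a * b ∈ 𝒜 (p + q)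
  d_d : ∀ a, d (d a) = 0
  leibniz : ∀ {p : ℤ} {a : A}, a ∈ 𝒜 p → ∀ b, d (a * b) = d a * b + p.negOnePow • (a * d b)
  mul_comm : ∀ {p q : ℤ} {a b : A}, a ∈ 𝒜 p → b ∈ 𝒜 q → a * b = (p * q).negOnePow • (b * a)

/-- `Γ` is an operator of degree `-1` with values in a square-zero ideal `V` that it annihilates,
and `Γ d Γ = Γ`. -/
structure IsVerticalHomotopy (𝒜 : ℤ → Submodule 𝕜 A) (d : A →ₗ[𝕜] A) (V : Submodule 𝕜 A)
    (Γ : A →ₗ[𝕜] A) : Prop extends IsCommDGA 𝒜 d where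
  gamma_mem : ∀ {p : ℤ} {a : A}, a ∈ 𝒜 p → Γ a ∈ 𝒜 (p - 1)
  gamma_vertical : ∀ a, Γ a ∈ V
  gamma_eq_zero : ∀ {v}, v ∈ V → Γ v = 0
  mul_vertical : ∀ a {v}, v ∈ V → a * v ∈ V
  vertical_mul : ∀ {v}, v ∈ V → ∀ a, v * a ∈ V
  vertical_mul_vertical : ∀ {u v}, u ∈ V → v ∈ V → u * v = 0
  gamma_d_gamma : ∀ a, Γ (d (Γ a)) = Γ a

/-- `1 - dΓ - Γd`. -/
def homotopyProj (d Γ : A →ₗ[𝕜] A) : A →ₗ[𝕜] A := LinearMap.id - d ∘ₗ Γ - Γ ∘ₗ d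

theorem homotopyProj_apply (d Γ : A →ₗ[𝕜] A) (a : A) :
    homotopyProj d Γ a = a - d (Γ a) - Γ (d a) := rfl

namespace IsVerticalHomotopy

variable {𝒜 : ℤ → Submodule 𝕜 A} {d : A →ₗ[𝕜] A} {V : Submodule 𝕜 A} {Γ : A →ₗ[𝕜] A}
  (H : IsVerticalHomotopy 𝒜 d V Γ)

local notation "π" => homotopyProj d Γ

include H

theorem gamma_gamma (a : A) : Γ (Γ a) = 0 := H.gamma_eq_zero (H.gamma_vertical a)

/-- Γ - ΓdΓ - ΓΓd = 0, because ΓdΓ = Γ and Γ kills its own vertical values. As π commutes with d,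
also Γdπ = 0, so the image of π lies in the Rumin subspace. -/
theorem gamma_proj (a : A) : Γ (π a) = 0 := by
  rw [homotopyProj_apply, map_sub, map_sub, H.gamma_d_gamma, H.gamma_gamma, sub_self, sub_zero]

theorem d_proj (a : A) : d (π a) = π (d a) := by
  rw [homotopyProj_apply, homotopyProj_apply, map_sub, map_sub, H.d_d, H.d_d, map_zero]
  abel

theorem gamma_d_proj (a : A) : Γ (d (π a)) = 0 := by rw [H.d_proj, H.gamma_proj]

theorem proj_mem {p : ℤ} {a : A} (ha : a ∈ 𝒜 p) : π a ∈ 𝒜 p := by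
  rw [homotopyProj_apply]
  refine sub_mem (sub_mem ha ?_) ?_
  · simpa using H.d_mem (H.gamma_mem ha)
  · simpa using H.gamma_mem (H.d_mem ha)

omit H in
theorem proj_eq_self {a : A} (h : Γ a = 0) (h' : Γ (d a) = 0) : π a = a := by
  rw [homotopyProj_apply, h, h', map_zero, sub_zero, sub_zero]

theorem proj_of_vertical {v : A} (hv : v ∈ V) : π v = v - Γ (d v) := by
  rw [homotopyProj_apply, H.gamma_eq_zero hv, map_zero, sub_zero]

theorem proj_vertical {v : A} (hv : v ∈ V) : π v ∈ V := by
  rw [H.proj_of_vertical hv]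
  exact sub_mem hv (H.gamma_vertical _)

theorem gamma_mul_gamma (a b : A) : Γ a * Γ b = 0 :=
  H.vertical_mul_vertical (H.gamma_vertical a) (H.gamma_vertical b)

/-- Γ ignores vertical terms. This removes Γ(da)·b, and it lets dΓa·b be replaced by d(Γa·b), since
they differ by the vertical form ±Γa·db. -/
theorem gamma_proj_mul {p : ℤ} {a : A} (ha : a ∈ 𝒜 p) (b : A) :
    Γ (π a * b) = Γ (a * b) - Γ (d (Γ a * b)) := by
  have h1 : Γ (Γ a * d b) = 0 := H.gamma_eq_zero (H.vertical_mul (H.gamma_vertical a) _)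
  have h2 : Γ (Γ (d a) * b) = 0 := H.gamma_eq_zero (H.vertical_mul (H.gamma_vertical _) _)
  rw [homotopyProj_apply, sub_mul, sub_mul, map_sub, map_sub, h2, H.leibniz (H.gamma_mem ha),
    map_add]
  rcases Int.units_eq_one_or (p - 1).negOnePow with hp | hp <;>
    simp [hp, h1]

theorem gamma_mul_proj {p : ℤ} {a : A} (ha : a ∈ 𝒜 p) (b : A) :
    Γ (a * π b) = Γ (a * b) - p.negOnePow • Γ (d (a * Γ b)) := by
  have h1 : Γ (d a * Γ b) = 0 := H.gamma_eq_zero (H.mul_vertical _ (H.gamma_vertical b))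
  have h2 : Γ (a * Γ (d b)) = 0 := H.gamma_eq_zero (H.mul_vertical _ (H.gamma_vertical _))
  rw [homotopyProj_apply, mul_sub, mul_sub, map_sub, map_sub, h2, H.leibniz ha, map_add]
  rcases Int.units_eq_one_or p.negOnePow with hp | hp <;>
    simp [hp, h1]

/-- The homotopy for the associativity of the product, `Γ(ab)c - (-1)^p aΓ(bc)` for `a` of
degree `p`. -/
def triple (_ : IsVerticalHomotopy 𝒜 d V Γ) (p : ℤ) (a b c : A) : A :=
  Γ (a * b) * c - p.negOnePow • (a * Γ (b * c))

theorem triple_vertical (p : ℤ) (a b c : A) : H.triple p a b c ∈ V := by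
  have h1 := H.vertical_mul (H.gamma_vertical (a * b)) c
  have h2 := H.mul_vertical a (H.gamma_vertical (b * c))
  rw [triple]
  rcases Int.units_eq_one_or p.negOnePow with hp | hp
  · simpa [hp] using sub_mem h1 h2
  · simpa [hp] using add_mem h1 h2

theorem triple_mem {p q r : ℤ} {a b c : A} (ha : a ∈ 𝒜 p) (hb : b ∈ 𝒜 q) (hc : c ∈ 𝒜 r) :
    H.triple p a b c ∈ 𝒜 (p + q + r - 1) := by
  have h1 := H.mul_mem (H.gamma_mem (H.mul_mem ha hb)) hc
  have h2 := H.mul_mem ha (H.gamma_mem (H.mul_mem hb hc))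
  rw [show p + q - 1 + r = p + q + r - 1 by ring] at h1
  rw [show p + (q + r - 1) = p + q + r - 1 by ring] at h2
  rw [triple]
  rcases Int.units_eq_one_or p.negOnePow with hp | hp
  · simpa [hp] using sub_mem h1 h2
  · simpa [hp] using add_mem h1 h2

theorem d_proj_mul {p : ℤ} {a : A} (ha : a ∈ 𝒜 p) (b : A) :
    d (π (a * b)) - π (d a * b) - p.negOnePow • π (a * d b) = 0 := by
  rw [H.d_proj, H.leibniz ha, map_add]
  rcases Int.units_eq_one_or p.negOnePow with hp | hp <;> simp [hp]

/-- As (ab)c = a(bc), the associator of πμ, before its last projection, involves only dΓ + Γd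
applied to ab and to bc. The Leibniz rule identifies it with the boundary of T. The identity holds
for all forms; the relation on ℛ is its image under π. -/
theorem triple_d {p q : ℤ} {a b : A} (ha : a ∈ 𝒜 p) (hb : b ∈ 𝒜 q) (c : A) :
    H.triple (p + 1) (d a) b c + p.negOnePow • H.triple p a (d b) c +
      (p.negOnePow * q.negOnePow) • H.triple p a b (d c) + π (a * b) * c - a * π (b * c) +
      d (H.triple p a b c) = 0 := by
  have h1 := H.leibniz (H.gamma_mem (H.mul_mem ha hb)) c
  have h2 := H.leibniz ha (Γ (b * c))
  have h3 := H.leibniz ha b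
  have h4 := H.leibniz hb c
  simp only [triple, homotopyProj_apply, h3, h4, map_sub, h1]
  -- Once the two signs are fixed, the expanded monomials cancel additively; the same method is used
  -- in the identities below.
  rcases Int.units_eq_one_or p.negOnePow with hp | hp <;>
  rcases Int.units_eq_one_or q.negOnePow with hq | hq <;>
  · simp only [hp, hq, Int.negOnePow_add, Int.negOnePow_sub, Int.negOnePow_one, one_smul,
      Units.neg_smul, mul_one, neg_mul, mul_neg, neg_neg, map_add, map_neg, sub_mul,
      mul_sub, add_mul, mul_add, h2, mul_assoc]
    abel

/-- On the vertical form T the projection is 1 - Γd, and `gamma_proj_mul` with its mirror image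
expands Γ of a product with a projection. All that does not cancel is ±d(Γ(ab)·Γ(ce)), which is zero
because vertical forms multiply to zero. -/
theorem triple_proj {p q r : ℤ} {a b c e : A} (ha : a ∈ 𝒜 p) (hb : b ∈ 𝒜 q) (hc : c ∈ 𝒜 r) :
    H.triple (p + q) (π (a * b)) c e - H.triple p a (π (b * c)) e + H.triple p a b (π (c * e)) -
      π (H.triple p a b c) * e - p.negOnePow • (a * π (H.triple q b c e)) = 0 := by
  have h0 : d (Γ (a * b)) * Γ (c * e) +
      (p + q - 1).negOnePow • (Γ (a * b) * d (Γ (c * e))) = 0 := by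
    rw [← H.leibniz (H.gamma_mem (H.mul_mem ha hb)), H.gamma_mul_gamma, map_zero]
  have h1 := H.gamma_mul_gamma (d (a * b)) (c * e)
  have h2 := H.gamma_mul_gamma (a * b) (d (c * e))
  rw [H.proj_of_vertical (H.triple_vertical _ _ _ _),
    H.proj_of_vertical (H.triple_vertical _ _ _ _)]
  simp only [triple, H.gamma_proj_mul (H.mul_mem ha hb), H.gamma_mul_proj ha,
    H.gamma_proj_mul (H.mul_mem hb hc), H.gamma_mul_proj hb]
  simp only [homotopyProj_apply, sub_mul, mul_sub, h1, h2]
  rcases Int.units_eq_one_or p.negOnePow with hp | hp <;>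
  rcases Int.units_eq_one_or q.negOnePow with hq | hq <;>
  · simp only [hp, hq, Int.negOnePow_add, Int.negOnePow_sub, Int.negOnePow_one, one_smul,
      Units.neg_smul, mul_one, neg_mul, mul_neg, neg_neg, map_sub, map_neg, sub_mul, mul_sub,
      mul_assoc] at h0 ⊢
    -- Which sign of the remaining boundary `h0` occurs depends on the parities chosen.
    first
    | (refine Eq.trans ?_ h0; abel1)
    | (refine Eq.trans ?_ (neg_eq_zero.2 h0); abel1)

theorem gamma_mul_eq {p q : ℤ} {a b : A} (ha : a ∈ 𝒜 p) (hb : b ∈ 𝒜 q) :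
    Γ (a * b) = (p * q).negOnePow • Γ (b * a) := by
  rw [H.mul_comm ha hb]
  rcases Int.units_eq_one_or (p * q).negOnePow with h | h <;> simp [h]

theorem proj_mul_eq {p q : ℤ} {a b : A} (ha : a ∈ 𝒜 p) (hb : b ∈ 𝒜 q) :
    π (a * b) = (p * q).negOnePow • π (b * a) := by
  rw [H.mul_comm ha hb]
  rcases Int.units_eq_one_or (p * q).negOnePow with h | h <;> simp [h]

/-- Γμ is graded commutative, so the six terms cancel in pairs: Γ(ab)c with Γ(ba)c, bΓ(ac) with
bΓ(ca), and aΓ(bc) with Γ(bc)a. -/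
theorem triple_shuffle_one_two {p q r : ℤ} {a b c : A} (ha : a ∈ 𝒜 p) (hb : b ∈ 𝒜 q)
    (hc : c ∈ 𝒜 r) :
    H.triple p a b c - (p * q).negOnePow • H.triple q b a c +
      ((p * q).negOnePow * (p * r).negOnePow) • H.triple q b c a = 0 := by
  have h1 := H.gamma_mul_eq ha hb
  have h2 := H.gamma_mul_eq ha hc
  have h3 : a * Γ (b * c) = _ := H.mul_comm ha (H.gamma_mem (H.mul_mem hb hc))
  rw [mul_sub, mul_add, mul_one, Int.negOnePow_sub, Int.negOnePow_add] at h3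
  simp only [triple, h1, h2, h3]
  -- The signs of p, q, pq and pr are treated as four independent units; the cancellation does not
  -- use their relations.
  rcases Int.units_eq_one_or p.negOnePow with h | h <;>
  rcases Int.units_eq_one_or q.negOnePow with h' | h' <;>
  rcases Int.units_eq_one_or (p * q).negOnePow with h'' | h'' <;>
  rcases Int.units_eq_one_or (p * r).negOnePow with h''' | h''' <;>
  · simp only [h, h', h'', h''', one_smul, Units.neg_smul, mul_one, neg_mul, mul_neg, neg_neg]
    abel

theorem triple_shuffle_two_one {p q r : ℤ} {a b c : A} (ha : a ∈ 𝒜 p) (hb : b ∈ 𝒜 q)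
    (hc : c ∈ 𝒜 r) :
    H.triple p a b c - (q * r).negOnePow • H.triple p a c b +
      ((p * r).negOnePow * (q * r).negOnePow) • H.triple r c a b = 0 := by
  have h1 := H.gamma_mul_eq hb hc
  have h2 := H.gamma_mul_eq ha hc
  have h3 : Γ (a * b) * c = _ := H.mul_comm (H.gamma_mem (H.mul_mem ha hb)) hc
  rw [sub_mul, add_mul, one_mul, Int.negOnePow_sub, Int.negOnePow_add] at h3
  simp only [triple, h1, h2, h3]
  rcases Int.units_eq_one_or p.negOnePow with h | h <;>
  rcases Int.units_eq_one_or r.negOnePow with h' | h' <;>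
  rcases Int.units_eq_one_or (q * r).negOnePow with h'' | h'' <;>
  rcases Int.units_eq_one_or (p * r).negOnePow with h''' | h''' <;>
  · simp only [h, h', h'', h''', one_smul, Units.neg_smul, mul_one, neg_mul, mul_neg, neg_neg]
    abel

end IsVerticalHomotopy

end Homotopy

/-! ### Gradings, and reduction of the relations to low arity -/

section Grading

variable {𝕜 A B : Type*} [Field 𝕜] [AddCommGroup A] [Module 𝕜 A] [AddCommGroup B] [Module 𝕜 B]

/-- The linear map acting on `𝒜 z` as `(-1)^z`. -/
def gradedParity {𝒜 : ℤ → Submodule 𝕜 A} (h : DirectSum.IsInternal 𝒜) : A →ₗ[𝕜] A :=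
  DirectSum.toModule 𝕜 ℤ A (fun z => (z.negOnePow : ℤ) • (𝒜 z).subtype) ∘ₗ
    (LinearEquiv.ofBijective (DirectSum.coeLinearMap 𝒜) h).symm.toLinearMap

theorem gradedParity_apply {𝒜 : ℤ → Submodule 𝕜 A} (h : DirectSum.IsInternal 𝒜) {z : ℤ} {a : A}
    (ha : a ∈ 𝒜 z) : gradedParity h a = z.negOnePow • a := by
  have e : (LinearEquiv.ofBijective (DirectSum.coeLinearMap 𝒜) h).symm a =
      DirectSum.lof 𝕜 ℤ (fun z => 𝒜 z) z ⟨a, ha⟩ :=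
    (LinearEquiv.symm_apply_eq _).2 (DirectSum.coeLinearMap_lof 𝒜 z ⟨a, ha⟩).symm
  rw [gradedParity, LinearMap.comp_apply, LinearEquiv.coe_coe, e, DirectSum.toModule_lof]
  rfl

/-- Independence is inherited from the larger pieces 𝒜 z, and the pieces span R because R is their
supremum. -/
theorem isInternal_submoduleOf {𝒜 ℬ : ℤ → Submodule 𝕜 A} (h : DirectSum.IsInternal 𝒜)
    (hle : ∀ z, ℬ z ≤ 𝒜 z) {R : Submodule 𝕜 A} (hR : R = ⨆ z, ℬ z) :
    DirectSum.IsInternal fun z => (ℬ z).submoduleOf R := by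
  have hi := h.submodule_iSupIndep
  rw [iSupIndep_iff_finsetSum_eq_zero_imp_eq_zero] at hi
  refine DirectSum.isInternal_submodule_of_iSupIndep_of_iSup_eq_top ?_ ?_
  · rw [iSupIndep_iff_finsetSum_eq_zero_imp_eq_zero]
    intro s v hv h0 i his
    refine Subtype.ext (hi s (fun i => (v i : A)) (fun i hi => hle i (hv i hi)) ?_ i his)
    rw [← Submodule.coe_sum, h0, Submodule.coe_zero]
  · have h1 : (⨆ z, (ℬ z).submoduleOf R).map R.subtype = (⊤ : Submodule 𝕜 R).map R.subtype := by
      rw [Submodule.map_iSup, Submodule.map_subtype_top]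
      conv_rhs => rw [hR]
      refine iSup_congr fun z => ?_
      rw [Submodule.submoduleOf, Submodule.map_comap_subtype, inf_eq_right, hR]
      exact le_iSup ℬ z
    exact Submodule.map_injective_of_injective R.injective_subtype h1

theorem Operations.hasDegree_of_le_three {𝒜 : ℤ → Submodule 𝕜 A} {ℬ : ℤ → Submodule 𝕜 B} {c : ℤ}
    {g : Operations 𝕜 A B} (hg : ∀ k, 4 ≤ k → g k = 0)
    (h1 : ∀ p a, a ∈ 𝒜 p → g 1 ![a] ∈ ℬ (p + (c - 1)))
    (h2 : ∀ p q a b, a ∈ 𝒜 p → b ∈ 𝒜 q → g 2 ![a, b] ∈ ℬ (p + q + (c - 2)))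
    (h3 : ∀ p q r a b e, a ∈ 𝒜 p → b ∈ 𝒜 q → e ∈ 𝒜 r →
      g 3 ![a, b, e] ∈ ℬ (p + q + r + (c - 3))) : g.HasDegree 𝒜 ℬ c := by
  intro k hk deg a ha
  by_cases h : 4 ≤ k
  · rw [hg k h, zero_apply]
    exact zero_mem _
  obtain rfl | rfl | rfl : k = 1 ∨ k = 2 ∨ k = 3 := by omega
  · rw [show a = ![a 0] by funext i; fin_cases i; rfl, Fin.sum_univ_one]
    exact h1 _ _ (ha 0)
  · rw [show a = ![a 0, a 1] by funext i; fin_cases i <;> rfl, Fin.sum_univ_two]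
    exact h2 _ _ _ _ (ha 0) (ha 1)
  · rw [show a = ![a 0, a 1, a 2] by funext i; fin_cases i <;> rfl, Fin.sum_univ_three]
    exact h3 _ _ _ _ _ _ (ha 0) (ha 1) (ha 2)

/-- The Stasheff relations for algebras with `m_k = 0` for `k ≥ 4`. -/
theorem stasheffSum_self_eq_zero {𝒜 : ℤ → Submodule 𝕜 A} {m : Operations 𝕜 A A}
    (hm : ∀ k, 4 ≤ k → m k = 0)
    (h1 : ∀ a, m 1 ![m 1 ![a]] = 0)
    (h2 : ∀ p a b, a ∈ 𝒜 p →
      m 1 ![m 2 ![a, b]] - m 2 ![m 1 ![a], b] - p.negOnePow • m 2 ![a, m 1 ![b]] = 0)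
    (h3 : ∀ p q r a b c, a ∈ 𝒜 p → b ∈ 𝒜 q → c ∈ 𝒜 r →
      m 3 ![m 1 ![a], b, c] + p.negOnePow • m 3 ![a, m 1 ![b], c] +
        (p.negOnePow * q.negOnePow) • m 3 ![a, b, m 1 ![c]] + m 2 ![m 2 ![a, b], c] -
        m 2 ![a, m 2 ![b, c]] + m 1 ![m 3 ![a, b, c]] = 0)
    (h4 : ∀ p q r s a b c e, a ∈ 𝒜 p → b ∈ 𝒜 q → c ∈ 𝒜 r → e ∈ 𝒜 s →
      m 3 ![m 2 ![a, b], c, e] - m 3 ![a, m 2 ![b, c], e] + m 3 ![a, b, m 2 ![c, e]] -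
        m 2 ![m 3 ![a, b, c], e] - p.negOnePow • m 2 ![a, m 3 ![b, c, e]] = 0)
    (h5 : ∀ p q r s t a b c e f, a ∈ 𝒜 p → b ∈ 𝒜 q → c ∈ 𝒜 r → e ∈ 𝒜 s → f ∈ 𝒜 t →
      m 3 ![m 3 ![a, b, c], e, f] = 0 ∧ m 3 ![a, m 3 ![b, c, e], f] = 0 ∧
        m 3 ![a, b, m 3 ![c, e, f]] = 0)
    {n : ℕ} (hn : 1 ≤ n) (deg : ℕ → ℤ) (a : ℕ → A) (ha : ∀ i, a i ∈ 𝒜 (deg i)) :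
    stasheffSum m m n deg a = 0 := by
  by_cases h : 6 ≤ n
  · exact stasheffSum_eq_zero hm hm h deg a
  obtain rfl | rfl | rfl | rfl | rfl : n = 1 ∨ n = 2 ∨ n = 3 ∨ n = 4 ∨ n = 5 := by omega
  · rw [stasheffSum_one _ _ _ _ hm hm, h1]
  · rw [stasheffSum_two _ _ _ _ hm hm, h2 _ _ _ (ha 0)]
  · rw [stasheffSum_three _ _ _ _ hm hm, h3 _ _ _ _ _ _ (ha 0) (ha 1) (ha 2)]
  · rw [stasheffSum_four _ _ _ _ hm hm, h4 _ _ _ _ _ _ _ _ (ha 0) (ha 1) (ha 2) (ha 3)]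
  · obtain ⟨e1, e2, e3⟩ := h5 _ _ _ _ _ _ _ _ _ _ (ha 0) (ha 1) (ha 2) (ha 3) (ha 4)
    rw [stasheffSum_five _ _ _ _ hm hm, e1, e2, e3, smul_zero, smul_zero, add_zero, add_zero]

end Grading

/-! ### Graded commutative differential algebras as C∞-algebras -/

section DGA

variable {𝕜 A : Type*} [Field 𝕜] [NonUnitalRing A] [Module 𝕜 A] [IsScalarTower 𝕜 A A]
  [SMulCommClass 𝕜 A A]

theorem IsCommDGA.isCInfinityAlgebra {𝒜 : ℤ → Submodule 𝕜 A} {d : A →ₗ[𝕜] A}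
    (H : IsCommDGA 𝒜 d) {m : Operations 𝕜 A A} (m1 : ∀ a, m 1 ![a] = d a)
    (m2 : ∀ a b, m 2 ![a, b] = a * b) (hm : ∀ k, 3 ≤ k → m k = 0) : IsCInfinityAlgebra 𝒜 m where
  isInternal := H.isInternal
  hasDegree := by
    refine Operations.hasDegree_of_le_three (fun k hk => hm k (by omega)) (fun p a ha => ?_)
      (fun p q a b ha hb => ?_) (fun p q r a b c ha hb hc => ?_)
    · rw [m1]
      exact H.d_mem ha
    · rw [m2, sub_self, add_zero]
      exact H.mul_mem ha hb
    · rw [hm 3 le_rfl, zero_apply]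
      exact zero_mem _
  stasheff n hn deg a ha := by
    refine stasheffSum_self_eq_zero (𝒜 := 𝒜) (fun k hk => hm k (by omega)) ?_ ?_ ?_ ?_ ?_ hn deg
      a ha
    · intro a
      rw [m1, m1, H.d_d]
    · intro p a b ha
      rw [m1, m1, m1, m2, m2, m2, H.leibniz ha]
      abel
    · intro p q r a b c ha hb hc
      simp only [hm 3 le_rfl, zero_apply, m1, m2, smul_zero, map_zero, mul_assoc]
      abel
    · intro p q r s a b c e ha hb hc he
      simp [hm 3 le_rfl, m2]
    · intro p q r s t a b c e f ha hb hc he hf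
      simp [hm 3 le_rfl]
  shuffle := by
    refine Operations.vanishesOnShuffles_of_le_three (fun k hk => hm k (by omega))
      (fun p q a b ha hb => ?_) (fun p q r a b c ha hb hc => ?_) (fun p q r a b c ha hb hc => ?_)
    · rw [m2, m2, H.mul_comm ha hb]
    · simp [hm 3 le_rfl]
    · simp [hm 3 le_rfl]

end DGA

/-! ### The operations on the Rumin subspace -/

section RuminOperations

variable {𝕜 A : Type*} [Field 𝕜] [NonUnitalRing A] [Module 𝕜 A] [IsScalarTower 𝕜 A A]
  [SMulCommClass 𝕜 A A]

/-- The operations `m_1 = d`, `m_2 = π μ`, `m_3 = π μ (Γμ ⊗ 1 - 1 ⊗ Γμ)` on a subspace `R`, where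
`ε` is the parity operator. -/
def ruminOperations (d Γ ε : A →ₗ[𝕜] A) (R : Submodule 𝕜 A) (hd : ∀ a ∈ R, d a ∈ R)
    (hπ : ∀ a, homotopyProj d Γ a ∈ R) : Operations 𝕜 R R
  | 1 => MultilinearMap.ofSubsingleton 𝕜 R R (0 : Fin 1) (d.restrict hd)
  | 2 => ((homotopyProj d Γ).codRestrict R hπ).compMultilinearMap
      (MultilinearMap.mk' (fun a : Fin 2 → R => (a 0 : A) * a 1)
        (fun a i x y => by fin_cases i <;> simp [add_mul, mul_add])
        (fun a i c x => by fin_cases i <;> simp [smul_mul_assoc, mul_smul_comm]))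
  | 3 => ((homotopyProj d Γ).codRestrict R hπ).compMultilinearMap
      (MultilinearMap.mk'
        (fun a : Fin 3 → R => Γ ((a 0 : A) * a 1) * a 2 - ε (a 0) * Γ ((a 1 : A) * a 2))
        (fun a i x y => by fin_cases i <;> simp [add_mul, mul_add] <;> abel)
        (fun a i c x => by fin_cases i <;> simp [smul_sub, smul_mul_assoc, mul_smul_comm]))
  | _ => 0

/-- The operations `f_1 = i`, `f_2 = -Γμ` on a subspace `R`. -/
def ruminInclusion (Γ : A →ₗ[𝕜] A) (R : Submodule 𝕜 A) : Operations 𝕜 R A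
  | 1 => MultilinearMap.ofSubsingleton 𝕜 R A (0 : Fin 1) R.subtype
  | 2 => (-Γ).compMultilinearMap
      (MultilinearMap.mk' (fun a : Fin 2 → R => (a 0 : A) * a 1)
        (fun a i x y => by fin_cases i <;> simp [add_mul, mul_add])
        (fun a i c x => by fin_cases i <;> simp [smul_mul_assoc, mul_smul_comm]))
  | _ => 0

theorem ruminInclusion_eq_zero (Γ : A →ₗ[𝕜] A) (R : Submodule 𝕜 A) {k : ℕ} (hk : 3 ≤ k) :
    ruminInclusion Γ R k = 0 := by
  match k, hk with
  | k + 3, _ => rfl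

theorem ruminOperations_eq_zero (d Γ ε : A →ₗ[𝕜] A) (R : Submodule 𝕜 A) (hd : ∀ a ∈ R, d a ∈ R)
    (hπ : ∀ a, homotopyProj d Γ a ∈ R) {k : ℕ} (hk : 4 ≤ k) :
    ruminOperations d Γ ε R hd hπ k = 0 := by
  match k, hk with
  | k + 4, _ => rfl

end RuminOperations

/-- The subspaces `ℛ z = {a ∈ 𝒜 z | Γ a = 0, Γ d a = 0}` with sum `R`. -/
structure IsRuminSubspace {𝕜 A : Type*} [Field 𝕜] [NonUnitalRing A] [Module 𝕜 A]
    (𝒜 : ℤ → Submodule 𝕜 A) (d Γ : A →ₗ[𝕜] A) (ℛ : ℤ → Submodule 𝕜 A) (R : Submodule 𝕜 A) :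
    Prop where
  mem_iff : ∀ z a, a ∈ ℛ z ↔ a ∈ 𝒜 z ∧ Γ a = 0 ∧ Γ (d a) = 0
  eq_iSup : R = ⨆ z, ℛ z

/-! ### The Rumin C∞-algebra -/

namespace IsVerticalHomotopy

variable {𝕜 A : Type*} [Field 𝕜] [NonUnitalRing A] [Module 𝕜 A] [IsScalarTower 𝕜 A A]
  [SMulCommClass 𝕜 A A] {𝒜 ℛ : ℤ → Submodule 𝕜 A} {d : A →ₗ[𝕜] A} {V R : Submodule 𝕜 A}
  {Γ : A →ₗ[𝕜] A} (H : IsVerticalHomotopy 𝒜 d V Γ) (hR : IsRuminSubspace 𝒜 d Γ ℛ R)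

local notation "π" => homotopyProj d Γ

omit [IsScalarTower 𝕜 A A] [SMulCommClass 𝕜 A A] in
theorem coe_smul_units (u : ℤˣ) (a : R) : ((u • a : R) : A) = u • (a : A) := rfl

include hR in
omit [IsScalarTower 𝕜 A A] [SMulCommClass 𝕜 A A] in
theorem rumin_le : R ≤ LinearMap.ker Γ ⊓ LinearMap.ker (Γ ∘ₗ d) := by
  rw [hR.eq_iSup]
  exact iSup_le fun z a ha => ((hR.mem_iff z a).1 ha).2

include hR in
theorem proj_of_mem_rumin {a : A} (ha : a ∈ R) : π a = a :=
  have h := rumin_le hR ha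
  proj_eq_self h.1 h.2

include hR in
theorem mem_rumin_of_mem {z : ℤ} {a : A} (ha : a ∈ ℛ z) : a ∈ R := by
  rw [hR.eq_iSup]
  exact Submodule.mem_iSup_of_mem z ha

include H hR

/-- R is a sum of graded pieces, so the claim is reduced to homogeneous elements, where Γπ = 0 and
Γdπ = 0 give membership. -/
theorem proj_mem_rumin (a : A) : π a ∈ R := by
  have ha : a ∈ ⨆ z, 𝒜 z := by
    rw [H.isInternal.submodule_iSup_eq_top]
    trivial
  induction ha using Submodule.iSup_induction' with
  | mem z a ha =>
    exact mem_rumin_of_mem hR ((hR.mem_iff z _).2 ⟨H.proj_mem ha, H.gamma_proj a, H.gamma_d_proj a⟩)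
  | zero => rw [map_zero]; exact zero_mem _
  | add a b _ _ h1 h2 => rw [map_add]; exact add_mem h1 h2

/-- An element of R is fixed by π, and π commutes with d, so da = π(da). -/
theorem d_mem_rumin (a : A) (ha : a ∈ R) : d a ∈ R := by
  rw [← proj_of_mem_rumin hR ha, H.d_proj]
  exact H.proj_mem_rumin hR _

theorem mem_rumin_iff {z : ℤ} {a : A} (ha : a ∈ 𝒜 z) : a ∈ ℛ z ↔ a ∈ R :=
  ⟨mem_rumin_of_mem hR, fun h => (hR.mem_iff z a).2 ⟨ha, rumin_le hR h⟩⟩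

/-- The operations of the Rumin algebra. -/
def operations : Operations 𝕜 R R :=
  ruminOperations d Γ (gradedParity H.isInternal) R (H.d_mem_rumin hR) (H.proj_mem_rumin hR)

theorem operations_one (a : R) : (H.operations hR 1 ![a] : A) = d a := rfl

theorem operations_two (a b : R) : (H.operations hR 2 ![a, b] : A) = π ((a : A) * b) := rfl

theorem operations_three {p : ℤ} (a b c : R) (ha : (a : A) ∈ 𝒜 p) :
    (H.operations hR 3 ![a, b, c] : A) = π (H.triple p a b c) := by
  rw [triple, ← smul_mul_assoc, ← gradedParity_apply H.isInternal ha]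
  rfl

theorem operations_eq_zero {k : ℕ} (hk : 4 ≤ k) : H.operations hR k = 0 :=
  ruminOperations_eq_zero _ _ _ _ _ _ hk

/-- Arities 1 and 2 hold because d² = 0 and π commutes with d. Arities 3 and 4 are the images under
π of the two identities for T. In arity 5 each composite of m₃ with itself is zero. -/
theorem isCInfinityAlgebra_operations :
    IsCInfinityAlgebra (fun z => (ℛ z).submoduleOf R) (H.operations hR) where
  isInternal := isInternal_submoduleOf H.isInternal
    (fun z a ha => ((hR.mem_iff z a).1 ha).1) hR.eq_iSup
  hasDegree := by
    have key : ∀ {z : ℤ} {a : R}, (a : A) ∈ 𝒜 z → a ∈ (ℛ z).submoduleOf R := fun {z a} h =>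
      (H.mem_rumin_iff hR h).2 a.2
    have key' : ∀ {z : ℤ} {a : R}, a ∈ (ℛ z).submoduleOf R → (a : A) ∈ 𝒜 z := fun {z a} h =>
      ((hR.mem_iff z a).1 h).1
    refine Operations.hasDegree_of_le_three (fun k hk => H.operations_eq_zero hR hk)
      (fun p a ha => key ?_) (fun p q a b ha hb => key ?_) (fun p q r a b c ha hb hc => key ?_)
    · exact H.d_mem (key' ha)
    · rw [operations_two, sub_self, add_zero]
      exact H.proj_mem (H.mul_mem (key' ha) (key' hb))
    · rw [H.operations_three hR _ _ _ (key' ha)]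
      exact H.proj_mem (H.triple_mem (key' ha) (key' hb) (key' hc))
  stasheff n hn deg a ha := by
    have key' : ∀ {z : ℤ} {a : R}, a ∈ (ℛ z).submoduleOf R → (a : A) ∈ 𝒜 z := fun {z a} h =>
      ((hR.mem_iff z a).1 h).1
    refine stasheffSum_self_eq_zero (𝒜 := fun z => (ℛ z).submoduleOf R)
      (fun k hk => H.operations_eq_zero hR hk) (fun a => Subtype.ext (H.d_d a)) ?_ ?_ ?_ ?_ hn deg
      a ha
    · intro p a b ha
      exact Subtype.ext (H.d_proj_mul (key' ha) b)
    · intro p q r a b c ha hb hc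
      replace ha := key' ha
      replace hb := key' hb
      refine Subtype.ext ?_
      simp only [Submodule.coe_add, Submodule.coe_sub, coe_smul_units, operations_one,
        operations_two, Submodule.coe_zero, H.operations_three hR _ _ _ ha,
        H.operations_three hR (H.operations hR 1 ![a]) _ _ (H.d_mem ha)]
      have h := congrArg π (H.triple_d ha hb c)
      rw [map_zero] at h
      rw [← h, H.d_proj]
      rcases Int.units_eq_one_or p.negOnePow with hp | hp <;>
      rcases Int.units_eq_one_or q.negOnePow with hq | hq <;>
      · simp only [hp, hq, one_smul, Units.neg_smul, mul_one, mul_neg, neg_neg, map_add,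
          map_sub, map_neg]
    · intro p q r s a b c e ha hb hc he
      replace ha := key' ha
      replace hb := key' hb
      replace hc := key' hc
      refine Subtype.ext ?_
      simp only [Submodule.coe_add, Submodule.coe_sub, coe_smul_units,
        operations_two, Submodule.coe_zero, H.operations_three hR _ _ _ ha,
        H.operations_three hR _ _ _ hb,
        H.operations_three hR (H.operations hR 2 ![a, b]) _ _ (H.proj_mem (H.mul_mem ha hb))]
      have h := congrArg π (H.triple_proj (e := (e : A)) ha hb hc)
      rw [map_zero] at h
      rw [← h]
      rcases Int.units_eq_one_or p.negOnePow with hp | hp <;>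
      · simp only [hp, one_smul, Units.neg_smul, map_add, map_sub, map_neg]
    · intro p q r s t a b c e f ha hb hc he hf
      replace ha := key' ha
      replace hb := key' hb
      replace hc := key' hc
      -- The inner m₃ is vertical. In the outer T it appears either inside Γ, which kills vertical
      -- products, or multiplied by a vertical value of Γ, which gives zero.
      refine ⟨Subtype.ext ?_, Subtype.ext ?_, Subtype.ext ?_⟩
      · have hv : (H.operations hR 3 ![a, b, c] : A) ∈ V := by
          rw [H.operations_three hR _ _ _ ha]
          exact H.proj_vertical (H.triple_vertical _ _ _ _)
        rw [H.operations_three hR _ _ _ (p := p + q + r - 1), triple,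
          H.gamma_eq_zero (H.vertical_mul hv _),
          H.vertical_mul_vertical hv (H.gamma_vertical _), zero_mul, smul_zero, sub_zero, map_zero,
          Submodule.coe_zero]
        rw [H.operations_three hR _ _ _ ha]
        exact H.proj_mem (H.triple_mem ha hb hc)
      · have hv : (H.operations hR 3 ![b, c, e] : A) ∈ V := by
          rw [H.operations_three hR _ _ _ hb]
          exact H.proj_vertical (H.triple_vertical _ _ _ _)
        rw [H.operations_three hR _ _ _ ha, triple, H.gamma_eq_zero (H.vertical_mul hv _),
          H.gamma_eq_zero (H.mul_vertical _ hv), zero_mul, mul_zero, smul_zero, sub_zero, map_zero,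
          Submodule.coe_zero]
      · have hv : (H.operations hR 3 ![c, e, f] : A) ∈ V := by
          rw [H.operations_three hR _ _ _ hc]
          exact H.proj_vertical (H.triple_vertical _ _ _ _)
        rw [H.operations_three hR _ _ _ ha, triple, H.gamma_eq_zero (H.mul_vertical _ hv),
          H.vertical_mul_vertical (H.gamma_vertical _) hv, mul_zero, smul_zero, sub_zero, map_zero,
          Submodule.coe_zero]
  shuffle := by
    have key' : ∀ {z : ℤ} {a : R}, a ∈ (ℛ z).submoduleOf R → (a : A) ∈ 𝒜 z := fun {z a} h =>
      ((hR.mem_iff z a).1 h).1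
    refine Operations.vanishesOnShuffles_of_le_three (fun k hk => H.operations_eq_zero hR hk)
      (fun p q a b ha hb => Subtype.ext (H.proj_mul_eq (key' ha) (key' hb)))
      (fun p q r a b c ha hb hc => Subtype.ext ?_) (fun p q r a b c ha hb hc => Subtype.ext ?_)
    · replace ha := key' ha
      replace hb := key' hb
      replace hc := key' hc
      simp only [Submodule.coe_add, Submodule.coe_sub, coe_smul_units, Submodule.coe_zero,
        H.operations_three hR _ _ _ ha, H.operations_three hR _ _ _ hb]
      have h := congrArg π (H.triple_shuffle_one_two ha hb hc)
      rw [map_zero] at h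
      rw [← h]
      rcases Int.units_eq_one_or (p * q).negOnePow with hp | hp <;>
      rcases Int.units_eq_one_or (p * r).negOnePow with hq | hq <;>
      · simp only [hp, hq, one_smul, Units.neg_smul, mul_one, mul_neg, neg_neg, map_add,
          map_sub, map_neg]
    · replace ha := key' ha
      replace hb := key' hb
      replace hc := key' hc
      simp only [Submodule.coe_add, Submodule.coe_sub, coe_smul_units, Submodule.coe_zero,
        H.operations_three hR _ _ _ ha, H.operations_three hR _ _ _ hc]
      have h := congrArg π (H.triple_shuffle_two_one ha hb hc)
      rw [map_zero] at h
      rw [← h]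
      rcases Int.units_eq_one_or (q * r).negOnePow with hp | hp <;>
      rcases Int.units_eq_one_or (p * r).negOnePow with hq | hq <;>
      · simp only [hp, hq, one_smul, Units.neg_smul, mul_one, mul_neg, neg_neg, map_add,
          map_sub, map_neg]

end IsVerticalHomotopy

/-! ### The C∞-quasi-isomorphism to the ambient algebra -/

namespace IsVerticalHomotopy

variable {𝕜 A : Type*} [Field 𝕜] [NonUnitalRing A] [Module 𝕜 A] [IsScalarTower 𝕜 A A]
  [SMulCommClass 𝕜 A A] {𝒜 ℛ : ℤ → Submodule 𝕜 A} {d : A →ₗ[𝕜] A} {V R : Submodule 𝕜 A}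
  {Γ : A →ₗ[𝕜] A} (H : IsVerticalHomotopy 𝒜 d V Γ) (hR : IsRuminSubspace 𝒜 d Γ ℛ R)

local notation "π" => homotopyProj d Γ

theorem ruminInclusion_one (a : R) : ruminInclusion Γ R 1 ![a] = a := rfl

theorem ruminInclusion_two (a b : R) : ruminInclusion Γ R 2 ![a, b] = -Γ ((a : A) * b) := rfl

include H hR

theorem operations_three_vertical {p : ℤ} (a b c : R) (ha : (a : A) ∈ 𝒜 p) :
    (H.operations hR 3 ![a, b, c] : A) ∈ V := by
  rw [H.operations_three hR _ _ _ ha]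
  exact H.proj_vertical (H.triple_vertical _ _ _ _)

theorem isCInfinityMorphism_inclusion {m : Operations 𝕜 A A} (m1 : ∀ a, m 1 ![a] = d a)
    (m2 : ∀ a b, m 2 ![a, b] = a * b) (hm : ∀ k, 3 ≤ k → m k = 0) :
    IsCInfinityMorphism (fun z => (ℛ z).submoduleOf R) (H.operations hR) 𝒜 m
      (ruminInclusion Γ R) where
  hasDegree := by
    have key' : ∀ {z : ℤ} {a : R}, a ∈ (ℛ z).submoduleOf R → (a : A) ∈ 𝒜 z := fun {z a} h =>
      ((hR.mem_iff z a).1 h).1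
    refine Operations.hasDegree_of_le_three
      (fun k hk => ruminInclusion_eq_zero Γ R (by omega)) (fun p a ha => ?_)
      (fun p q a b ha hb => ?_) (fun p q r a b c ha hb hc => ?_)
    · rw [ruminInclusion_one, sub_self, add_zero]
      exact key' ha
    · rw [ruminInclusion_two]
      exact neg_mem (H.gamma_mem (H.mul_mem (key' ha) (key' hb)))
    · rw [ruminInclusion_eq_zero Γ R le_rfl, zero_apply]
      exact zero_mem _
  relations n hn deg a ha := by
    have ha' : ∀ i, (a i : A) ∈ 𝒜 (deg i) := fun i => ((hR.mem_iff _ _).1 (ha i)).1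
    have h4 : ∀ k, 4 ≤ k → H.operations hR k = 0 := fun k => H.operations_eq_zero hR
    have hf : ∀ k, 3 ≤ k → ruminInclusion Γ R k = 0 := fun k => ruminInclusion_eq_zero Γ R
    have hf4 : ∀ k, 4 ≤ k → ruminInclusion Γ R k = 0 := fun k hk => hf k (by omega)
    by_cases hn5 : 5 ≤ n
    · rw [compositionSum_eq_zero _ _ hm hf hn5]
      by_cases hn6 : 6 ≤ n
      · exact stasheffSum_eq_zero h4 hf4 hn6 deg a
      obtain rfl : n = 5 := by omega
      rw [stasheffSum_five _ _ _ _ h4 hf4, hf 3 le_rfl]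
      simp only [zero_apply, smul_zero, add_zero]
    obtain rfl | rfl | rfl | rfl : n = 1 ∨ n = 2 ∨ n = 3 ∨ n = 4 := by omega
    · rw [stasheffSum_one _ _ _ _ h4 hf4, compositionSum_one _ _ hm hf, m1]
      rfl
    -- Arity 2 is the definition of π evaluated on ab, with d(ab) expanded by the Leibniz rule.
    · rw [stasheffSum_two _ _ _ _ h4 hf4, compositionSum_two _ _ hm hf, m1, m2]
      simp only [ruminInclusion_one, ruminInclusion_two, operations_one, operations_two,
        homotopyProj_apply, H.leibniz (ha' 0), map_add, map_neg]
      rcases Int.units_eq_one_or (deg 0).negOnePow with hp | hp <;>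
      · simp only [hp, one_smul, Units.neg_smul, map_neg]
        abel
    -- Arity 3: Γ(π(ab)c) and Γ(aπ(bc)) differ from Γ(abc) by terms that add up to ΓdT, so the left
    -- side is πT + ΓdT = T, which is the right side.
    · have hx := H.proj_of_vertical (H.triple_vertical (deg 0) (a 0) (a 1) (a 2))
      rw [stasheffSum_three _ _ _ _ h4 hf4, compositionSum_three _ _ hm hf, m2, m2, hf 3 le_rfl]
      simp only [ruminInclusion_one, ruminInclusion_two, operations_two, zero_apply, smul_zero,
        H.operations_three hR _ _ _ (ha' 0), hx,
        H.gamma_proj_mul (H.mul_mem (ha' 0) (ha' 1)), H.gamma_mul_proj (ha' 0), mul_assoc]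
      simp only [triple]
      rcases Int.units_eq_one_or (deg 0).negOnePow with hp | hp <;>
      · simp only [hp, one_smul, Units.neg_smul, map_sub, map_neg, neg_mul, mul_neg]
        abel
    -- Arity 4: the right side is a product of two values of Γ, and the left side is Γ of vertical
    -- forms; both vanish.
    · rw [stasheffSum_four _ _ _ _ h4 hf4, compositionSum_four _ _ hm hf, m2, hf 3 le_rfl]
      have hv := H.operations_three_vertical hR (a 0) (a 1) (a 2) (ha' 0)
      have hv' := H.operations_three_vertical hR (a 1) (a 2) (a 3) (ha' 1)
      simp only [ruminInclusion_two, zero_apply, neg_mul, mul_neg, H.gamma_mul_gamma,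
        H.gamma_eq_zero (H.vertical_mul hv _), H.gamma_eq_zero (H.mul_vertical _ hv'),
        neg_zero, smul_zero, sub_zero, add_zero]
  shuffle := by
    refine Operations.vanishesOnShuffles_of_le_three
      (fun k hk => ruminInclusion_eq_zero Γ R (by omega))
      (fun p q a b ha hb => ?_) (fun p q r a b c ha hb hc => ?_) (fun p q r a b c ha hb hc => ?_)
    · have h : Γ ((a : A) * b) = _ :=
        H.gamma_mul_eq ((hR.mem_iff _ _).1 ha).1 ((hR.mem_iff _ _).1 hb).1
      rw [ruminInclusion_two, ruminInclusion_two, h, smul_neg]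
    · simp only [ruminInclusion_eq_zero Γ R (le_refl 3), zero_apply, smul_zero, sub_zero, add_zero]
    · simp only [ruminInclusion_eq_zero Γ R (le_refl 3), zero_apply, smul_zero, sub_zero, add_zero]

theorem isCInfinityQuasiIso_inclusion {m : Operations 𝕜 A A} (m1 : ∀ a, m 1 ![a] = d a)
    (m2 : ∀ a b, m 2 ![a, b] = a * b) (hm : ∀ k, 3 ≤ k → m k = 0) :
    IsCInfinityQuasiIso (fun z => (ℛ z).submoduleOf R) (H.operations hR) 𝒜 m
      (ruminInclusion Γ R) := by
  refine ⟨H.isCInfinityMorphism_inclusion hR m1 m2 hm, ?_⟩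
  have hone : ∀ a, m.one a = d a := fun a => by
    rw [← m1]
    exact congrArg (m 1) (by funext i; fin_cases i; rfl)
  have hR1 : ∀ a : R, ((H.operations hR).one a : A) = d a := fun _ => rfl
  have mem_coc : ∀ {z : ℤ} {a : A}, a ∈ cocycles 𝒜 m z ↔ d a = 0 ∧ a ∈ 𝒜 z := fun {z a} => by
    rw [cocycles, Submodule.mem_inf, LinearMap.mem_ker, hone]
  have mem_cocR : ∀ {z : ℤ} {a : R}, a ∈ cocycles (fun z => (ℛ z).submoduleOf R)
      (H.operations hR) z ↔ d (a : A) = 0 ∧ (a : A) ∈ 𝒜 z := fun {z a} => by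
    rw [cocycles, Submodule.mem_inf, LinearMap.mem_ker, ← hR1, Submodule.coe_eq_zero]
    exact and_congr_right fun _ => ⟨fun h => ((hR.mem_iff _ _).1 h).1,
      fun h => (H.mem_rumin_iff hR h).2 a.2⟩
  have hmap : ∀ {z : ℤ} {a : R}, a ∈ cocycles (fun z => (ℛ z).submoduleOf R)
      (H.operations hR) z → (a : A) ∈ cocycles 𝒜 m z := fun h => mem_coc.2 (mem_cocR.1 h)
  let φ : ∀ z : ℤ, cocycles (fun z => (ℛ z).submoduleOf R) (H.operations hR) z →ₗ[𝕜]
      cocycles 𝒜 m z := fun z => R.subtype.restrict fun a ha => hmap ha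
  -- Equality with the preimage gives well-definedness and injectivity in cohomology at once. For
  -- the second: if a in R equals db in the ambient algebra, then a = πa = d(πb), exact within R.
  have hφ : ∀ z, (LinearMap.range (H.operations hR).one).submoduleOf
      (cocycles (fun z => (ℛ z).submoduleOf R) (H.operations hR) z) =
      ((LinearMap.range m.one).submoduleOf (cocycles 𝒜 m z)).comap (φ z) := by
    intro z
    ext a
    constructor
    · rintro ⟨b, hb⟩
      refine ⟨(b : A), ?_⟩
      rw [hone, ← hR1, hb]
      rfl
    · rintro ⟨b, hb⟩
      refine ⟨⟨π b, H.proj_mem_rumin hR b⟩, Subtype.ext ?_⟩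
      have hb' : d b = (a : R) := by
        rw [← hone, hb]
        rfl
      rw [hR1]
      change d (π b) = _
      rw [H.d_proj, hb', proj_of_mem_rumin hR (a : R).2]
      rfl
  have hbij : ∀ z, Function.Bijective (Submodule.mapQ _ _ (φ z) (hφ z).le) := by
    intro z
    constructor
    · rw [← LinearMap.ker_eq_bot, Submodule.ker_mapQ, ← hφ, Submodule.mkQ_map_self]
    · intro x
      obtain ⟨⟨x, hx⟩, rfl⟩ := Submodule.Quotient.mk_surjective _ x
      obtain ⟨hx1, hx2⟩ := mem_coc.1 hx
      have hp : (⟨π x, H.proj_mem_rumin hR x⟩ : R) ∈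
          cocycles (fun z => (ℛ z).submoduleOf R) (H.operations hR) z :=
        mem_cocR.2 ⟨by rw [H.d_proj, hx1, map_zero], H.proj_mem hx2⟩
      refine ⟨Submodule.Quotient.mk ⟨_, hp⟩, ?_⟩
      rw [Submodule.mapQ_apply, Submodule.Quotient.eq]
      -- For a cocycle x, πx - x = -dΓx, so every class has a representative in R.
      refine ⟨-Γ x, ?_⟩
      rw [hone]
      change d (-Γ x) = π x - x
      rw [homotopyProj_apply, hx1, map_zero, map_neg]
      abel
  refine ⟨fun z => LinearEquiv.ofBijective _ (hbij z), fun z a ha => ⟨hmap ha, rfl⟩,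
    fun p q a b ha hb => ?_⟩
  obtain ⟨ha1, ha2⟩ := mem_cocR.1 ha
  obtain ⟨hb1, hb2⟩ := mem_cocR.1 hb
  have hd : d ((a : A) * b) = 0 := by
    rw [H.leibniz ha2, ha1, hb1, zero_mul, mul_zero, smul_zero, add_zero]
  have hab : H.operations hR 2 ![a, b] ∈
      cocycles (fun z => (ℛ z).submoduleOf R) (H.operations hR) (p + q) :=
    mem_cocR.2 ⟨by rw [operations_two, H.d_proj, hd, map_zero], H.proj_mem (H.mul_mem ha2 hb2)⟩
  have hfab : m 2 ![(ruminInclusion Γ R).one a, (ruminInclusion Γ R).one b] ∈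
      cocycles 𝒜 m (p + q) := by
    rw [m2]
    exact mem_coc.2 ⟨hd, H.mul_mem ha2 hb2⟩
  refine ⟨hab, hfab, ?_⟩
  change Submodule.mapQ _ _ (φ (p + q)) (hφ (p + q)).le (Submodule.Quotient.mk ⟨_, hab⟩) =
    Submodule.Quotient.mk ⟨_, hfab⟩
  rw [Submodule.mapQ_apply, Submodule.Quotient.eq]
  -- The two products π(ab) and ab of cocycles differ by the boundary of f₂(a, b).
  refine ⟨-Γ ((a : A) * b), ?_⟩
  rw [hone]
  change d (-Γ ((a : A) * b)) = π ((a : A) * b) -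
    m 2 ![(ruminInclusion Γ R).one a, (ruminInclusion Γ R).one b]
  rw [m2, homotopyProj_apply, hd, map_zero, map_neg]
  change _ = (a : A) * b - _ - 0 - (a : A) * b
  abel

end IsVerticalHomotopy

/-! ### Differential forms on a contact manifold as an instance of the algebraic theory -/

section DeRhamAlgebra
variable {E : Type*} [NormedAddCommGroup E] [NormedSpace ℝ E] [FiniteDimensional ℝ E]
variable {M : Type*} [TopologicalSpace M] [ChartedSpace E M]

open ExtForm

namespace deRham

instance : NonUnitalRing (deRham E M) :=
  { (inferInstance : AddCommGroup (deRham E M)) with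
    mul := fun a b => deRham.wedge a b
    left_distrib := fun a b c => map_add (deRham.wedge a) b c
    right_distrib := fun a b c => LinearMap.map_add₂ deRham.wedge a b c
    zero_mul := fun a => LinearMap.map_zero₂ deRham.wedge a
    mul_zero := fun a => map_zero (deRham.wedge a)
    mul_assoc := fun a b c => Subtype.ext (FormField.ext_val fun x =>
      wedge_assoc (V := E) (a.1.val x) (b.1.val x) (c.1.val x)) }

instance : IsScalarTower ℝ (deRham E M) (deRham E M) :=
  ⟨fun c a b => LinearMap.map_smul₂ deRham.wedge c a b⟩

instance : SMulCommClass ℝ (deRham E M) (deRham E M) :=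
  ⟨fun c a b => (map_smul (deRham.wedge a) c b).symm⟩

theorem isInternal_grading : DirectSum.IsInternal (grading (E := E) (M := M)) := by
  refine DirectSum.isInternal_submodule_of_iSupIndep_of_iSup_eq_top ?_ iSup_grading
  rw [iSupIndep_iff_finsetSum_eq_zero_imp_eq_zero]
  intro s v hv h0 i hi
  by_cases hneg : i < 0
  · exact eq_zero_of_neg hneg (hv i hi)
  lift i to ℕ using not_lt.1 hneg
  have h1 := congrArg (component (E := E) (M := M) i) h0
  rwa [map_zero, map_sum, Finset.sum_eq_single_of_mem (i : ℤ) hi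
    (fun j hj hji => component_eq_zero hji (hv j hj)), component_eq_self (hv i hi)] at h1

theorem isCommDGA [IsManifold 𝓘(ℝ, E) ∞ M] :
    IsCommDGA (grading (E := E) (M := M)) deRham.d where
  isInternal := isInternal_grading
  d_mem ha x := FormField.d_isHomogeneous isOpen_univ (fun y _ => ha y) (Set.mem_univ x)
  mul_mem {p q a b} ha hb x := IsHomogeneous.mul (V := E) (ha x) (hb x)
  d_d a := Subtype.ext (FormField.ext_val fun x =>
    FormField.val_d_d isOpen_univ a.2 (Set.mem_univ x))
  leibniz {p a} ha b := Subtype.ext (FormField.ext_val fun x => by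
    have h := FormField.val_d_wedge isOpen_univ a.2 b.2 (Set.mem_univ x)
    have hp : parity (a.1.val x) = p.negOnePow • a.1.val x :=
      IsHomogeneous.parity_eq (V := E) (a := a.1.val x) (ha x)
    rw [hp] at h
    refine h.trans (congrArg (fun y : ExtForm E => a.1.d.val x * b.1.val x + y) ?_)
    change (p.negOnePow • a.1.val x) * b.1.d.val x = p.negOnePow • (a.1.val x * b.1.d.val x)
    rcases Int.units_eq_one_or p.negOnePow with h1 | h1 <;>
      simp only [h1, one_smul, Units.neg_smul, neg_mul])
  mul_comm {p q a b} ha hb := Subtype.ext (FormField.ext_val fun x =>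
    IsHomogeneous.mul_comm (E := E) (ha x) (hb x))

theorem linearMap_ext {N : Type*} [AddCommGroup N] [Module ℝ N] {f g : deRham E M →ₗ[ℝ] N}
    (h : ∀ (k : ℤ), ∀ a ∈ grading (E := E) (M := M) k, f a = g a) : f = g := by
  refine LinearMap.ext fun a => ?_
  rw [sum_component a, map_sum, map_sum]
  exact Finset.sum_congr rfl fun k _ => h k _ (component_mem k a)

end deRham

namespace ContactStructure

variable {n : ℕ} (C : ContactStructure E M n)

/-- The ideal of vertical forms. -/
def vertical : Submodule ℝ (deRham E M) where
  carrier := {α | C.IsVertical α}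
  add_mem' {a b} ha hb U θ hθ x hx := by
    have h := congrArg₂ (· + ·) (ha U θ hθ x hx) (hb U θ hθ x hx)
    exact (mul_add (θ.val x) (a.1.val x) (b.1.val x)).trans (h.trans (add_zero _))
  zero_mem' U θ _ x _ := mul_zero (θ.val x)
  smul_mem' c a ha U θ hθ x hx :=
    (mul_smul_comm c (θ.val x) (a.1.val x)).trans
      ((congrArg (c • ·) (ha U θ hθ x hx)).trans (smul_zero c))

variable [IsManifold 𝓘(ℝ, E) ∞ M] (hE : Module.finrank ℝ E = 2 * n + 1)

-- For the vertical form τ = Γα, differentiating θ∧τ = 0 gives θ∧dτ = τ∧dθ. This is exactly what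
-- makes τ satisfy the equations for Γ(dτ), in high degrees with the same ζ as for α.
variable {C} in
theorem gamma_d_gamma_of_mem {k : ℤ} {α : deRham E M} (hα : α ∈ deRham.grading k) :
    C.gamma hE (deRham.d (C.gamma hE α)) = C.gamma hE α := by
  have hH := isLefschetzInverse_gamma (C := C) hE
  have hd : deRham.d (C.gamma hE α) ∈ deRham.grading (E := E) (M := M) k := by
    have := deRham.isCommDGA.d_mem (hH.mem_grading k α hα)
    rwa [sub_add_cancel] at this
  refine gamma_eq_of_isGammaAt hE hd fun x => ?_
  obtain ⟨U, θ, hx, hθ⟩ := C.smooth x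
  replace hθ : C.IsContactForm U θ := hθ
  have hp := hθ.isContactPair hx
  have h := gammaAt_spec (C := C) hE (hα x) U θ hθ hx
  have hmul : θ.val x * (deRham.d (C.gamma hE α)).1.val x =
      (C.gamma hE α).1.val x * θ.d.val x :=
    (hθ.mul_val_d hθ.isOpen subset_rfl
      (fun x₀ j => ((C.gamma hE α).2 x₀ j).mono
        (Set.inter_subset_inter_right _ (Set.subset_univ _)))
      (fun y hy => hH.isVertical α U θ hθ y hy) hx).trans (hp.right.commute_of_two _).eq
  refine hθ.isGammaAt hx ⟨h.homogeneous, h.vertical, fun hk => ?_, fun hk => ?_⟩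
  · rw [hmul, mul_assoc, ← pow_succ', show (n + 2 - k).toNat = (n + 1 - k).toNat + 1 by omega]
  · obtain ⟨ζ, h1, h2, h3, h4⟩ := h.high hk
    refine ⟨ζ, h1, h2, ?_, h4⟩
    rw [hmul, show (k - n).toNat = (k - n - 1).toNat + 1 by omega, pow_succ, ← mul_assoc]
    exact congrArg (· * θ.d.val x) h4

theorem mul_isVertical (a : deRham E M) {v : deRham E M} (hv : C.IsVertical v) :
    C.IsVertical (a * v) := fun U θ hθ x hx =>
  have h : θ.val x * v.1.val x = 0 := hv U θ hθ x hx
  (IsContactForm.isContactPair (C := C) hθ hx).mul_vertical (a.1.val x) h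

theorem isVertical_mul {v : deRham E M} (hv : C.IsVertical v) (a : deRham E M) :
    C.IsVertical (v * a) := fun U θ hθ x hx =>
  have h : θ.val x * v.1.val x = 0 := hv U θ hθ x hx
  (IsContactForm.isContactPair (C := C) hθ hx).vertical_mul h (a.1.val x)

theorem mul_eq_zero_of_isVertical {u v : deRham E M} (hu : C.IsVertical u) (hv : C.IsVertical v) :
    u * v = 0 := Subtype.ext (FormField.ext_val fun x => by
  obtain ⟨U, θ, hx, hθ⟩ := C.smooth x
  have h1 : θ.val x * u.1.val x = 0 := hu U θ hθ x hx
  have h2 : θ.val x * v.1.val x = 0 := hv U θ hθ x hx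
  exact (IsContactForm.isContactPair (C := C) hθ hx).mul_eq_zero_of_vertical h1 h2)

theorem isVerticalHomotopy_gamma :
    IsVerticalHomotopy deRham.grading deRham.d C.vertical (C.gamma hE) where
  toIsCommDGA := deRham.isCommDGA
  gamma_mem {p a} ha := (isLefschetzInverse_gamma (C := C) hE).mem_grading p a ha
  gamma_vertical a := (isLefschetzInverse_gamma (C := C) hE).isVertical a
  gamma_eq_zero hv := gamma_eq_zero_of_isVertical hE hv
  mul_vertical a _ hv := C.mul_isVertical a hv
  vertical_mul hv a := C.isVertical_mul hv a
  vertical_mul_vertical hu hv := C.mul_eq_zero_of_isVertical hu hv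
  gamma_d_gamma a := congrArg (fun f : deRham E M →ₗ[ℝ] deRham E M => f a) (deRham.linearMap_ext
    (f := C.gamma hE ∘ₗ deRham.d ∘ₗ C.gamma hE) fun _ _ ha => gamma_d_gamma_of_mem hE ha)

-- In degrees at most n the defining equation of Γα turns Γα = 0 into θ∧α∧dθ^(n+1-k) = 0 by
-- Lefschetz injectivity. In higher degrees Γα∧dθ = θ∧α turns it into θ∧α = 0. The second Rumin
-- condition is the same statement for dα.
variable {C} in
theorem mem_ruminDegree_iff {k : ℤ} {α : deRham E M} : α ∈ C.ruminDegree k ↔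
    α ∈ deRham.grading k ∧ C.gamma hE α = 0 ∧ C.gamma hE (deRham.d α) = 0 := by
  have hd : α ∈ deRham.grading (E := E) (M := M) k → deRham.d α ∈ deRham.grading (k + 1) :=
    fun h => deRham.isCommDGA.d_mem h
  have hw : ∀ {U θ} (β : deRham E M) (x : M) (j : ℕ), C.IsContactForm U θ →
      ((θ x).wedge (β.1 x)).wedgePow (θ.d x) j = θ.val x * β.1.val x * θ.d.val x ^ j :=
    fun {U θ} β x j _ => wedgePow_eq_mul_pow (V := E) (θ.val x * β.1.val x) (θ.d.val x) j
  constructor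
  · rintro ⟨hα, h⟩
    refine ⟨hα, gamma_eq_of_isGammaAt hE hα fun x U θ hθ hx => ?_,
      gamma_eq_of_isGammaAt hE (hd hα) fun x U θ hθ hx => ?_⟩
    · refine ⟨isHomogeneous_zero _, mul_zero _, fun hk => ?_, fun hk => ?_⟩
      · rw [← hw α x _ hθ, ((h U θ hθ x hx).1 hk).1]
        exact (zero_mul _).symm
      · have h1 : θ.val x * α.1.val x = 0 := ((h U θ hθ x hx).2 hk).1
        exact (IsContactPair.isLefschetzImage_zero (k := k) h1).high hk
    · refine ⟨isHomogeneous_zero _, mul_zero _, fun hk => ?_, fun hk => ?_⟩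
      · rw [← hw (deRham.d α) x _ hθ, show ((n : ℤ) + 1 - (k + 1)) = n - k by ring,
          ((h U θ hθ x hx).1 (by omega)).2]
        exact (zero_mul _).symm
      · refine (IsContactPair.isLefschetzImage_zero (k := k + 1) ?_).high hk
        -- Here dα has high degree, but for k = n the Rumin condition on it is the low one; its
        -- exponent n - k is then 0, so the two agree.
        by_cases hk' : k ≤ n
        · have h1 := ((h U θ hθ x hx).1 hk').2
          rwa [hw (deRham.d α) x _ hθ, show ((n : ℤ) - k).toNat = 0 by omega, pow_zero, mul_one]
            at h1
        · exact ((h U θ hθ x hx).2 (by omega)).2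
  · rintro ⟨hα, h1, h2⟩
    have key : ∀ {U θ} {x : M} {l : ℤ} {β : deRham E M}, C.IsContactForm U θ → x ∈ U →
        β ∈ deRham.grading l → C.gamma hE β = 0 →
        (l ≤ n → θ.val x * β.1.val x * θ.d.val x ^ (n + 1 - l).toNat = 0) ∧
        (n + 1 ≤ l → θ.val x * β.1.val x = 0) := by
      intro U θ x l β hθ hx hβ h0
      have h : IsLefschetzImage n (θ.val x) (θ.d.val x) l (β.1.val x) ((C.gamma hE β).1.val x) :=
        gammaAt_spec (C := C) hE (hβ x) U θ hθ hx
      rw [h0] at h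
      refine ⟨fun hl => (h.low hl).trans (zero_mul _), fun hl => ?_⟩
      obtain ⟨ζ, -, -, h3, h4⟩ := h.high hl
      -- One factor dθ is split off to recognize θ∧β = Γβ∧dθ.
      rw [h3, show (l - n).toNat = (l - n - 1).toNat + 1 by omega, pow_succ, ← mul_assoc, ← h4]
      exact zero_mul _
    refine ⟨hα, fun U θ hθ x hx => ⟨fun hk => ⟨?_, ?_⟩, fun hk => ⟨?_, ?_⟩⟩⟩
    · rw [hw α x _ hθ]
      exact (key hθ hx hα h1).1 hk
    · rw [hw (deRham.d α) x _ hθ]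
      by_cases hk' : k + 1 ≤ n
      · have := (key hθ hx (hd hα) h2).1 hk'
        rwa [show ((n : ℤ) + 1 - (k + 1)) = n - k by ring] at this
      · rw [(key hθ hx (hd hα) h2).2 (by omega)]
        exact zero_mul (θ.d.val x ^ ((n : ℤ) - k).toNat)
    · exact (key hθ hx hα h1).2 hk
    · exact (key hθ hx (hd hα) h2).2 (by omega)

theorem isRuminSubspace :
    IsRuminSubspace deRham.grading deRham.d (C.gamma hE) C.ruminDegree C.rumin :=
  ⟨fun _ _ => mem_ruminDegree_iff hE, rfl⟩

variable {C} in
theorem IsLefschetzInverse.unique {Γ Γ' : deRham E M →ₗ[ℝ] deRham E M}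
    (h : C.IsLefschetzInverse Γ) (h' : C.IsLefschetzInverse Γ') : Γ = Γ' :=
  deRham.linearMap_ext fun k a ha => Subtype.ext (FormField.ext_val fun x =>
    (((isLefschetzInverse_iff _).1 h).2 k a ha x).unique
      (((isLefschetzInverse_iff _).1 h').2 k a ha x))

end ContactStructure

end DeRhamAlgebra

theorem corollary4p2 {n : ℕ} {E : Type*} [NormedAddCommGroup E] [NormedSpace ℝ E]
    [FiniteDimensional ℝ E] (hE : Module.finrank ℝ E = 2 * n + 1)
    {M : Type*} [TopologicalSpace M] [ChartedSpace E M] [IsManifold 𝓘(ℝ, E) ∞ M]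
    (C : ContactStructure E M n) :
    ∃ Γ : deRham E M →ₗ[ℝ] deRham E M,
      C.IsLefschetzInverse Γ ∧ (∀ Γ', C.IsLefschetzInverse Γ' → Γ' = Γ) ∧
      ∃ (m : Operations ℝ C.rumin C.rumin) (f : Operations ℝ C.rumin (deRham E M)),
        -- the operations on the Rumin spaces
        (∀ a : C.rumin, (m 1 ![a] : deRham E M) = deRham.d a) ∧
        (∀ a b : C.rumin,
          (m 2 ![a, b] : deRham E M) = ContactStructure.proj Γ (deRham.wedge a b)) ∧
        (∀ (p : ℤ) (a b c : C.rumin), a ∈ C.ruminGrading p →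
          (m 3 ![a, b, c] : deRham E M) = ContactStructure.proj Γ
            (deRham.wedge (Γ (deRham.wedge a b)) c -
              Int.negOnePow p • deRham.wedge a (Γ (deRham.wedge b c)))) ∧
        (∀ k : ℕ, 4 ≤ k → m k = 0) ∧
        -- the components of the morphism to the de Rham algebra
        (∀ a : C.rumin, f 1 ![a] = a) ∧
        (∀ a b : C.rumin, f 2 ![a, b] = -Γ (deRham.wedge a b)) ∧
        (∀ k : ℕ, 3 ≤ k → f k = 0) ∧
        -- the conclusions
        IsCInfinityAlgebra C.ruminGrading m ∧
        IsCInfinityAlgebra deRham.grading (deRham.operations (E := E) (M := M)) ∧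
        IsCInfinityQuasiIso C.ruminGrading m deRham.grading deRham.operations f := by
  have H := C.isVerticalHomotopy_gamma hE
  have hR := C.isRuminSubspace hE
  have m1 : ∀ a, deRham.operations (E := E) (M := M) 1 ![a] = deRham.d a := fun _ => rfl
  have m2 : ∀ a b, deRham.operations (E := E) (M := M) 2 ![a, b] = a * b := fun _ _ => rfl
  have hm : ∀ k, 3 ≤ k → deRham.operations (E := E) (M := M) k = 0 := fun k hk => by
    match k, hk with
    | k + 3, _ => rfl
  have hΓ := ContactStructure.isLefschetzInverse_gamma (C := C) hE
  exact ⟨C.gamma hE, hΓ, fun Γ' h => h.unique hΓ, H.operations hR,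
    ruminInclusion (C.gamma hE) C.rumin, H.operations_one hR, H.operations_two hR,
    fun p a b c ha => H.operations_three hR a b c ((hR.mem_iff p a).1 ha).1,
    fun k hk => H.operations_eq_zero hR hk, fun _ => rfl, fun _ _ => rfl,
    fun k hk => ruminInclusion_eq_zero _ _ hk, H.isCInfinityAlgebra_operations hR,
    deRham.isCommDGA.isCInfinityAlgebra m1 m2 hm, H.isCInfinityQuasiIso_inclusion hR m1 m2 hm⟩

end
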